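/- Let $\mathcal{O}$ be a complete discrete valuation ring with finite residue field $\mathbb{F}_q$ and uniformiser $\pi$, let $\mathcal{O}^{\mathrm{ur}}$ be the ring of integers of the maximal unramified extension of $\mathrm{Frac}(\mathcal{O})$, let $r>1$, $\mathcal{O}^{\mathrm{ur}}_r=\mathcal{O}^{\mathrm{ur}}/\pi^r$, and put $l=\lceil r/2\rceil$, $l'=\lfloor r/2\rfloor$. Let $G=\mathrm{GL}_n(\mathcal{O}^{\mathrm{ur}}_r)$ and let $F\colon G\to G$ be the Frobenius endomorphism, which applies to every matrix entry the automorphism of $\mathcal{O}^{\mathrm{ur}}_r$ induced by the Frobenius automorphism of $\mathcal{O}^{\mathrm{ur}}$ over $\mathcal{O}$. Let $\mathbf{T}$ be a maximal torus of the group scheme $\mathrm{GL}_n$ over $\mathcal{O}^{\mathrm{ur}}_r$ whose group of points $T=\mathbf{T}(\mathcal{O}^{\mathrm{ur}}_r)\subseteq G$ satisfies $F(T)=T$, let $\Phi$ be its set of roots, and let $\ell\neq\mathrm{char}(\mathbb{F}_q)$ be a prime. For a subgroup $H\subseteq G$ let $H^i$ be the kernel of reduction modulo $\pi^i$ on $H$.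 For $\alpha\in\Phi$ let $U_\alpha\subseteq G$ be the root subgroup, let $T^\alpha\subseteq T$ be the image of the coroot of $\alpha$, and let $\mathcal{T}^\alpha=(T^\alpha)^{r-1}$. Let $U^{\pm}$ be the subgroup of the abelian group $G^l$ generated by the $(U_\alpha)^l$, $\alpha\in\Phi$, so that $TG^l=TU^\pm$ and $TG^l/U^\pm\cong T$. Let $\mathrm{Irr}(T^F)=\mathrm{Hom}(T^F,\overline{\mathbb{Q}}_\ell^\times)$ be the set of irreducible characters of the finite abelian group $T^F$. A character $\theta\in\mathrm{Irr}(T^F)$ is called: * in general position, if no non-trivial element of $(N_G(T)/T)^F$ fixes $\theta$; * regular, if for every $\alpha\in\Phi$ it is non-trivial on $\{\,t\,F(t)\cdots F^{a-1}(t) : t\in(\mathcal{T}^\alpha)^{F^a}\}$, where $a>0$ is an integer such that $F^a\mathcal{T}^\alpha=\mathcal{T}^\alpha$ for all $\alpha\in\Phi$ (the condition does not depend on the choice of $a$); * generic, if it is regular and in general position; * strongly generic, if it is generic and $\mathrm{Stab}_{G^F}(\widetilde\theta|_{(G^l)^F})=(TG^{l'})^F$, where $\widetilde\theta$ is the inflation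 of $\theta$ to $(TG^l)^F$ via $TG^l/U^\pm\cong T$. Then for every $\theta\in\mathrm{Irr}(T^F)$, $$\theta\text{ is regular}\iff\theta\text{ is generic}\iff\theta\text{ is strongly generic}.$$ Moreover, applying the same definitions with $F^m$ in place of $F$ for $m\geq 1$, $$\lim_{m\to\infty}\frac{\#\{\theta\in\mathrm{Irr}(T^{F^m}) : \theta\text{ is strongly generic}\}}{\#\,\mathrm{Irr}(T^{F^m})}=1.$$ -/

import Mathlib

open scoped MatrixGroups TensorProduct
open Matrix

noncomputable section

/-! ### The maximal unramified extension and the rings `𝒪^ur_r` -/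

section Unramified

variable (O : Type*) [CommRing O] [IsDomain O]

/-- The maximal unramified extension of `K = Frac 𝒪` inside an algebraic closure of `K`: the
compositum of all finite extensions `L / K` whose ring of integers (the integral closure of `𝒪`
in `L`) is unramified over `𝒪`. -/
def maxUnramifiedExt :
    IntermediateField (FractionRing O) (AlgebraicClosure (FractionRing O)) :=
  sSup {L | FiniteDimensional (FractionRing O) L ∧
    Algebra.FormallyUnramified O (integralClosure O L)}

/-- `𝒪^ur`, the ring of integers of the maximal unramified extension. -/
abbrev UnramifiedIntegers : Type _ := integralClosure O (maxUnramifiedExt O)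

variable [IsLocalRing O]

/-- The ideal `π 𝒪^ur` generated by the maximal ideal of `𝒪`. -/
def unramifiedIdeal : Ideal (UnramifiedIntegers O) :=
  (IsLocalRing.maximalIdeal O).map (algebraMap O (UnramifiedIntegers O))

/-- `𝒪^ur_r = 𝒪^ur / π^r`. -/
abbrev UnramifiedLevel (r : ℕ) : Type _ := UnramifiedIntegers O ⧸ unramifiedIdeal O ^ r

/-- The ideal generated by `π` in `𝒪^ur_r`. -/
def levelIdeal (r : ℕ) : Ideal (UnramifiedLevel O r) :=
  (unramifiedIdeal O).map (Ideal.Quotient.mk (unramifiedIdeal O ^ r))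

variable {O}

/-- `φ` is the Frobenius automorphism of `𝒪^ur` over `𝒪`: it induces `x ↦ x ^ q` on the
residue field, where `q` is the cardinality of the residue field of `𝒪`. -/
def IsFrobenius (φ : UnramifiedIntegers O ≃ₐ[O] UnramifiedIntegers O) : Prop :=
  (φ : UnramifiedIntegers O →ₐ[O] UnramifiedIntegers O).IsArithFrobAt (unramifiedIdeal O)

theorem unramifiedIdeal_pow_map (φ : UnramifiedIntegers O ≃ₐ[O] UnramifiedIntegers O) (r : ℕ) :
    unramifiedIdeal O ^ r = (unramifiedIdeal O ^ r).map φ.toRingEquiv.toRingHom := by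
  rw [Ideal.map_pow, unramifiedIdeal, Ideal.map_map]
  congr 2
  exact RingHom.ext fun x => (φ.commutes x).symm

/-- The automorphism of `𝒪^ur_r` induced by an automorphism of `𝒪^ur`. -/
def levelAut (φ : UnramifiedIntegers O ≃ₐ[O] UnramifiedIntegers O) (r : ℕ) :
    UnramifiedLevel O r ≃+* UnramifiedLevel O r :=
  Ideal.quotientEquiv _ _ φ.toRingEquiv (unramifiedIdeal_pow_map φ r)

/-- The endomorphism `F` of `G = GL_n(𝒪^ur_r)` that applies the given automorphism to every matrix
entry; for the Frobenius automorphism of `𝒪^ur` it is the geometric Frobenius endomorphism of `G`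
attached to the group `GL_n` over `𝒪_r`. -/
def frobEnd (φ : UnramifiedIntegers O ≃ₐ[O] UnramifiedIntegers O) (r n : ℕ) :
    Monoid.End (GL (Fin n) (UnramifiedLevel O r)) :=
  GeneralLinearGroup.map (levelAut φ r).toRingHom

end Unramified

/-! ### Maximal tori of `GL_n`, their roots and coroots -/

/-- The coordinate ring `R[ℤ^n]` of the split torus `𝔾_m^n` over `R`, with its character lattice
`ℤ^n`. -/
abbrev TorusRing (n : ℕ) (R : Type*) [CommRing R] : Type _ := AddMonoidAlgebra R (Fin n → ℤ)

/-- The character of `𝔾_m^n` with exponent vector `χ`, as a regular function. -/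
def torusChar {n : ℕ} (R : Type*) [CommRing R] (χ : Fin n → ℤ) : TorusRing n R :=
  AddMonoidAlgebra.single χ 1

/-- A (split) maximal torus `𝐓` of the group scheme `GL_n` over `R`: a closed immersion of group
schemes `𝔾_m^n → GL_n`. It is given by its universal point `u ∈ GL_n(R[ℤ^n])`; that the morphism
is a homomorphism of group schemes says that `u` is multiplicative for the comultiplication and
counit of `R[ℤ^n]`, and that it is a closed immersion says that the entries of `u` and of `u⁻¹`
generate the algebra `R[ℤ^n]`. Over a strictly Henselian local ring such as `𝒪^ur_r` every torus
is split, and the maximal tori of `GL_n` are the tori of rank `n`. -/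
structure MaximalTorus (n : ℕ) (R : Type*) [CommRing R] where
  /-- The universal point. -/
  u : GL (Fin n) (TorusRing n R)
  comul_u : ∀ i j, Coalgebra.comul (R := R) (u.val i j) =
    ∑ k, u.val i k ⊗ₜ[R] u.val k j
  counit_u : ∀ i j, Coalgebra.counit (R := R) (u.val i j) =
    (1 : Matrix (Fin n) (Fin n) R) i j
  adjoin_u : Algebra.adjoin R
    ({x | ∃ i j, x = u.val i j} ∪
      {x | ∃ i j, x = u⁻¹.val i j}) = ⊤

namespace MaximalTorus

variable {n : ℕ} {R : Type*} [CommRing R]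

/-- The evaluation `R[ℤ^n] → R` at the `R`-point `c ∈ Hom(ℤ^n, Rˣ)` of `𝔾_m^n`. -/
def evalHom (c : Multiplicative (Fin n → ℤ) →* Rˣ) : TorusRing n R →ₐ[R] R :=
  AddMonoidAlgebra.lift R R (Fin n → ℤ) ((Units.coeHom R).comp c)

theorem evalHom_torusChar (c : Multiplicative (Fin n → ℤ) →* Rˣ) (χ : Fin n → ℤ) :
    evalHom c (torusChar R χ) = c (Multiplicative.ofAdd χ) := by
  simp [evalHom, torusChar]

theorem evalHom_one : evalHom (1 : Multiplicative (Fin n → ℤ) →* Rˣ) =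
    Bialgebra.counitAlgHom R (TorusRing n R) := by
  apply AddMonoidAlgebra.algHom_ext
  · intro χ; simp [evalHom]
  · exact Subsingleton.elim _ _

theorem evalHom_mul (c d : Multiplicative (Fin n → ℤ) →* Rˣ) :
    evalHom (c * d) = (Algebra.TensorProduct.lift (evalHom c) (evalHom d)
      (fun _ _ => Commute.all _ _)).comp (Bialgebra.comulAlgHom R (TorusRing n R)) := by
  apply AddMonoidAlgebra.algHom_ext
  · intro χ; simp [evalHom]
  · exact Subsingleton.elim _ _

variable (T : MaximalTorus n R)

/-- The homomorphism `𝔾_m^n(R) → GL_n(R)` on `R`-points. -/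
def pointHom : (Multiplicative (Fin n → ℤ) →* Rˣ) →* GL (Fin n) R where
  toFun c := GeneralLinearGroup.map (evalHom c).toRingHom T.u
  map_one' := by
    ext i j
    simpa [evalHom_one] using T.counit_u i j
  map_mul' c d := by
    ext i j
    simp [evalHom_mul, T.comul_u, Matrix.mul_apply]

/-- `T = 𝐓(R)` as a subgroup of `GL_n(R)`. -/
def points : Subgroup (GL (Fin n) R) := T.pointHom.range

/-- The weight space `𝔤_α ⊆ 𝔤 = M_n(R)` of a character `α` of `𝐓` for the adjoint action: the
`X` with `u X u⁻¹ = α X`. -/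
def weightSpace (α : Fin n → ℤ) : Set (Matrix (Fin n) (Fin n) R) :=
  {X | T.u.val * X.map (algebraMap R (TorusRing n R)) =
    torusChar R α • (X.map (algebraMap R (TorusRing n R)) * T.u.val)}

/-- `α ∈ Φ`: the roots are the non-zero characters of `𝐓` with a non-zero weight space in `𝔤`. -/
def IsRoot (α : Fin n → ℤ) : Prop := α ≠ 0 ∧ ∃ X ∈ T.weightSpace α, X ≠ 0

/-- The map `χ ↦ χ - ⟨χ, v⟩ α` on characters. -/
def reflection (α v : Fin n → ℤ) : (Fin n → ℤ) →+ (Fin n → ℤ) where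
  toFun χ := χ - (χ ⬝ᵥ v) • α
  map_zero' := by simp
  map_add' χ ψ := by rw [add_dotProduct, add_smul]; abel

/-- The cocharacter `v` is the coroot of `α`: `⟨α, v⟩ = 2`, and the reflection
`χ ↦ χ - ⟨χ, v⟩ α` is the action on the characters of `𝐓` of an element of the Weyl group, that is,
of conjugation by some `w ∈ GL_n(R)` that normalizes `𝐓`. -/
def IsCoroot (α v : Fin n → ℤ) : Prop :=
  α ⬝ᵥ v = 2 ∧ ∃ w : GL (Fin n) R,
    GeneralLinearGroup.map (algebraMap R (TorusRing n R)) w * T.u *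
        (GeneralLinearGroup.map (algebraMap R (TorusRing n R)) w)⁻¹ =
      GeneralLinearGroup.map
        (AddMonoidAlgebra.mapDomainAlgHom R R (reflection α v)).toRingHom T.u

/-- The point of `T` with coordinates `χ ↦ s ^ ⟨χ, v⟩`: the value at `s` of the cocharacter `v`. -/
def cochar (v : Fin n → ℤ) (s : Rˣ) : GL (Fin n) R :=
  T.pointHom
    { toFun := fun χ => s ^ (Multiplicative.toAdd χ ⬝ᵥ v)
      map_one' := by simp
      map_mul' := fun χ ψ => by rw [toAdd_mul, add_dotProduct, _root_.zpow_add] }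

/-- `T^α ⊆ T`: the image of the coroot of `α`. -/
def corootImage (α : Fin n → ℤ) : Set (GL (Fin n) R) :=
  {g | ∃ v, T.IsCoroot α v ∧ ∃ s : Rˣ, g = T.cochar v s}

/-- `F T = T`. -/
def IsStable (F : Monoid.End (GL (Fin n) R)) : Prop := T.points.map F = T.points

end MaximalTorus

/-! ### Conditions on characters of `T^F` -/

/-- The subgroup of fixed points of `F` on `H`. -/
def fixedSubgroup {G : Type*} [Group G] (H : Subgroup G) (F : Monoid.End G) : Subgroup G where
  carrier := {g | g ∈ H ∧ F g = g}
  one_mem' := ⟨H.one_mem, map_one F⟩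
  mul_mem' := fun ha hb => ⟨H.mul_mem ha.1 hb.1, by rw [map_mul, ha.2, hb.2]⟩
  inv_mem' := fun {a} ha => ⟨H.inv_mem ha.1, by
    have h : F a⁻¹ * F a = 1 := by rw [← map_mul, inv_mul_cancel, map_one]
    rw [ha.2] at h
    exact eq_inv_of_mul_eq_one_left h⟩

/-- The congruence subgroup `G^i`: the kernel of the reduction modulo `I^i`. -/
def congruenceSubgroup (n : ℕ) {R : Type*} [CommRing R] (I : Ideal R) (i : ℕ) :
    Subgroup (GL (Fin n) R) :=
  (GeneralLinearGroup.map (n := Fin n) (Ideal.Quotient.mk (I ^ i))).ker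

/-- The norm `t · F(t) ⋯ F^{a-1}(t)`. -/
def frobNorm {G : Type*} [Group G] (F : Monoid.End G) (a : ℕ) (t : G) : G :=
  ((List.range a).map fun d => (F ^ d) t).prod

section Conditions

variable {n : ℕ} {R : Type*} [CommRing R] (I : Ideal R) (r : ℕ)
  (T : MaximalTorus n R) (F : Monoid.End (GL (Fin n) R)) {E : Type*} [Field E]

/-- `Irr(T^F)`: as `T^F` is a finite abelian group, its irreducible characters over an
algebraically closed field `E` of characteristic zero are the homomorphisms to `Eˣ`. -/
abbrev TorusIrr (E : Type*) [Field E] : Type _ := fixedSubgroup T.points F →* Eˣ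

variable {T F}

/-- `θ` is in general position: no non-trivial element of `(N_G(T)/T)^F` fixes `θ`. A coset `wT`
is fixed by `F` if and only if `w⁻¹ F(w) ∈ T`. (The membership `h'` holds automatically.) -/
def InGeneralPosition (θ : TorusIrr T F E) : Prop :=
  ∀ w ∈ Subgroup.normalizer (T.points : Set (GL (Fin n) R)), w⁻¹ * F w ∈ T.points →
    (∀ (t : GL (Fin n) R) (h : t ∈ fixedSubgroup T.points F)
      (h' : w * t * w⁻¹ ∈ fixedSubgroup T.points F), θ ⟨w * t * w⁻¹, h'⟩ = θ ⟨t, h⟩) →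
    w ∈ T.points

/-- `𝒯^α = (T^α)^{r-1}`: the elements of `T^α` that are trivial modulo `I^{r-1}`. -/
def topCorootImage (T : MaximalTorus n R) (α : Fin n → ℤ) : Set (GL (Fin n) R) :=
  T.corootImage α ∩ congruenceSubgroup n I (r - 1)

/-- `θ` is regular: it is non-trivial on the norms of `(𝒯^α)^{F^a}` for every root `α`, where
`a > 0` is such that `F^a 𝒯^α = 𝒯^α` for every root `α`. (The condition does not depend on `a`;
the membership `h` holds automatically.) -/
def IsRegularChar (θ : TorusIrr T F E) : Prop :=
  ∃ a : ℕ, 0 < a ∧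
    (∀ α, T.IsRoot α → (F ^ a) '' topCorootImage I r T α = topCorootImage I r T α) ∧
    ∀ α, T.IsRoot α → ∃ t ∈ topCorootImage I r T α, (F ^ a) t = t ∧
      ∃ h : frobNorm F a t ∈ fixedSubgroup T.points F, θ ⟨frobNorm F a t, h⟩ ≠ 1

/-- `θ` is generic: it is regular and in general position. -/
def IsGenericChar (θ : TorusIrr T F E) : Prop :=
  IsRegularChar I r θ ∧ InGeneralPosition θ

variable (T) in
/-- `U^± = U^i (U^-)^i` for `2 i ≥ r`: the subgroup of the abelian group `G^i` generated by the
root subgroups `(U_α)^i`, `α ∈ Φ`. In `GL_n` the root subgroup `U_α` consists of the `1 + X` with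
`X ∈ 𝔤_α`. -/
def rootCongruenceSubgroup (i : ℕ) : Subgroup (GL (Fin n) R) :=
  Subgroup.closure {g | g ∈ congruenceSubgroup n I i ∧
    ∃ α, T.IsRoot α ∧ (g : Matrix (Fin n) (Fin n) R) - 1 ∈ T.weightSpace α}

/-- `χ : (TG^i)^F → Eˣ` is the inflation of `θ` via `TG^i / U^± ≅ T`: it restricts to `θ` on `T^F`
and is trivial on `(U^±)^F`. -/
def IsInflation (i : ℕ) (θ : TorusIrr T F E)
    (χ : fixedSubgroup (T.points ⊔ congruenceSubgroup n I i) F →* Eˣ) : Prop :=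
  (∀ (x : fixedSubgroup (T.points ⊔ congruenceSubgroup n I i) F)
      (hx : (x : GL (Fin n) R) ∈ fixedSubgroup T.points F), χ x = θ ⟨x, hx⟩) ∧
  (∀ x : fixedSubgroup (T.points ⊔ congruenceSubgroup n I i) F, (x : GL (Fin n) R) ∈ rootCongruenceSubgroup I T i → χ x = 1)

/-- The restriction of a character of `(TG^i)^F` to `(G^i)^F`. -/
def resCongruence (i : ℕ)
    (χ : fixedSubgroup (T.points ⊔ congruenceSubgroup n I i) F →* Eˣ) :
    fixedSubgroup (congruenceSubgroup n I i) F →* Eˣ :=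
  χ.comp (Subgroup.inclusion fun _ hx => ⟨Subgroup.mem_sup_right hx.1, hx.2⟩)

theorem conj_mem_fixed_congruence {i : ℕ} {g x : GL (Fin n) R} (hg : F g = g)
    (hx : x ∈ fixedSubgroup (congruenceSubgroup n I i) F) :
    g * x * g⁻¹ ∈ fixedSubgroup (congruenceSubgroup n I i) F := by
  have hg' : F g⁻¹ = g⁻¹ :=
    ((fixedSubgroup (⊤ : Subgroup (GL (Fin n) R)) F).inv_mem ⟨Subgroup.mem_top g, hg⟩).2
  refine ⟨(MonoidHom.normal_ker _).conj_mem x hx.1 g, ?_⟩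
  rw [map_mul, map_mul, hg, hx.2, hg']

/-- The stabiliser in `G^F` of a character of `(G^i)^F`, for the conjugation action. -/
def charStabiliser (i : ℕ) (χ : fixedSubgroup (congruenceSubgroup n I i) F →* Eˣ) :
    Set (GL (Fin n) R) :=
  {g | ∃ hg : F g = g, ∀ x : fixedSubgroup (congruenceSubgroup n I i) F,
    χ ⟨g * x * g⁻¹, conj_mem_fixed_congruence I hg x.2⟩ = χ x}

/-- The stabiliser condition `Stab_{G^F}(θ̃|_{(G^l)^F}) = (TG^{l'})^F`, where `l = ⌈r/2⌉`,
`l' = ⌊r/2⌋` and `θ̃` is the inflation of `θ` to `(TG^l)^F`. -/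
def StabiliserCondition (θ : TorusIrr T F E) : Prop :=
  ∃ χ : fixedSubgroup (T.points ⊔ congruenceSubgroup n I ((r + 1) / 2)) F →* Eˣ,
    IsInflation I ((r + 1) / 2) θ χ ∧
    charStabiliser I ((r + 1) / 2) (resCongruence I ((r + 1) / 2) χ) =
      fixedSubgroup (T.points ⊔ congruenceSubgroup n I (r / 2)) F

/-- `θ` is strongly generic: it is generic and satisfies the stabiliser condition. -/
def IsStronglyGenericChar (θ : TorusIrr T F E) : Prop :=
  IsGenericChar I r θ ∧ StabiliserCondition I r θ

end Conditions

end

/-! Characters are turned into matrices by a trace pairing. Regularity of a character then says that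
a diagonal matrix has distinct eigenvalues modulo π, and both general position and the stabiliser
condition follow from that.

Frame. Comultiplicativity makes the coefficient matrices of the universal point orthogonal
idempotents, and the closed immersion condition makes the weights generate ℤ^n. Over a local ring
this forces exactly n weights, forming a basis χ of ℤ^n, so T is conjugate to the diagonal torus
(`MaximalTorus.exists_frame`). In this frame the roots are the χ i - χ j with i ≠ j, the set 𝒯^α
consists of the 1 + s(E_i - E_j) with s ∈ (π^(r-1)), and F permutes the idempotents E_i
(`exists_permutesIdempotents`).

Duality. The ring of Frobenius-fixed points is finite and each of its non-zero elements divides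
π^(r-1), so all its additive characters are multiples of a single Ψ. Hence θ on T^F ∩ G^l is 1 + X ↦
Ψ(tr(BX)) for an F-fixed B = g diag(b) g⁻¹ (`IsTruncated.exists_dual`). If b i - b j lay in (π), θ
would be trivial on the norms attached to χ i - χ j; so for regular θ every b i - b j is a unit. If
x fixes θ or its inflation, non-degeneracy gives x⁻¹Bx ≡ B modulo π^(r-l). Comparing entries of Bx
and xB, the off-diagonal entries of x in the frame lie in (π^(r-l)), where r - l = l'. For x in the
normaliser this forces x ∈ T; for general x ∈ G^F it says x ∈ TG^(l').

Counting. With Q = q^m, the norm on (𝒯^α)^(F^a) has a source of Q^a elements and a kernel contained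
in the zeros of an additive polynomial of degree at most Q^(a-1). Its image therefore has at least Q
elements, and at most a fraction 1/Q of all characters is trivial on it. Summing over pairs (i, j),
the proportion of non-regular characters is at most n²/q^m.

Arithmetic. It remains to see that 𝒪^ur is local with maximal ideal (π), and that y^(q^a) = y has
q^a solutions in its residue field. Lifting an irreducible residual polynomial of degree f yields a
ring 𝒪[θ] (θ now a root of the lift) which is unramified and contains every element of K(θ) integral
over 𝒪, K being the fraction field of 𝒪. Any finite unramified extension is generated by solutions
of z^(q^f) = z, all of which Hensel's lemma puts into such an 𝒪[θ]; so 𝒪^ur is the union of these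
rings. -/

noncomputable section

/-! ### Diagonalisation of a split maximal torus over a local ring -/

namespace MaximalTorus

section Components

variable {n : ℕ} {R : Type*} [CommRing R] (T : MaximalTorus n R)

/-- The coefficient matrix of the character `χ` in the universal point. -/
def component (χ : Fin n → ℤ) : Matrix (Fin n) (Fin n) R :=
  Matrix.of fun i j => (T.u.val i j).coeff χ

/-- The coefficient functional of `χ` on `R[ℤ^n]`. -/
def coeffFunctional (R : Type*) [CommRing R] (χ : Fin n → ℤ) : TorusRing n R →ₗ[R] R :=
  (Finsupp.lapply χ).comp (AddMonoidAlgebra.coeffLinearEquiv R).toLinearMap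

theorem coeffFunctional_apply (χ : Fin n → ℤ) (x : TorusRing n R) :
    coeffFunctional R χ x = x.coeff χ := rfl

/-- Characters are group-like: the comultiplication of `single m a` involves only m ⊗ m, so mixed
coefficients vanish. -/
theorem coeff_comul (χ ψ : Fin n → ℤ) (x : TorusRing n R) :
    LinearMap.mul' R R (TensorProduct.map (coeffFunctional R χ) (coeffFunctional R ψ)
      (Coalgebra.comul x)) = if χ = ψ then x.coeff χ else 0 := by
  induction x using AddMonoidAlgebra.induction_linear with
  | zero => simp
  | add x y hx hy => rw [map_add, map_add, map_add, hx, hy]; split_ifs <;> simp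
  | single m a =>
    rw [AddMonoidAlgebra.comul_single]
    simp only [CommSemiring.comul_apply, TensorProduct.map_tmul, coeffFunctional_apply,
      AddMonoidAlgebra.coeff_single,
      LinearMap.mul'_apply, AddMonoidAlgebra.lsingle_apply, Finsupp.single_apply]
    split_ifs <;> simp_all

/-- Comparing the coefficients of χ ⊗ ψ in `comul_u` gives the relations of orthogonal idempotents.
-/
theorem component_mul (χ ψ : Fin n → ℤ) :
    T.component χ * T.component ψ = if χ = ψ then T.component χ else 0 := by
  ext i j
  have h := congrArg (fun z => LinearMap.mul' R R
    (TensorProduct.map (coeffFunctional R χ) (coeffFunctional R ψ) z)) (T.comul_u i j)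
  simp only [coeff_comul, map_sum, TensorProduct.map_tmul, LinearMap.mul'_apply,
    coeffFunctional_apply] at h
  simp only [Matrix.mul_apply, component, Matrix.of_apply]
  rw [← h]
  split_ifs <;> simp

/-- The characters that occur in the universal point. -/
def weights : Finset (Fin n → ℤ) :=
  open Classical in
  (Finset.univ.biUnion fun ij : Fin n × Fin n => (T.u.val ij.1 ij.2).coeff.support).filter
    fun χ => T.component χ ≠ 0

theorem component_eq_zero_of_notMem {χ : Fin n → ℤ} (h : χ ∉ T.weights) : T.component χ = 0 := by
  classical
  by_contra h0
  apply h
  simp only [weights, Finset.mem_filter, Finset.mem_biUnion, Finset.mem_univ, true_and]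
  refine ⟨?_, h0⟩
  by_contra h1
  push Not at h1
  apply h0
  ext i j
  simpa [component] using h1 (i, j)

theorem mem_weights {χ : Fin n → ℤ} : χ ∈ T.weights ↔ T.component χ ≠ 0 := by
  classical
  refine ⟨fun h => (Finset.mem_filter.1 h).2, fun h => ?_⟩
  by_contra h'
  exact h (T.component_eq_zero_of_notMem h')

theorem u_apply (i j : Fin n) :
    T.u.val i j = ∑ χ ∈ T.weights, AddMonoidAlgebra.single χ (T.component χ i j) := by
  classical
  ext ψ
  rw [AddMonoidAlgebra.coeff_sum, Finsupp.finsetSum_apply]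
  simp only [AddMonoidAlgebra.coeff_single, Finsupp.single_apply, Finset.sum_ite_eq']
  split_ifs with h
  · rfl
  · exact congrFun (congrFun (T.component_eq_zero_of_notMem h) i) j

/-- Let H be the group generated by the weights. The quotient map and the zero map ℤ^n → ℤ^n/H
induce algebra maps that agree on the universal point, hence on the algebra generated by its entries
and those of its inverse, which is everything. So every character is trivial in ℤ^n/H. -/
theorem closure_weights : AddSubgroup.closure (T.weights : Set (Fin n → ℤ)) = ⊤ ∨ Subsingleton R := by
  classical
  by_cases hR : Subsingleton R
  · exact Or.inr hR
  rw [not_subsingleton_iff_nontrivial] at hR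
  left
  set H := AddSubgroup.closure (T.weights : Set (Fin n → ℤ))
  let f₁ : TorusRing n R →ₐ[R] AddMonoidAlgebra R ((Fin n → ℤ) ⧸ H) :=
    AddMonoidAlgebra.mapDomainAlgHom R R (QuotientAddGroup.mk' H)
  let f₂ : TorusRing n R →ₐ[R] AddMonoidAlgebra R ((Fin n → ℤ) ⧸ H) :=
    AddMonoidAlgebra.mapDomainAlgHom R R (0 : (Fin n → ℤ) →+ ((Fin n → ℤ) ⧸ H))
  have hu : GeneralLinearGroup.map f₁.toRingHom T.u = GeneralLinearGroup.map f₂.toRingHom T.u := by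
    apply Units.ext
    ext1 i j
    change f₁ (T.u.val i j) = f₂ (T.u.val i j)
    rw [T.u_apply, map_sum, map_sum]
    refine Finset.sum_congr rfl fun χ hχ => ?_
    have : (QuotientAddGroup.mk' H χ) = 0 :=
      (QuotientAddGroup.eq_zero_iff χ).2 (AddSubgroup.subset_closure hχ)
    simp only [f₁, f₂, AddMonoidAlgebra.mapDomainAlgHom_apply, AddMonoidAlgebra.mapDomain_single,
      this, AddMonoidHom.zero_apply]
  have hf : f₁ = f₂ := by
    refine AlgHom.ext_of_adjoin_eq_top T.adjoin_u ?_
    rintro x (⟨i, j, rfl⟩ | ⟨i, j, rfl⟩)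
    · exact congrArg (fun w : GL (Fin n) _ => w.val i j) hu
    · have := congrArg (fun w : GL (Fin n) (AddMonoidAlgebra R ((Fin n → ℤ) ⧸ H)) => w⁻¹) hu
      simp only [← map_inv] at this
      exact congrArg (fun w : GL (Fin n) _ => w.val i j) this
  rw [eq_top_iff]
  intro ψ _
  have h := congrArg (fun f => f (AddMonoidAlgebra.single ψ (1 : R))) hf
  simp only [f₁, f₂, AddMonoidAlgebra.mapDomainAlgHom_apply, AddMonoidAlgebra.mapDomain_single,
      AddMonoidHom.zero_apply] at h
  rw [AddMonoidAlgebra.single_left_inj one_ne_zero] at h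
  exact (QuotientAddGroup.eq_zero_iff ψ).1 h

end Components

end MaximalTorus

/-- If no entry were a unit, P would vanish modulo the maximal ideal; then 1 - P would be
invertible, and (1 - P)P = 0 would give P = 0. -/
theorem exists_isUnit_apply_of_isIdempotentElem {n : ℕ} {R : Type*} [CommRing R] [IsLocalRing R]
    {P : Matrix (Fin n) (Fin n) R} (hP : P * P = P) (h0 : P ≠ 0) : ∃ i j, IsUnit (P i j) := by
  by_contra! h
  have hmap : P.map (IsLocalRing.residue R) = 0 := by
    ext i j
    simpa using h i j
  have hdet : IsUnit (1 - P).det := by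
    rw [← IsLocalRing.residue_ne_zero_iff_isUnit, RingHom.map_det, map_sub, map_one]
    simp only [RingHom.mapMatrix_apply, hmap, sub_zero, det_one, ne_eq, one_ne_zero,
      not_false_eq_true]
  rw [← Matrix.isUnit_iff_isUnit_det] at hdet
  apply h0
  rw [← hdet.mul_left_eq_zero, mul_sub, mul_one, hP, sub_self]

namespace MaximalTorus

variable {n : ℕ} {R : Type*} [CommRing R] [IsLocalRing R] (T : MaximalTorus n R)

/-- Over a local ring, a split maximal torus of `GL_n` is conjugate to the diagonal torus. -/
theorem exists_frame : ∃ (g : GL (Fin n) R) (χ : Module.Basis (Fin n) ℤ (Fin n → ℤ)),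
    T.u.val * g.val.map (algebraMap R (TorusRing n R)) =
      g.val.map (algebraMap R (TorusRing n R)) * diagonal fun i => torusChar R (χ i) := by
  classical
  have hunit : ∀ χ : T.weights, ∃ i j, IsUnit (T.component χ i j) := fun χ =>
    exists_isUnit_apply_of_isIdempotentElem (by simpa using T.component_mul χ χ)
      (T.mem_weights.1 χ.2)
  choose a b hab using hunit
  -- A column of the idempotent that contains a unit entry: an eigenvector of weight χ that stays
  -- non-zero over the residue field.
  let v : T.weights → Fin n → R := fun χ i => T.component χ i (b χ)
  have hv : ∀ (ψ : Fin n → ℤ) (χ : T.weights),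
      T.component ψ *ᵥ v χ = if ψ = χ then v χ else 0 := by
    intro ψ χ
    ext i
    have := congrFun (congrFun (T.component_mul ψ χ) i) (b χ)
    rw [Matrix.mul_apply] at this
    simp only [Matrix.mulVec, dotProduct, v, this]
    split_ifs with h
    · rw [h]
    · rfl
  let res := IsLocalRing.residue R
  let vb : T.weights → Fin n → IsLocalRing.ResidueField R := fun χ i => res (v χ i)
  have hvb : LinearIndependent (IsLocalRing.ResidueField R) vb := by
    rw [Fintype.linearIndependent_iff]
    intro c hc ψ
    -- Applying the idempotent of ψ to a linear relation isolates its ψ-term.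
    have h1 : ((T.component ψ).map res) *ᵥ (∑ χ, c χ • vb χ) = c ψ • vb ψ := by
      rw [Matrix.mulVec_sum, Finset.sum_eq_single ψ]
      · rw [Matrix.mulVec_smul]
        congr 1
        ext i
        have := congrArg res (congrFun (hv ψ ψ) i)
        simp only [if_pos] at this
        rw [RingHom.map_mulVec] at this
        exact this
      · intro χ _ hχ
        have : ((T.component ψ).map res) *ᵥ vb χ = 0 := by
          ext i
          have := congrArg res (congrFun (hv ψ χ) i)
          rw [if_neg (fun h => hχ (Subtype.ext h.symm)), RingHom.map_mulVec] at this
          simpa using! this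
        rw [Matrix.mulVec_smul, this, smul_zero]
      · simp
    rw [hc, Matrix.mulVec_zero] at h1
    have h2 := congrFun h1.symm (a ψ)
    simp only [Pi.smul_apply, Pi.zero_apply, smul_eq_mul, mul_eq_zero] at h2
    exact h2.resolve_right ((IsLocalRing.residue_ne_zero_iff_isUnit _).2 (hab ψ))
  -- Independence over the residue field allows at most n weights, and generation of ℤ^n needs at
  -- least n; so the weights form a basis.
  have hle : T.weights.card ≤ n := by
    simpa using hvb.fintype_card_le_finrank
  have hcl : AddSubgroup.closure (T.weights : Set (Fin n → ℤ)) = ⊤ :=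
    T.closure_weights.resolve_right (not_subsingleton R)
  have hspan : Submodule.span ℤ (T.weights : Set (Fin n → ℤ)) = ⊤ := by
    apply Submodule.toAddSubgroup_injective
    rw [Submodule.span_int_eq_addSubgroupClosure, hcl]
    rfl
  have hge : n ≤ T.weights.card := by
    have := finrank_span_finset_le_card (R := ℤ) T.weights
    rw [Set.finrank, hspan, finrank_top] at this
    simpa using this
  have hcard : Fintype.card (Fin n) = Fintype.card T.weights := by
    simp [le_antisymm hle hge]
  let e : Fin n ≃ T.weights := Fintype.equivOfCardEq hcard
  let χ : Module.Basis (Fin n) ℤ (Fin n → ℤ) :=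
    basisOfTopLeSpanOfCardEqFinrank (fun i => (e i : Fin n → ℤ)) (by
      rw [show Set.range (fun i => (e i : Fin n → ℤ)) = (T.weights : Set (Fin n → ℤ)) from ?_, hspan]
      ext x
      constructor
      · rintro ⟨i, rfl⟩
        exact (e i).2
      · intro hx
        exact ⟨e.symm ⟨x, hx⟩, by simp⟩) (by simp)
  have hχ : ∀ i, χ i = e i := fun i => by simp [χ]
  let M : Matrix (Fin n) (Fin n) R := Matrix.of fun i c => v (e c) i
  have hM : IsUnit M.det := by
    rw [← IsLocalRing.residue_ne_zero_iff_isUnit, RingHom.map_det]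
    have : LinearIndependent (IsLocalRing.ResidueField R) (res.mapMatrix M).col :=
      hvb.comp e e.injective
    rw [Matrix.linearIndependent_cols_iff_isUnit, Matrix.isUnit_iff_isUnit_det] at this
    exact this.ne_zero
  refine ⟨GeneralLinearGroup.mk'' M hM, χ, ?_⟩
  ext1 i c
  rw [Matrix.mul_diagonal, Matrix.mul_apply]
  have hM' : ∀ (ψ : T.weights), (T.component ψ * M) i c = if ψ = e c then M i c else 0 := by
    intro ψ
    have := congrFun (hv ψ (e c)) i
    simp only [← Subtype.ext_iff] at this
    rw [Matrix.mul_apply]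
    refine Eq.trans this ?_
    split_ifs <;> rfl
  calc ∑ k, T.u.val i k * algebraMap R (TorusRing n R) (M k c)
      = ∑ ψ : T.weights, AddMonoidAlgebra.single (ψ : Fin n → ℤ) ((T.component ψ * M) i c) := by
        simp only [Matrix.mul_apply, T.u_apply, Finset.sum_mul]
        rw [Finset.sum_comm, ← Finset.sum_coe_sort]
        refine Finset.sum_congr rfl fun ψ _ => ?_
        rw [← AddMonoidAlgebra.singleAddHom_apply, map_sum]
        refine Finset.sum_congr rfl fun k _ => ?_
        simp [AddMonoidAlgebra.single_mul_single]
    _ = algebraMap R (TorusRing n R) (M i c) * torusChar R (χ c) := by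
        simp only [hM', hχ, torusChar]
        rw [Finset.sum_eq_single (e c)]
        · simp [AddMonoidAlgebra.single_mul_single]
        · intro ψ _ h
          simp [h]
        · simp

end MaximalTorus

/-! ### Matrices with entries in an ideal -/

theorem Ideal.mul_mem_matrix_right {n : ℕ} {R : Type*} [CommRing R] {J : Ideal R}
    {X : Matrix (Fin n) (Fin n) R} (hX : X ∈ J.matrix (Fin n)) (Y : Matrix (Fin n) (Fin n) R) :
    X * Y ∈ J.matrix (Fin n) := by
  rw [Ideal.mem_matrix] at hX ⊢
  intro i j
  rw [Matrix.mul_apply]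
  exact J.sum_mem fun k _ => J.mul_mem_right _ (hX i k)

theorem Ideal.mul_mem_matrix {n : ℕ} {R : Type*} [CommRing R] {J K : Ideal R}
    {X Y : Matrix (Fin n) (Fin n) R} (hX : X ∈ J.matrix (Fin n)) (hY : Y ∈ K.matrix (Fin n)) :
    X * Y ∈ (J * K).matrix (Fin n) := by
  rw [Ideal.mem_matrix] at hX hY ⊢
  intro i j
  rw [Matrix.mul_apply]
  exact (J * K).sum_mem fun k _ => Ideal.mul_mem_mul (hX i k) (hY k j)

theorem Ideal.matrix_bot' {n : ℕ} {R : Type*} [CommRing R] {X : Matrix (Fin n) (Fin n) R}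
    (hX : X ∈ (⊥ : Ideal R).matrix (Fin n)) : X = 0 := by
  ext i j
  simpa using (Ideal.mem_matrix _ _ _).1 hX i j

theorem Ideal.matrix_pow_mono {n : ℕ} {R : Type*} [CommRing R] {I : Ideal R} {a b : ℕ}
    (h : a ≤ b) {X : Matrix (Fin n) (Fin n) R} (hX : X ∈ (I ^ b).matrix (Fin n)) :
    X ∈ (I ^ a).matrix (Fin n) := by
  rw [Ideal.mem_matrix] at hX ⊢
  exact fun i j => Ideal.pow_le_pow_right h (hX i j)

theorem mem_congruenceSubgroup {n : ℕ} {R : Type*} [CommRing R] {I : Ideal R} {i : ℕ}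
    {x : GL (Fin n) R} : x ∈ congruenceSubgroup n I i ↔ x.val - 1 ∈ (I ^ i).matrix (Fin n) := by
  rw [congruenceSubgroup, MonoidHom.mem_ker, Ideal.mem_matrix, Units.ext_iff, ← Matrix.ext_iff]
  refine forall_congr' fun a => forall_congr' fun b => ?_
  rw [← Ideal.Quotient.eq_zero_iff_mem, Matrix.sub_apply, map_sub, sub_eq_zero]
  have : Ideal.Quotient.mk (I ^ i) ((1 : Matrix (Fin n) (Fin n) R) a b) =
      (1 : Matrix (Fin n) (Fin n) (R ⧸ I ^ i)) a b := by
    rw [Matrix.one_apply, Matrix.one_apply]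
    split_ifs <;> simp
  rw [this]
  rfl

/-! ### The Cartan subalgebra attached to a frame -/

section Cartan

variable {n : ℕ} {R : Type*} [CommRing R] (g : GL (Fin n) R)

/-- The algebra homomorphism `t ↦ g diag(t) g⁻¹`. -/
def cartan : (Fin n → R) →+* Matrix (Fin n) (Fin n) R where
  toFun t := g.val * diagonal t * g⁻¹.val
  map_one' := by simp
  map_mul' s t := by
    rw [show diagonal (s * t) = diagonal s * diagonal t from (diagonal_mul_diagonal s t).symm]
    simp only [mul_assoc, Units.inv_mul_cancel_left]
  map_zero' := by simp
  map_add' s t := by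
    rw [show diagonal (s + t) = diagonal s + diagonal t from (diagonal_add s t).symm, mul_add, add_mul]

theorem cartan_apply (t : Fin n → R) : cartan g t = g.val * diagonal t * g⁻¹.val := rfl

theorem cartan_smul (a : R) (t : Fin n → R) : cartan g (a • t) = a • cartan g t := by
  rw [cartan_apply, cartan_apply, diagonal_smul]
  simp

theorem frame_inv_mul : g⁻¹.val * g.val = 1 := by
  rw [← Units.val_mul, inv_mul_cancel, Units.val_one]

theorem frame_mul_inv : g.val * g⁻¹.val = 1 := by
  rw [← Units.val_mul, mul_inv_cancel, Units.val_one]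

/-- Coordinates of a matrix in a frame. -/
def frameConj (X : Matrix (Fin n) (Fin n) R) : Matrix (Fin n) (Fin n) R := g⁻¹.val * X * g.val

theorem frameConj_mul (X Y : Matrix (Fin n) (Fin n) R) :
    frameConj g (X * Y) = frameConj g X * frameConj g Y := by
  simp only [frameConj, mul_assoc, Units.mul_inv_cancel_left]

theorem frameConj_add (X Y : Matrix (Fin n) (Fin n) R) :
    frameConj g (X + Y) = frameConj g X + frameConj g Y := by
  simp only [frameConj, mul_add, add_mul]

theorem frameConj_sub (X Y : Matrix (Fin n) (Fin n) R) :
    frameConj g (X - Y) = frameConj g X - frameConj g Y := by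
  simp only [frameConj, mul_sub, sub_mul]

theorem frameConj_cartan (t : Fin n → R) : frameConj g (cartan g t) = diagonal t := by
  simp only [frameConj, cartan_apply, mul_assoc, frame_inv_mul, mul_one]
  rw [← mul_assoc, frame_inv_mul, one_mul]

theorem frameConj_injective : Function.Injective (frameConj g) := by
  intro X Y h
  have := congrArg (fun Z => g.val * Z * g⁻¹.val) h
  simpa only [frameConj, mul_assoc, Units.mul_inv_cancel_left, frame_mul_inv, mul_one] using this

theorem cartan_injective : Function.Injective (cartan g) := by
  intro s t h
  have := congrArg (frameConj g) h
  rwa [frameConj_cartan, frameConj_cartan, diagonal_injective.eq_iff] at this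

theorem cartan_comm (s t : Fin n → R) : cartan g s * cartan g t = cartan g t * cartan g s := by
  rw [← map_mul, mul_comm, map_mul]

theorem frameConj_mem {J : Ideal R} {X : Matrix (Fin n) (Fin n) R} :
    frameConj g X ∈ J.matrix (Fin n) ↔ X ∈ J.matrix (Fin n) := by
  constructor
  · intro h
    have := Ideal.mul_mem_matrix_right ((J.matrix (Fin n)).mul_mem_left g.val h) g⁻¹.val
    simpa only [frameConj, mul_assoc, Units.mul_inv_cancel_left, frame_mul_inv, mul_one] using this
  · intro h
    exact Ideal.mul_mem_matrix_right ((J.matrix (Fin n)).mul_mem_left _ h) _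

theorem cartan_mem {J : Ideal R} {t : Fin n → R} :
    cartan g t ∈ J.matrix (Fin n) ↔ ∀ i, t i ∈ J := by
  rw [← frameConj_mem g, frameConj_cartan, Ideal.mem_matrix]
  constructor
  · intro h i
    simpa using h i i
  · intro h i j
    rw [diagonal_apply]
    split_ifs
    · exact h i
    · exact J.zero_mem

/-- The projection onto the Cartan subalgebra along the root spaces. -/
def cartanProj (X : Matrix (Fin n) (Fin n) R) : Matrix (Fin n) (Fin n) R :=
  cartan g fun i => frameConj g X i i

theorem cartanProj_cartan (t : Fin n → R) : cartanProj g (cartan g t) = cartan g t := by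
  simp [cartanProj, frameConj_cartan]

theorem cartanProj_add (X Y : Matrix (Fin n) (Fin n) R) :
    cartanProj g (X + Y) = cartanProj g X + cartanProj g Y := by
  rw [cartanProj, frameConj_add, cartanProj, cartanProj, ← map_add]
  rfl

theorem cartanProj_one : cartanProj g 1 = 1 := by
  rw [← map_one (cartan g), cartanProj_cartan]

theorem cartanProj_mem {J : Ideal R} {X : Matrix (Fin n) (Fin n) R}
    (hX : X ∈ J.matrix (Fin n)) : cartanProj g X ∈ J.matrix (Fin n) := by
  rw [cartanProj, cartan_mem]
  exact fun i => (Ideal.mem_matrix _ _ _).1 ((frameConj_mem g).2 hX) i i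

theorem trace_cartan_mul (t : Fin n → R) (X : Matrix (Fin n) (Fin n) R) :
    trace (cartan g t * X) = ∑ i, t i * frameConj g X i i := by
  have : trace (cartan g t * X) = trace (diagonal t * frameConj g X) := by
    rw [cartan_apply, frameConj, mul_assoc, mul_assoc, trace_mul_comm]
    simp only [mul_assoc]
  rw [this, trace]
  simp [diagonal_mul]

theorem trace_cartan_mul_cartanProj (t : Fin n → R) (X : Matrix (Fin n) (Fin n) R) :
    trace (cartan g t * cartanProj g X) = trace (cartan g t * X) := by
  rw [trace_cartan_mul, trace_cartan_mul, cartanProj, frameConj_cartan]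
  simp

/-- The projection is self-adjoint for the trace form, so a matrix representing a character that
factors through it may be projected to the Cartan subalgebra. -/
theorem trace_mul_cartanProj (B X : Matrix (Fin n) (Fin n) R) :
    trace (B * cartanProj g X) = trace (cartanProj g B * X) := by
  rw [trace_mul_comm, cartanProj, trace_cartan_mul, cartanProj, trace_cartan_mul]
  exact Finset.sum_congr rfl fun i _ => mul_comm _ _

theorem eq_cartan_of_frameConj {X : Matrix (Fin n) (Fin n) R}
    (h : ∀ i j, i ≠ j → frameConj g X i j = 0) : X = cartan g fun i => frameConj g X i i := by
  apply frameConj_injective g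
  rw [frameConj_cartan]
  ext i j
  rw [diagonal_apply]
  split_ifs with hij
  · rw [hij]
  · exact h i j hij

end Cartan

/-! ### Points, roots and coroots in a frame -/

namespace MaximalTorus

variable {n : ℕ} {R : Type*} [CommRing R]

/-- The frame `g` diagonalises the torus `T`, with characters `χ`. -/
def IsFrame (T : MaximalTorus n R) (g : GL (Fin n) R)
    (χ : Module.Basis (Fin n) ℤ (Fin n → ℤ)) : Prop :=
  T.u.val * g.val.map (algebraMap R (TorusRing n R)) =
      g.val.map (algebraMap R (TorusRing n R)) * diagonal fun i => torusChar R (χ i)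

variable {T : MaximalTorus n R} {g : GL (Fin n) R} {χ : Module.Basis (Fin n) ℤ (Fin n → ℤ)}

theorem IsFrame.pointHom_val (h : T.IsFrame g χ) (c : Multiplicative (Fin n → ℤ) →* Rˣ) :
    (T.pointHom c).val = cartan g fun i => c (Multiplicative.ofAdd (χ i)) := by
  have h1 := congrArg (evalHom c).toRingHom.mapMatrix h
  rw [map_mul, map_mul] at h1
  have h2 : (evalHom c).toRingHom.mapMatrix (g.val.map (algebraMap R (TorusRing n R))) = g.val := by
    ext i j
    exact (evalHom c).commutes _
  have h3 : (evalHom c).toRingHom.mapMatrix (diagonal fun i => torusChar R (χ i)) =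
      diagonal fun i => (c (Multiplicative.ofAdd (χ i)) : R) := by
    ext i j
    simp only [RingHom.mapMatrix_apply, Matrix.map_apply, diagonal_apply]
    split_ifs
    · exact evalHom_torusChar c _
    · simp
  rw [h2, h3] at h1
  have h4 : (T.pointHom c).val = (evalHom c).toRingHom.mapMatrix T.u.val := rfl
  rw [cartan_apply, ← h1, mul_assoc, frame_mul_inv, mul_one, h4]

theorem IsFrame.mem_points (h : T.IsFrame g χ) {x : GL (Fin n) R} :
    x ∈ T.points ↔ ∃ t : Fin n → Rˣ, x.val = cartan g fun i => (t i : R) := by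
  constructor
  · rintro ⟨c, rfl⟩
    exact ⟨_, h.pointHom_val c⟩
  · rintro ⟨t, ht⟩
    let f : (Fin n → ℤ) →+ Additive Rˣ :=
      ((χ.constr ℤ (fun i => Additive.ofMul (t i))) : (Fin n → ℤ) →ₗ[ℤ] Additive Rˣ).toAddMonoidHom
    refine ⟨AddMonoidHom.toMultiplicativeLeft f, ?_⟩
    apply Units.ext
    rw [h.pointHom_val, ht]
    congr 1
    ext i
    have : f (χ i) = Additive.ofMul (t i) := by simp [f]
    simp [this]

theorem IsFrame.mem_points' (h : T.IsFrame g χ) {x : GL (Fin n) R} :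
    x ∈ T.points ↔ ∃ t : Fin n → R, x.val = cartan g t := by
  refine ⟨fun hx => ?_, ?_⟩
  · obtain ⟨t, ht⟩ := h.mem_points.1 hx
    exact ⟨_, ht⟩
  · rintro ⟨t, ht⟩
    have hu : IsUnit (cartan g t) := ht ▸ x.isUnit
    have hu' : IsUnit (diagonal t) := by
      rw [← frameConj_cartan g]
      exact (g⁻¹.isUnit.mul hu).mul g.isUnit
    have hu'' : ∀ i, IsUnit (t i) := by
      rw [Matrix.isUnit_iff_isUnit_det, det_diagonal, IsUnit.prod_univ_iff] at hu'
      exact hu'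
    exact h.mem_points.2 ⟨fun i => (hu'' i).unit, by simpa using ht⟩

theorem torusChar_mul_eq_iff {α a b : Fin n → ℤ} (x : R) :
    torusChar R a * algebraMap R (TorusRing n R) x =
      torusChar R α • (algebraMap R (TorusRing n R) x * torusChar R b) ↔ (x ≠ 0 → a = α + b) := by
  rw [smul_eq_mul, AddMonoidAlgebra.coe_algebraMap, Function.comp_apply, torusChar, torusChar,
    torusChar, AddMonoidAlgebra.single_mul_single, AddMonoidAlgebra.single_mul_single,
    AddMonoidAlgebra.single_mul_single, AddMonoidAlgebra.single_inj]
  simp only [Algebra.algebraMap_self, RingHom.id_apply, one_mul, mul_one, zero_add, add_zero]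
  constructor
  · rintro (h | h) hx
    · exact h.1
    · exact absurd h.1 hx
  · intro h
    by_cases hx : x = 0
    · exact Or.inr ⟨hx, hx⟩
    · exact Or.inl ⟨h hx, trivial⟩

/-- In the frame u is diagonal, so the weight condition compares two monomials in each entry. -/
theorem IsFrame.mem_weightSpace (h : T.IsFrame g χ) {α : Fin n → ℤ}
    {X : Matrix (Fin n) (Fin n) R} :
    X ∈ T.weightSpace α ↔ ∀ i j, frameConj g X i j ≠ 0 → χ i = α + χ j := by
  let ι := (algebraMap R (TorusRing n R)).mapMatrix (m := Fin n)
  have hg : ι g.val * ι g⁻¹.val = 1 := by rw [← map_mul, frame_mul_inv, map_one]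
  have hg' : ι g⁻¹.val * ι g.val = 1 := by rw [← map_mul, frame_inv_mul, map_one]
  have hu : T.u.val = ι g.val * (diagonal fun i => torusChar R (χ i)) * ι g⁻¹.val := by
    rw [show ι g.val * (diagonal fun i => torusChar R (χ i)) = _ from h.symm, mul_assoc,
      show g.val.map (algebraMap R (TorusRing n R)) * ι g⁻¹.val = 1 from hg, mul_one]
  have key : X ∈ T.weightSpace α ↔
      (diagonal fun i => torusChar R (χ i)) * ι (frameConj g X) =
        torusChar R α • (ι (frameConj g X) * (diagonal fun i => torusChar R (χ i))) := by
    change T.u.val * ι X = torusChar R α • (ι X * T.u.val) ↔ _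
    rw [hu]
    simp only [frameConj, map_mul]
    constructor
    · intro hX
      have := congrArg (fun Z => ι g⁻¹.val * Z * ι g.val) hX
      simp only [mul_assoc, Matrix.mul_smul, Matrix.smul_mul, hg', mul_one] at this
      rw [← mul_assoc (ι g⁻¹.val) (ι g.val), hg', one_mul] at this
      simpa only [mul_assoc] using this
    · intro hX
      have := congrArg (fun Z => ι g.val * Z * ι g⁻¹.val) hX
      simp only [mul_assoc, Matrix.mul_smul, Matrix.smul_mul, hg, mul_one] at this
      rw [← mul_assoc (ι g.val) (ι g⁻¹.val) (ι X * _), hg, one_mul] at this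
      simpa only [mul_assoc] using this
  rw [key, ← Matrix.ext_iff]
  refine forall_congr' fun i => forall_congr' fun j => ?_
  rw [diagonal_mul, Matrix.smul_apply, mul_diagonal]
  exact torusChar_mul_eq_iff _

theorem IsFrame.cartanProj_weightSpace (h : T.IsFrame g χ) {α : Fin n → ℤ} (hα : α ≠ 0)
    {X : Matrix (Fin n) (Fin n) R} (hX : X ∈ T.weightSpace α) : cartanProj g X = 0 := by
  have : (fun i => frameConj g X i i) = 0 := by
    ext i
    by_contra h0
    have := h.mem_weightSpace.1 hX i i h0
    exact hα (by simpa using this)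
  rw [cartanProj, this, map_zero]

theorem isFrame_sub_ne_zero (χ : Module.Basis (Fin n) ℤ (Fin n → ℤ)) {i j : Fin n} (hij : i ≠ j) :
    χ i - χ j ≠ 0 := sub_ne_zero.2 (χ.injective.ne hij)

theorem IsFrame.isRoot_iff [Nontrivial R] (h : T.IsFrame g χ) {α : Fin n → ℤ} :
    T.IsRoot α ↔ ∃ i j, i ≠ j ∧ α = χ i - χ j := by
  constructor
  · rintro ⟨hα, X, hX, hX0⟩
    have : frameConj g X ≠ 0 := by
      intro h0
      apply hX0
      apply frameConj_injective g
      rw [h0]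
      simp [frameConj]
    obtain ⟨i, j, hij⟩ : ∃ i j, frameConj g X i j ≠ 0 := by
      by_contra! h0
      exact this (Matrix.ext h0)
    have h1 := h.mem_weightSpace.1 hX i j hij
    refine ⟨i, j, ?_, by rw [h1]; abel⟩
    rintro rfl
    exact hα (by simpa using h1)
  · rintro ⟨i, j, hij, rfl⟩
    have hc : frameConj g (g.val * Matrix.single i j 1 * g⁻¹.val) = Matrix.single i j 1 := by
      simp only [frameConj, mul_assoc, frame_inv_mul, mul_one]
      rw [← mul_assoc, frame_inv_mul, one_mul]
    refine ⟨isFrame_sub_ne_zero χ hij, g.val * Matrix.single i j 1 * g⁻¹.val, ?_, ?_⟩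
    · rw [h.mem_weightSpace, hc]
      intro a b hab
      rw [Matrix.single_apply] at hab
      obtain ⟨rfl, rfl⟩ : i = a ∧ j = b := by
        by_contra h0
        exact hab (if_neg h0)
      abel
    · intro h0
      rw [h0] at hc
      have := congrFun (congrFun hc i) j
      simp [frameConj] at this

end MaximalTorus

/-! ### Coroots in a frame, and the sets 𝒯^α -/

namespace MaximalTorus

variable {n : ℕ} {R : Type*} [CommRing R]
variable {T : MaximalTorus n R} {g : GL (Fin n) R} {χ : Module.Basis (Fin n) ℤ (Fin n → ℤ)}

/-- With w = g N g⁻¹, the condition says that N intertwines the diagonal matrix of the χ i with that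
of their reflections. Entrywise this constrains only the positions of the non-zero entries of N. -/
theorem IsFrame.isCoroot_iff (h : T.IsFrame g χ) {α v : Fin n → ℤ} :
    T.IsCoroot α v ↔ α ⬝ᵥ v = 2 ∧ ∃ N : GL (Fin n) R, ∀ k m, N.val k m ≠ 0 →
      χ m = χ k - (χ k ⬝ᵥ v) • α := by
  let ι := (algebraMap R (TorusRing n R)).mapMatrix (m := Fin n)
  let ρ := (AddMonoidAlgebra.mapDomainAlgHom R R (reflection α v)).toRingHom.mapMatrix (m := Fin n)
  let D : Matrix (Fin n) (Fin n) (TorusRing n R) := diagonal fun i => torusChar R (χ i)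
  let D' : Matrix (Fin n) (Fin n) (TorusRing n R) :=
    diagonal fun i => torusChar R (reflection α v (χ i))
  have hg : ι g.val * ι g⁻¹.val = 1 := by rw [← map_mul, frame_mul_inv, map_one]
  have hg' : ι g⁻¹.val * ι g.val = 1 := by rw [← map_mul, frame_inv_mul, map_one]
  have hu : T.u.val = ι g.val * D * ι g⁻¹.val := by
    rw [show ι g.val * D = _ from h.symm, mul_assoc,
      show g.val.map (algebraMap R (TorusRing n R)) * ι g⁻¹.val = 1 from hg, mul_one]
  have hρι : ∀ X, ρ (ι X) = ι X := by
    intro X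
    ext1 i j
    exact (AddMonoidAlgebra.mapDomainAlgHom R R (reflection α v)).commutes _
  have hρD : ρ D = D' := by
    ext1 i j
    simp only [ρ, D, D', RingHom.mapMatrix_apply, Matrix.map_apply, diagonal_apply]
    split_ifs
    · change AddMonoidAlgebra.mapDomainAlgHom R R (reflection α v) (torusChar R (χ i)) = _
      rw [torusChar, AddMonoidAlgebra.mapDomainAlgHom_apply, AddMonoidAlgebra.mapDomain_single]
      rfl
    · exact map_zero _
  have hρu : ρ T.u.val = ι g.val * D' * ι g⁻¹.val := by
    rw [hu, map_mul, map_mul, hρι, hρι, hρD]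
  have key : ∀ N : GL (Fin n) R,
      (GeneralLinearGroup.map (algebraMap R (TorusRing n R)) (g * N * g⁻¹) * T.u *
        (GeneralLinearGroup.map (algebraMap R (TorusRing n R)) (g * N * g⁻¹))⁻¹ =
      GeneralLinearGroup.map
        (AddMonoidAlgebra.mapDomainAlgHom R R (reflection α v)).toRingHom T.u) ↔
      ∀ k m, N.val k m ≠ 0 → χ m = χ k - (χ k ⬝ᵥ v) • α := by
    intro N
    rw [mul_inv_eq_iff_eq_mul, Units.ext_iff]
    change ι (g.val * N.val * g⁻¹.val) * T.u.val = ρ T.u.val * ι (g.val * N.val * g⁻¹.val) ↔ _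
    rw [hρu, hu]
    have e1 : ι (g.val * N.val * g⁻¹.val) * (ι g.val * D * ι g⁻¹.val) =
        ι g.val * (ι N.val * D) * ι g⁻¹.val := by
      simp only [map_mul, mul_assoc]
      rw [← mul_assoc (ι g⁻¹.val) (ι g.val), hg', one_mul]
    have e2 : ι g.val * D' * ι g⁻¹.val * ι (g.val * N.val * g⁻¹.val) =
        ι g.val * (D' * ι N.val) * ι g⁻¹.val := by
      simp only [map_mul, mul_assoc]
      rw [← mul_assoc (ι g⁻¹.val) (ι g.val), hg', one_mul]
    rw [e1, e2]
    have e3 : ι g.val * (ι N.val * D) * ι g⁻¹.val = ι g.val * (D' * ι N.val) * ι g⁻¹.val ↔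
        D' * ι N.val = ι N.val * D := by
      constructor
      · intro hX
        have := congrArg (fun Z => ι g⁻¹.val * Z * ι g.val) hX
        simp only [mul_assoc, hg', mul_one] at this
        rw [← mul_assoc (ι g⁻¹.val) (ι g.val), ← mul_assoc (ι g⁻¹.val) (ι g.val), hg', one_mul,
          one_mul] at this
        exact this.symm
      · intro hX
        rw [hX]
    rw [e3, ← Matrix.ext_iff]
    refine forall_congr' fun i => forall_congr' fun j => ?_
    rw [diagonal_mul, mul_diagonal]
    have h1 : (torusChar R (0 : Fin n → ℤ)) = 1 := rfl
    have h2 := torusChar_mul_eq_iff (R := R) (α := 0) (a := reflection α v (χ i)) (b := χ j)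
      (N.val i j)
    rw [h1, one_smul, zero_add] at h2
    refine h2.trans (forall_congr' fun _ => ?_)
    exact eq_comm
  refine and_congr_right fun _ => ⟨?_, ?_⟩
  · rintro ⟨w, hw⟩
    refine ⟨g⁻¹ * w * g, (key _).1 ?_⟩
    rw [show g * (g⁻¹ * w * g) * g⁻¹ = w by group]
    exact hw
  · rintro ⟨N, hN⟩
    exact ⟨_, (key N).2 hN⟩

/-- The reflection maps each χ k to some χ m. For k = i this allows only the pairings 0 and 1, for k
= j only 0 and -1, and ⟨α, v⟩ = 2 selects 1 and -1. For any other k the pairing must be 0, since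
otherwise χ i and χ j would occur in a basis vector with opposite non-zero coefficients. -/
theorem IsFrame.dotProduct_coroot [Nontrivial R] (h : T.IsFrame g χ) {i j : Fin n} (hij : i ≠ j)
    {v : Fin n → ℤ} (hv : T.IsCoroot (χ i - χ j) v) (k : Fin n) :
    χ k ⬝ᵥ v = (Pi.single i 1 - Pi.single j 1 : Fin n → ℤ) k := by
  obtain ⟨h2, N, hN⟩ := h.isCoroot_iff.1 hv
  rw [sub_dotProduct] at h2
  -- An invertible matrix has no zero row, so every χ k is reflected to some χ m; `main` writes this
  -- in coordinates for the basis χ.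
  have hrow : ∀ k, ∃ m, N.val k m ≠ 0 := by
    intro k
    by_contra! h0
    have := congrFun (congrFun (frame_mul_inv N) k) k
    rw [Matrix.mul_apply, Finset.sum_eq_zero fun m _ => by rw [h0 m, zero_mul]] at this
    simp at this
  have main : ∀ k, ∃ m, ∀ l, (if m = l then (1 : ℤ) else 0) = (if k = l then 1 else 0) -
      (χ k ⬝ᵥ v) * ((if i = l then 1 else 0) - (if j = l then 1 else 0)) := by
    intro k
    obtain ⟨m, hm⟩ := hrow k
    refine ⟨m, fun l => ?_⟩
    have := congrArg (fun x => χ.repr x l) (hN k m hm)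
    simpa [-zsmul_eq_mul, Finsupp.single_apply] using this
  have hi : χ i ⬝ᵥ v = 0 ∨ χ i ⬝ᵥ v = 1 := by
    obtain ⟨m, hm⟩ := main i
    have h1 := hm i
    simp only [if_true, if_neg hij.symm] at h1
    split_ifs at h1 <;> omega
  have hj : χ j ⬝ᵥ v = 0 ∨ χ j ⬝ᵥ v = -1 := by
    obtain ⟨m, hm⟩ := main j
    have h1 := hm j
    simp only [if_true, if_neg hij] at h1
    split_ifs at h1 <;> omega
  simp only [Pi.sub_apply, Pi.single_apply]
  rcases eq_or_ne k i with rfl | hki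
  · simp only [if_true, if_neg hij]
    omega
  rcases eq_or_ne k j with rfl | hkj
  · simp only [if_true, if_neg hki]
    omega
  simp only [if_neg hki, if_neg hkj]
  obtain ⟨m, hm⟩ := main k
  have h1 := hm k
  simp only [if_true, if_neg hki.symm, if_neg hkj.symm] at h1
  have h3 : m = k := by
    by_contra h0
    simp [h0] at h1
  have h4 := hm i
  simp only [h3, if_true, if_neg hki, if_neg hij.symm] at h4
  omega

/-- The cocharacter takes the values 1 on χ i, -1 on χ j and 0 on the rest of the basis; the
transposition matrix of i and j realises its reflection. -/
theorem IsFrame.exists_coroot (h : T.IsFrame g χ) {i j : Fin n} (hij : i ≠ j) :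
    ∃ v, T.IsCoroot (χ i - χ j) v := by
  let f : (Fin n → ℤ) →ₗ[ℤ] ℤ := χ.constr ℤ (Pi.single i 1 - Pi.single j 1 : Fin n → ℤ)
  let v : Fin n → ℤ := fun a => f (Pi.single a 1)
  have hv : ∀ x, x ⬝ᵥ v = f x := by
    intro x
    conv_rhs => rw [pi_eq_sum_univ' x]
    rw [map_sum, dotProduct]
    refine Finset.sum_congr rfl fun a _ => ?_
    rw [map_smul, smul_eq_mul]
  have hk : ∀ k, χ k ⬝ᵥ v = (Pi.single i 1 - Pi.single j 1 : Fin n → ℤ) k := by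
    intro k
    rw [hv]
    simp [f]
  refine ⟨v, h.isCoroot_iff.2 ⟨?_, GeneralLinearGroup.swap R i j, ?_⟩⟩
  · rw [sub_dotProduct, hk, hk]
    simp [hij, hij.symm]
  · intro k m hkm
    rw [hk]
    have : m = Equiv.swap i j k := by
      by_contra h0
      apply hkm
      simpa [GeneralLinearGroup.swap, Matrix.swap, Equiv.Perm.permMatrix, PEquiv.toMatrix_apply]
        using fun h1 => absurd h1.symm h0
    rw [this]
    simp only [Pi.sub_apply, Pi.single_apply, Equiv.swap_apply_def]
    split_ifs <;> simp_all

theorem IsFrame.cochar_val (h : T.IsFrame g χ) (v : Fin n → ℤ) (s : Rˣ) :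
    (T.cochar v s).val = cartan g fun k => ((s ^ (χ k ⬝ᵥ v) : Rˣ) : R) :=
  h.pointHom_val _

/-- On elements of square zero the coroot is linear: (1 + s)^(±1) = 1 ± s. -/
theorem IsFrame.mem_topCorootImage [Nontrivial R] (h : T.IsFrame g χ) {I : Ideal R} {r : ℕ}
    (hI : ∀ s ∈ I ^ (r - 1), s * s = 0) {i j : Fin n} (hij : i ≠ j) {x : GL (Fin n) R} :
    x ∈ topCorootImage I r T (χ i - χ j) ↔
      ∃ s ∈ I ^ (r - 1), x.val = 1 + cartan g (s • (Pi.single i 1 - Pi.single j 1)) := by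
  have hcoch : ∀ (v : Fin n → ℤ) (_ : T.IsCoroot (χ i - χ j) v) (s : Rˣ),
      (T.cochar v s).val = cartan g fun k =>
        ((s ^ ((Pi.single i 1 - Pi.single j 1 : Fin n → ℤ) k) : Rˣ) : R) := by
    intro v hv s
    rw [h.cochar_val]
    congr 1
    ext k
    rw [h.dotProduct_coroot hij hv k]
  have hexp : ∀ (s : R) (u : Rˣ), u.val = 1 + s → s * s = 0 →
      (fun k => ((u ^ ((Pi.single i 1 - Pi.single j 1 : Fin n → ℤ) k) : Rˣ) : R)) =
        1 + s • (Pi.single i 1 - Pi.single j 1) := by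
    intro s u hu hs
    have hinv : (u⁻¹).val = 1 - s := by
      rw [Units.inv_eq_of_mul_eq_one_right]
      rw [hu]
      linear_combination -hs
    ext k
    simp only [Pi.sub_apply, Pi.add_apply, Pi.smul_apply, Pi.one_apply, Pi.single_apply]
    rcases eq_or_ne k i with rfl | hki
    · simp [hij, hu]
    rcases eq_or_ne k j with rfl | hkj
    · simp [hki, hinv, sub_eq_add_neg]
    simp [hki, hkj]
  constructor
  · rintro ⟨⟨v, hv, u, rfl⟩, hx⟩
    have hx := mem_congruenceSubgroup.1 hx
    have hs : u.val - 1 ∈ I ^ (r - 1) := by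
      rw [hcoch v hv, ← map_one (cartan g), ← map_sub, cartan_mem] at hx
      simpa [hij] using hx i
    refine ⟨u.val - 1, hs, ?_⟩
    rw [hcoch v hv, hexp (u.val - 1) u (by ring) (hI _ hs), map_add, map_one]
  · rintro ⟨s, hs, hx⟩
    obtain ⟨v, hv⟩ := h.exists_coroot hij
    have hss := hI s hs
    let u : Rˣ := ⟨1 + s, 1 - s, by linear_combination -hss, by linear_combination -hss⟩
    have hxu : x = T.cochar v u := by
      apply Units.ext
      rw [hx, hcoch v hv, hexp s u rfl hss, map_add, map_one]
    refine ⟨⟨v, hv, u, hxu⟩, ?_⟩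
    refine mem_congruenceSubgroup.2 ?_
    rw [hx, add_sub_cancel_left, cartan_mem]
    intro k
    exact (I ^ (r - 1)).mul_mem_right _ hs

end MaximalTorus

/-! ### Semilinear ring endomorphisms preserving a Cartan subalgebra -/

section Semilinear

variable {n : ℕ} {R : Type*} [CommRing R] {g : GL (Fin n) R}

theorem cartan_eq_sum (t : Fin n → R) : cartan g t = ∑ i, t i • cartan g (Pi.single i 1) := by
  conv_lhs => rw [pi_eq_sum_univ' t]
  rw [map_sum]
  refine Finset.sum_congr rfl fun i _ => ?_
  rw [← cartan_smul]

/-- Expressing the projection through the idempotents alone makes it commute with any semilinear map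
that permutes them. -/
theorem cartanProj_eq_sum (X : Matrix (Fin n) (Fin n) R) :
    cartanProj g X = ∑ i, cartan g (Pi.single i 1) * X * cartan g (Pi.single i 1) := by
  apply frameConj_injective g
  have hsum : frameConj g (∑ i, cartan g (Pi.single i 1) * X * cartan g (Pi.single i 1)) =
      ∑ i, frameConj g (cartan g (Pi.single i 1) * X * cartan g (Pi.single i 1)) := by
    simp only [frameConj, Finset.mul_sum, Finset.sum_mul]
  rw [cartanProj, frameConj_cartan, hsum]
  ext a b
  simp only [frameConj_mul, frameConj_cartan, Matrix.sum_apply, mul_diagonal, diagonal_mul,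
    Pi.single_apply, diagonal_apply]
  split_ifs with h
  · subst h
    simp
  · symm
    refine Finset.sum_eq_zero fun i _ => ?_
    by_cases h1 : a = i
    · subst h1
      simp [Ne.symm h]
    · simp [h1]

/-- A ring endomorphism of `M_n(R)`, semilinear over a ring endomorphism of `R`, that maps the
points of the torus into the Cartan subalgebra preserves the Cartan subalgebra. -/
theorem exists_map_cartan_eq (hR : ∃ u : R, IsUnit u ∧ IsUnit (u - 1)) (τ : R →+* R)
    (f : Matrix (Fin n) (Fin n) R →+* Matrix (Fin n) (Fin n) R)
    (hf : ∀ (a : R) X, f (a • X) = τ a • f X)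
    (hT : ∀ t : Fin n → Rˣ, ∃ t' : Fin n → R, f (cartan g fun i => (t i : R)) = cartan g t')
    (t : Fin n → R) : ∃ t', f (cartan g t) = cartan g t' := by
  obtain ⟨u, hu, hu1⟩ := hR
  have hE : ∀ i, ∃ t', f (cartan g (Pi.single i 1)) = cartan g t' := by
    intro i
    -- This torus point is 1 + (u - 1)E_i; as u - 1 is a unit, the image of E_i can be recovered
    -- from the image of the point.
    obtain ⟨t', ht'⟩ := hT (Function.update 1 i hu.unit)
    have h1 : (fun j => ((Function.update (1 : Fin n → Rˣ) i hu.unit j : Rˣ) : R)) =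
        1 + (u - 1) • Pi.single i 1 := by
      ext j
      rcases eq_or_ne j i with rfl | h
      · simp
      · simp [h]
    rw [h1, map_add, map_one, map_add, map_one, cartan_smul, hf] at ht'
    obtain ⟨c, hc⟩ := (hu1.map τ).exists_left_inv
    refine ⟨c • (t' - 1), ?_⟩
    rw [cartan_smul, map_sub, map_one, ← ht', add_sub_cancel_left, smul_smul, hc, one_smul]
  choose e he using hE
  refine ⟨∑ i, τ (t i) • e i, ?_⟩
  rw [cartan_eq_sum, map_sum, map_sum]
  refine Finset.sum_congr rfl fun i _ => ?_
  rw [hf, he, cartan_smul]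

/-- A local ring has only the idempotents 0 and 1, so the e i are indicators of n disjoint non-empty
subsets of an n-element set, that is, of singletons. -/
theorem exists_perm_of_orthogonal [IsLocalRing R] (e : Fin n → Fin n → R)
    (hidem : ∀ i, e i * e i = e i) (horth : ∀ i j, i ≠ j → e i * e j = 0) (hne : ∀ i, e i ≠ 0) :
    ∃ w : Equiv.Perm (Fin n), ∀ i, e i = Pi.single (w i) 1 := by
  have h01 : ∀ i c, e i c = 0 ∨ e i c = 1 := by
    intro i c
    have h := congrFun (hidem i) c
    rw [Pi.mul_apply] at h
    rcases IsLocalRing.isUnit_or_isUnit_of_add_one (add_sub_cancel (e i c) 1) with hu | hu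
    · right
      exact hu.mul_left_cancel (by rw [h, mul_one])
    · left
      apply hu.mul_left_cancel
      rw [sub_mul, h, one_mul, sub_self, mul_zero]
  have hex : ∀ i, ∃ c, e i c = 1 := by
    intro i
    by_contra! h
    exact hne i (funext fun c => (h01 i c).resolve_right (h c))
  choose w hw using hex
  have hzero : ∀ i j, i ≠ j → e i (w j) = 0 := by
    intro i j hij
    have := congrFun (horth i j hij) (w j)
    rwa [Pi.mul_apply, hw, mul_one] at this
  have hinj : Function.Injective w := by
    intro i j hij
    by_contra h
    have := hzero i j h
    rw [← hij, hw] at this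
    exact one_ne_zero this
  refine ⟨Equiv.ofBijective w (Finite.injective_iff_bijective.1 hinj), fun i => ?_⟩
  ext c
  obtain ⟨j, rfl⟩ := (Finite.injective_iff_surjective.1 hinj) c
  rcases eq_or_ne i j with rfl | hij
  · simp [hw]
  · rw [hzero i j hij, Equiv.ofBijective_apply, Pi.single_apply, if_neg (hinj.ne hij.symm)]

/-- The automorphism `τ` permutes the primitive idempotents of the Cartan subalgebra by `w`. -/
def PermutesIdempotents (g : GL (Fin n) R) (τ : R →+* R) (w : Equiv.Perm (Fin n)) : Prop :=
  ∀ i, (cartan g (Pi.single i 1)).map τ = cartan g (Pi.single (w i) 1)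

theorem map_smul_matrix (τ : R →+* R) (a : R) (X : Matrix (Fin n) (Fin n) R) :
    (a • X).map τ = τ a • X.map τ := by
  ext i j
  simp

theorem PermutesIdempotents.map_cartan {τ : R →+* R} {w : Equiv.Perm (Fin n)}
    (h : PermutesIdempotents g τ w) (t : Fin n → R) :
    (cartan g t).map τ = cartan g fun k => τ (t (w.symm k)) := by
  rw [cartan_eq_sum, cartan_eq_sum, ← RingHom.mapMatrix_apply, map_sum]
  simp only [RingHom.mapMatrix_apply, map_smul_matrix, h _]
  conv_rhs => rw [← Equiv.sum_comp w]
  simp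

theorem PermutesIdempotents.map_cartanProj {τ : R →+* R} {w : Equiv.Perm (Fin n)}
    (h : PermutesIdempotents g τ w) (X : Matrix (Fin n) (Fin n) R) :
    (cartanProj g X).map τ = cartanProj g (X.map τ) := by
  rw [cartanProj_eq_sum, cartanProj_eq_sum, ← RingHom.mapMatrix_apply, map_sum]
  simp only [map_mul, RingHom.mapMatrix_apply, h _]
  exact Equiv.sum_comp w fun i => cartan g (Pi.single i 1) * X.map τ * cartan g (Pi.single i 1)

theorem PermutesIdempotents.pow {τ : R ≃+* R} {w : Equiv.Perm (Fin n)}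
    (h : PermutesIdempotents g (τ : R →+* R) w) (m : ℕ) :
    PermutesIdempotents g ((τ ^ m : R ≃+* R) : R →+* R) (w ^ m) := by
  induction m with
  | zero =>
    intro i
    ext a b
    simp
  | succ m ih =>
    intro i
    rw [pow_succ' w, Equiv.Perm.mul_apply, ← h, ← ih]
    ext a b
    simp [pow_succ']

/-- Stability of T makes the entrywise automorphism preserve the Cartan subalgebra; being injective,
it sends the E_i to non-zero orthogonal idempotents. -/
theorem exists_permutesIdempotents [IsLocalRing R] (hR : ∃ u : R, IsUnit u ∧ IsUnit (u - 1))
    {T : MaximalTorus n R} {χ : Module.Basis (Fin n) ℤ (Fin n → ℤ)} (hg : T.IsFrame g χ)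
    (τ : R ≃+* R) (hT : T.IsStable (GeneralLinearGroup.map (τ : R →+* R))) :
    ∃ w, PermutesIdempotents g (τ : R →+* R) w := by
  let f := (τ : R →+* R).mapMatrix (m := Fin n)
  have hinj : Function.Injective f := Matrix.map_injective τ.injective
  have hex : ∀ t : Fin n → R, ∃ t', f (cartan g t) = cartan g t' := by
    refine exists_map_cartan_eq hR (τ : R →+* R) f (map_smul_matrix _) ?_
    intro t
    let x : GL (Fin n) R := ⟨cartan g fun i => (t i : R), cartan g fun i => ((t i)⁻¹ : Rˣ),
      by rw [← map_mul, ← map_one (cartan g)]; congr 1; ext i; simp,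
      by rw [← map_mul, ← map_one (cartan g)]; congr 1; ext i; simp⟩
    have hx : x ∈ T.points := hg.mem_points.2 ⟨t, rfl⟩
    have hFx : GeneralLinearGroup.map (τ : R →+* R) x ∈ T.points := by
      rw [← hT]
      exact Subgroup.mem_map_of_mem _ hx
    exact hg.mem_points'.1 hFx
  choose e he using fun i => hex (Pi.single i 1)
  obtain ⟨w, hw⟩ := exists_perm_of_orthogonal e
    (fun i => by
      apply cartan_injective g
      rw [map_mul, ← he, ← map_mul, ← map_mul, ← Pi.single_mul, mul_one])
    (fun i j hij => by
      apply cartan_injective g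
      rw [map_mul, ← he, ← he, ← map_mul, ← map_mul,
        show (Pi.single i 1 * Pi.single j 1 : Fin n → R) = 0 from ?_, map_zero, map_zero]
      ext k
      rw [Pi.mul_apply, Pi.single_apply, Pi.single_apply]
      split_ifs with h1 h2
      · exact absurd (h1.symm.trans h2) hij
      all_goals simp)
    (fun i h0 => by
      have := he i
      rw [h0, map_zero, ← map_zero f] at this
      have := hinj this
      rw [← map_zero (cartan g)] at this
      have := congrFun (cartan_injective g this) i
      simp at this)
  exact ⟨w, fun i => by rw [← hw i]; exact he i⟩

end Semilinear

/-! ### Normaliser of the torus -/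

namespace MaximalTorus

variable {n : ℕ} {R : Type*} [CommRing R]
variable {T : MaximalTorus n R} {g : GL (Fin n) R} {χ : Module.Basis (Fin n) ℤ (Fin n → ℤ)}

theorem IsFrame.conj_cartan (hR : ∃ u : R, IsUnit u ∧ IsUnit (u - 1)) (h : T.IsFrame g χ)
    {w : GL (Fin n) R} (hw : w ∈ Subgroup.normalizer (T.points : Set (GL (Fin n) R)))
    (t : Fin n → R) : ∃ t', w.val * cartan g t * w⁻¹.val = cartan g t' := by
  let f : Matrix (Fin n) (Fin n) R →+* Matrix (Fin n) (Fin n) R :=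
    (MulSemiringAction.toRingHom (ConjAct (Matrix (Fin n) (Fin n) R)ˣ) _ (ConjAct.toConjAct w))
  have hf : ∀ X, f X = w.val * X * w⁻¹.val := fun X => rfl
  rw [← hf]
  refine exists_map_cartan_eq hR (RingHom.id R) f (fun a X => by simp [hf]) ?_ t
  intro t
  let x : GL (Fin n) R := ⟨cartan g fun i => (t i : R), cartan g fun i => ((t i)⁻¹ : Rˣ),
      by rw [← map_mul, ← map_one (cartan g)]; congr 1; ext i; simp,
      by rw [← map_mul, ← map_one (cartan g)]; congr 1; ext i; simp⟩
  have hx : x ∈ T.points := h.mem_points.2 ⟨t, rfl⟩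
  exact h.mem_points'.1 ((Subgroup.mem_normalizer_iff.1 hw x).1 hx)

/-- An element of the normaliser of `T` that is diagonal modulo a proper ideal lies in `T`. -/
theorem IsFrame.mem_points_of_mem_normalizer [IsLocalRing R]
    (hR : ∃ u : R, IsUnit u ∧ IsUnit (u - 1)) (h : T.IsFrame g χ)
    {w : GL (Fin n) R} (hw : w ∈ Subgroup.normalizer (T.points : Set (GL (Fin n) R)))
    (hd : ∀ i j, i ≠ j → frameConj g w.val i j ∈ IsLocalRing.maximalIdeal R) :
    w ∈ T.points := by
  rw [h.mem_points']
  refine ⟨_, eq_cartan_of_frameConj g ?_⟩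
  set N := frameConj g w.val with hN
  have hNu : IsUnit N := (g⁻¹.isUnit.mul w.isUnit).mul g.isUnit
  have hdiag : ∀ i, IsUnit (N i i) := by
    intro i
    by_contra h0
    have hrow : ∀ j, N i j ∈ IsLocalRing.maximalIdeal R := by
      intro j
      rcases eq_or_ne i j with rfl | hij
      · exact h0
      · exact hd i j hij
    obtain ⟨N', hN'⟩ := hNu.exists_right_inv
    have := congrFun (congrFun hN' i) i
    rw [Matrix.mul_apply, one_apply_eq] at this
    have h1 : (1 : R) ∈ IsLocalRing.maximalIdeal R := by
      rw [← this]
      exact Ideal.sum_mem _ fun k _ => Ideal.mul_mem_right _ _ (hrow k)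
    exact (Ideal.ne_top_iff_one _).1 Ideal.IsPrime.ne_top' h1
  have hcomm : ∀ t : Fin n → R, ∃ t' : Fin n → R, N * diagonal t = diagonal t' * N := by
    intro t
    obtain ⟨t', ht'⟩ := h.conj_cartan hR hw t
    refine ⟨t', ?_⟩
    rw [← frameConj_cartan g, ← frameConj_cartan g, hN, ← frameConj_mul, ← frameConj_mul, ← ht',
      mul_assoc, mul_assoc, frame_inv_mul, mul_one]
  -- Compare entries of N E_j = diag(t') N: entry (i, i) gives t' i = 0 because N i i is a unit, and
  -- then entry (i, j) gives N i j = 0.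
  intro i j hij
  obtain ⟨t', ht'⟩ := hcomm (Pi.single j 1)
  have h1 := congrFun (congrFun ht' i) j
  have h2 := congrFun (congrFun ht' i) i
  rw [mul_diagonal, diagonal_mul] at h1 h2
  simp only [Pi.single_eq_same, Pi.single_eq_of_ne hij, mul_one, mul_zero] at h1 h2
  rw [h1, (hdiag i).mul_left_eq_zero.1 h2.symm, zero_mul]

end MaximalTorus

/-! ### Duality for finite rings with simple socle -/

section Duality

variable {A : Type*} [CommRing A] [Finite A] {E : Type*} [Field E] [IsAlgClosed E] [CharZero E]

/-- A finite ring in which every non-zero element divides a fixed non-zero element has a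
generating additive character. -/
theorem exists_generating_character {π₀ : A} (h0 : π₀ ≠ 0) (hdvd : ∀ x : A, x ≠ 0 → x ∣ π₀) :
    ∃ Ψ : Multiplicative A →* Eˣ,
      (∀ x : A, (∀ y, Ψ (Multiplicative.ofAdd (x * y)) = 1) → x = 0) ∧
      ∀ φ : Multiplicative A →* Eˣ, ∃ b : A, ∀ x : A,
        φ (Multiplicative.ofAdd x) = Ψ (Multiplicative.ofAdd (b * x)) := by
  obtain ⟨Ψ, hΨ⟩ := CommGroup.exists_apply_ne_one_of_hasEnoughRootsOfUnity (Multiplicative A) E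
    (a := Multiplicative.ofAdd π₀) (by simpa using h0)
  have hprim : ∀ x : A, (∀ y, Ψ (Multiplicative.ofAdd (x * y)) = 1) → x = 0 := by
    intro x hx
    by_contra hx0
    obtain ⟨y, rfl⟩ := hdvd x hx0
    exact hΨ (hx y)
  refine ⟨Ψ, hprim, ?_⟩
  let D : A → (Multiplicative A →* Eˣ) := fun b =>
    Ψ.comp (AddMonoidHom.toMultiplicative (AddMonoidHom.mulLeft b))
  have hD : ∀ b x, D b (Multiplicative.ofAdd x) = Ψ (Multiplicative.ofAdd (b * x)) :=
    fun b x => rfl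
  -- Multiples of Ψ are distinct by non-degeneracy, and a finite abelian group has as many
  -- characters as elements, so they exhaust the dual.
  have hinj : Function.Injective D := by
    intro b c hbc
    rw [← sub_eq_zero]
    apply hprim
    intro y
    rw [sub_mul, ofAdd_sub, map_div, ← hD, ← hD, hbc, div_self']
  have hcard : Nat.card A = Nat.card (Multiplicative A →* Eˣ) := by
    rw [CommGroup.card_monoidHom_of_hasEnoughRootsOfUnity]
    rfl
  have hbij := (Nat.bijective_iff_injective_and_card D).2 ⟨hinj, hcard⟩
  intro φ
  obtain ⟨b, rfl⟩ := hbij.2 φ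
  exact ⟨b, fun x => rfl⟩

end Duality

/-- Split the character over the matrix units; the indices of B are transposed because tr(BX) pairs
B j i with X i j. -/
theorem exists_trace_eq {A : Type*} [CommRing A] {E : Type*} [Field E] {Ψ : Multiplicative A →* Eˣ}
    (hΨ : ∀ φ : Multiplicative A →* Eˣ, ∃ b : A, ∀ x : A,
        φ (Multiplicative.ofAdd x) = Ψ (Multiplicative.ofAdd (b * x))) {n : ℕ}
    (φ : Multiplicative (Matrix (Fin n) (Fin n) A) →* Eˣ) :
    ∃ B : Matrix (Fin n) (Fin n) A, ∀ X : Matrix (Fin n) (Fin n) A,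
      φ (Multiplicative.ofAdd X) = Ψ (Multiplicative.ofAdd (trace (B * X))) := by
  have hex : ∀ i j, ∃ b : A, ∀ x : A, φ (Multiplicative.ofAdd (Matrix.single i j x)) =
      Ψ (Multiplicative.ofAdd (b * x)) := fun i j =>
    hΨ (φ.comp (AddMonoidHom.toMultiplicative (Matrix.singleAddMonoidHom i j)))
  choose b hb using hex
  refine ⟨Matrix.of fun j i => b i j, fun X => ?_⟩
  have h1 : φ (Multiplicative.ofAdd X) =
      ∏ i, ∏ j, φ (Multiplicative.ofAdd (Matrix.single i j (X i j))) := by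
    conv_lhs => rw [matrix_eq_sum_single X]
    simp only [ofAdd_sum, map_prod]
  rw [h1]
  simp only [hb, trace, diag_apply, Matrix.mul_apply, of_apply, ofAdd_sum, map_prod]
  exact Finset.prod_comm

/-! ### Truncated valuation rings with an automorphism -/

/-- `R` is a local ring whose maximal ideal is generated by `π`, such that `π ^ r = 0` and the
annihilator of `π ^ j` is generated by `π ^ (r - j)`, and `τ` is an automorphism that fixes `π`
and has a finite ring of fixed points, in which every non-zero element divides `π ^ (r - 1)`. -/
structure IsTruncated {R : Type*} [CommRing R] [IsLocalRing R] (π : R) (r : ℕ) (τ : R ≃+* R) :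
    Prop where
  maximal : IsLocalRing.maximalIdeal R = Ideal.span {π}
  pow_eq_zero : π ^ r = 0
  annihilator : ∀ j ≤ r, ∀ x, π ^ j * x = 0 → x ∈ Ideal.span {π} ^ (r - j)
  fixed : τ π = π
  finite : Finite ((τ : R →+* R).eqLocus (RingHom.id R))
  socle : ∀ x, τ x = x → x ≠ 0 → ∃ y, τ y = y ∧ x * y = π ^ (r - 1)
  unit : ∃ u : R, IsUnit u ∧ IsUnit (u - 1)

section FixedRing

variable {R : Type*} [CommRing R] [IsLocalRing R] {π : R} {r : ℕ} {τ : R ≃+* R} {n : ℕ}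

/-- The ring of fixed points of `τ`. -/
abbrev fixedRing (τ : R ≃+* R) : Subring R := (τ : R →+* R).eqLocus (RingHom.id R)

theorem IsTruncated.pow_ne_zero (h : IsTruncated π r τ) (hr : 0 < r) : π ^ (r - 1) ≠ 0 := by
  intro h0
  have h1 := h.annihilator (r - 1) (by omega) 1 (by rw [h0, zero_mul])
  rw [show r - (r - 1) = 1 by omega, pow_one, ← h.maximal] at h1
  exact (Ideal.ne_top_iff_one _).1 Ideal.IsPrime.ne_top' h1

theorem IsTruncated.ideal_pow_eq_bot (h : IsTruncated π r τ) {i : ℕ} (hi : r ≤ i) :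
    Ideal.span {π} ^ i = ⊥ := by
  rw [Ideal.span_singleton_pow, ← Nat.add_sub_of_le hi, pow_add, h.pow_eq_zero, zero_mul,
    Ideal.span_singleton_eq_bot]

theorem IsTruncated.mul_eq_zero (h : IsTruncated π r τ) {i j : ℕ} (hij : r ≤ i + j)
    {X Y : Matrix (Fin n) (Fin n) R} (hX : X ∈ (Ideal.span {π} ^ i).matrix (Fin n))
    (hY : Y ∈ (Ideal.span {π} ^ j).matrix (Fin n)) : X * Y = 0 := by
  have := Ideal.mul_mem_matrix hX hY
  rw [← pow_add, h.ideal_pow_eq_bot hij] at this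
  exact Ideal.matrix_bot' this

variable {E : Type*} [Field E]

/-- `Ψ` is a generating character of the ring of fixed points of `τ`. -/
structure IsGenerating (Ψ : Multiplicative (fixedRing τ) →* Eˣ) : Prop where
  nondegenerate : ∀ x : fixedRing τ, (∀ y, Ψ (Multiplicative.ofAdd (x * y)) = 1) → x = 0
  exists_eq : ∀ φ : Multiplicative (fixedRing τ) →* Eˣ, ∃ b : fixedRing τ, ∀ x : fixedRing τ,
        φ (Multiplicative.ofAdd x) = Ψ (Multiplicative.ofAdd (b * x))

theorem IsTruncated.exists_isGenerating [IsAlgClosed E] [CharZero E] (h : IsTruncated π r τ)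
    (hr : 0 < r) : ∃ Ψ : Multiplicative (fixedRing τ) →* Eˣ, IsGenerating Ψ := by
  have := h.finite
  obtain ⟨Ψ, h1, h2⟩ := exists_generating_character (E := E) (A := fixedRing τ)
    (π₀ := ⟨π ^ (r - 1), by change τ _ = _; rw [map_pow, h.fixed]; rfl⟩)
    (fun h0 => h.pow_ne_zero hr (congrArg Subtype.val h0)) (by
      rintro ⟨x, hx⟩ hx0
      obtain ⟨y, hy, hxy⟩ := h.socle x hx (fun h0 => hx0 (Subtype.ext h0))
      exact ⟨⟨y, hy⟩, Subtype.ext hxy.symm⟩)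
  exact ⟨Ψ, h1, h2⟩

omit [IsLocalRing R] in
theorem trace_mul_fixed {B X : Matrix (Fin n) (Fin n) R} (hB : B.map τ = B) (hX : X.map τ = X) :
    τ (trace (B * X)) = trace (B * X) := by
  have h1 : trace ((τ : R →+* R).mapMatrix (B * X)) = τ (trace (B * X)) := by
    rw [trace, trace, map_sum]
    rfl
  rw [← h1, map_mul]
  change trace (B.map τ * X.map τ) = _
  rw [hB, hX]

/-- Non-degeneracy of the trace pairing on fixed matrices. -/
theorem IsTruncated.mem_matrix_of_trace (h : IsTruncated π r τ)
    {Ψ : Multiplicative (fixedRing τ) →* Eˣ} (hΨ : IsGenerating Ψ) {l : ℕ} (hl : l ≤ r)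
    {C : Matrix (Fin n) (Fin n) R} (hC : C.map τ = C)
    (htr : ∀ X : Matrix (Fin n) (Fin n) R, X.map τ = X → X ∈ (Ideal.span {π} ^ l).matrix (Fin n) →
      ∀ a : fixedRing τ, (a : R) = trace (C * X) → Ψ (Multiplicative.ofAdd a) = 1) :
    C ∈ (Ideal.span {π} ^ (r - l)).matrix (Fin n) := by
  rw [Ideal.mem_matrix]
  intro i j
  apply h.annihilator l hl
  have hCij : τ (C i j) = C i j := congrFun (congrFun hC i) j
  have hfix : τ (π ^ l * C i j) = π ^ l * C i j := by
    rw [map_mul, map_pow, h.fixed, hCij]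
  have := hΨ.nondegenerate ⟨π ^ l * C i j, hfix⟩ (by
    rintro ⟨y, hy⟩
    have hy' : τ y = y := hy
    -- This test matrix extracts π^l C i j y from the trace.
    apply htr (Matrix.single j i (π ^ l * y))
    · ext a b
      rw [Matrix.map_apply, Matrix.single_apply]
      split_ifs
      · rw [map_mul, map_pow, h.fixed, hy']
      · exact map_zero τ
    · rw [Ideal.mem_matrix]
      intro a b
      rw [Matrix.single_apply]
      split_ifs
      · exact Ideal.mul_mem_right _ _ (Ideal.pow_mem_pow (Ideal.mem_span_singleton_self π) l)
      · exact Ideal.zero_mem _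
    · rw [trace_mul_comm, trace_single_mul]
      change π ^ l * C i j * y = _
      ring)
  exact congrArg Subtype.val this

end FixedRing

/-! ### The element of the Cartan subalgebra dual to a character of `T^F` -/

section Dual

variable {R : Type*} [CommRing R] {n : ℕ}

/-- The invertible matrix `1 + Z` for `Z` of square zero. -/
def oneAddSqZero (Z : Matrix (Fin n) (Fin n) R) (hZ : Z * Z = 0) : GL (Fin n) R where
  val := 1 + Z
  inv := 1 - Z
  val_inv := by rw [add_mul, one_mul, mul_sub, mul_one, hZ]; abel
  inv_val := by rw [sub_mul, one_mul, mul_add, mul_one, hZ]; abel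

variable [IsLocalRing R] {π : R} {r : ℕ} {τ : R ≃+* R}
variable {T : MaximalTorus n R} {g : GL (Fin n) R} {χ : Module.Basis (Fin n) ℤ (Fin n → ℤ)}
variable {w : Equiv.Perm (Fin n)} {F : Monoid.End (GL (Fin n) R)}
variable {E : Type*} [Field E] [IsAlgClosed E] [CharZero E]

/-- Since 2l ≥ r, the map X ↦ 1 + pr(X) is a homomorphism from the additive group of fixed matrices
of level l to T^F. Pulling θ back along it gives an additive character, represented by a trace form;
projecting the representing matrix gives `cartan g b`. -/
theorem IsTruncated.exists_dual (h : IsTruncated π r τ) (hF : ∀ x, (F x).val = x.val.map τ)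
    {Ψ : Multiplicative (fixedRing τ) →* Eˣ} (hΨ : IsGenerating Ψ)
    (hg : T.IsFrame g χ) (hw : PermutesIdempotents g (τ : R →+* R) w) {l : ℕ} (hl : r ≤ l + l)
    (θ : TorusIrr T F E) : ∃ b : Fin n → R, (cartan g b).map τ = cartan g b ∧
      ∀ X : Matrix (Fin n) (Fin n) R, X.map τ = X → X ∈ (Ideal.span {π} ^ l).matrix (Fin n) →
        ∀ x : fixedSubgroup T.points F, x.val.val = 1 + cartanProj g X →
          ∀ a : fixedRing τ, (a : R) = trace (cartan g b * X) →
            θ x = Ψ (Multiplicative.ofAdd a) := by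
  have := h.finite
  let v : Matrix (Fin n) (Fin n) (fixedRing τ) →+* Matrix (Fin n) (Fin n) R :=
    (fixedRing τ).subtype.mapMatrix
  have hv : ∀ X, (v X).map τ = v X := by
    intro X
    ext i j
    exact (X i j).2
  let J := (Ideal.span {π} ^ l).matrix (Fin n)
  let H : Subgroup (Multiplicative (Matrix (Fin n) (Fin n) (fixedRing τ))) :=
    AddSubgroup.toSubgroup (J.toAddSubgroup.comap v.toAddMonoidHom)
  have hH : ∀ X : H, v (Multiplicative.toAdd X.1) ∈ J := fun X => X.2
  have hsq : ∀ X Y : H, cartanProj g (v (Multiplicative.toAdd X.1)) *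
      cartanProj g (v (Multiplicative.toAdd Y.1)) = 0 := fun X Y =>
    h.mul_eq_zero hl (cartanProj_mem g (hH X)) (cartanProj_mem g (hH Y))
  have hmem : ∀ X : H, oneAddSqZero _ (hsq X X) ∈ fixedSubgroup T.points F := by
    intro X
    constructor
    · rw [hg.mem_points']
      exact ⟨1 + fun i => frameConj g (v (Multiplicative.toAdd X.1)) i i,
        by rw [map_add, map_one]; rfl⟩
    · apply Units.ext
      rw [hF]
      change (τ : R →+* R).mapMatrix (1 + cartanProj g (v (Multiplicative.toAdd X.1))) =
        1 + cartanProj g (v (Multiplicative.toAdd X.1))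
      rw [map_add, map_one, RingHom.mapMatrix_apply, hw.map_cartanProj]
      congr 2
      exact hv _
  let κ : H →* fixedSubgroup T.points F :=
    { toFun := fun X => ⟨oneAddSqZero _ (hsq X X), hmem X⟩
      map_one' := by
        apply Subtype.ext
        apply Units.ext
        change 1 + cartanProj g (v 0) = 1
        rw [map_zero, ← map_zero (cartan g), cartanProj_cartan, map_zero, add_zero]
      map_mul' := by
        intro X Y
        apply Subtype.ext
        apply Units.ext
        change 1 + cartanProj g (v (Multiplicative.toAdd X.1 + Multiplicative.toAdd Y.1)) =
          (1 + cartanProj g (v (Multiplicative.toAdd X.1))) *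
            (1 + cartanProj g (v (Multiplicative.toAdd Y.1)))
        rw [map_add, cartanProj_add, add_mul, one_mul, mul_add, mul_one, hsq]
        abel }
  -- The pulled-back character lives only on matrices of level l; it is extended to all fixed
  -- matrices so that trace duality applies.
  obtain ⟨φ, hφ⟩ := MonoidHom.domRestrict_surjective E H (θ.comp κ)
  obtain ⟨B, hB⟩ := exists_trace_eq hΨ.exists_eq φ
  refine ⟨fun i => frameConj g (v B) i i, ?_, ?_⟩
  · have := hw.map_cartanProj (v B)
    rw [show (v B).map (τ : R →+* R) = v B from hv B] at this
    exact this
  · intro X hX hXJ x hx a ha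
    have hPfix : (cartanProj g X).map τ = cartanProj g X := by
      have := hw.map_cartanProj X
      rw [show X.map (τ : R →+* R) = X from hX] at this
      exact this
    -- Evaluating at pr(X) instead of X turns tr(B · pr X) into tr(pr B · X).
    let Y : Matrix (Fin n) (Fin n) (fixedRing τ) :=
      Matrix.of fun i j => ⟨cartanProj g X i j, congrFun (congrFun hPfix i) j⟩
    have hY : v Y = cartanProj g X := rfl
    have hYH : Multiplicative.ofAdd Y ∈ H := by
      change v Y ∈ J
      rw [hY]
      exact cartanProj_mem g hXJ
    have hκ : κ ⟨Multiplicative.ofAdd Y, hYH⟩ = x := by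
      apply Subtype.ext
      apply Units.ext
      change 1 + cartanProj g (v Y) = _
      rw [hY, hx]
      congr 1
      exact cartanProj_cartan g _
    have h1 := DFunLike.congr_fun hφ ⟨Multiplicative.ofAdd Y, hYH⟩
    rw [MonoidHom.comp_apply, hκ] at h1
    rw [← h1]
    change φ (Multiplicative.ofAdd Y) = _
    rw [hB]
    congr 2
    apply Subtype.ext
    rw [ha]
    have h2 : (fixedRing τ).subtype (trace (B * Y)) = trace (v (B * Y)) := by
      rw [trace, trace, map_sum]
      rfl
    change (fixedRing τ).subtype (trace (B * Y)) = _
    rw [h2, map_mul, hY, trace_mul_cartanProj]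
    rfl

end Dual

/-! ### Regular characters are in general position -/

section Regular

variable {R : Type*} [CommRing R] {n : ℕ}

theorem pow_val_eq_map {τ : R ≃+* R} {F : Monoid.End (GL (Fin n) R)}
    (hF : ∀ x, (F x).val = x.val.map τ) (d : ℕ) (x : GL (Fin n) R) :
    ((F ^ d) x).val = x.val.map (τ ^ d : R ≃+* R) := by
  induction d with
  | zero =>
    ext i j
    simp
  | succ d ih =>
    rw [pow_succ', Monoid.End.coe_mul, Function.comp_apply, hF, ih]
    ext i j
    simp [pow_succ']

theorem frobNorm_succ {G : Type*} [Group G] (F : Monoid.End G) (a : ℕ) (t : G) :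
    frobNorm F (a + 1) t = frobNorm F a t * (F ^ a) t := by
  simp [frobNorm, List.range_succ]

theorem map_mem_matrix {π : R} {τ : R ≃+* R} (hτ : τ π = π) {i : ℕ}
    {X : Matrix (Fin n) (Fin n) R} (hX : X ∈ (Ideal.span {π} ^ i).matrix (Fin n)) :
    X.map τ ∈ (Ideal.span {π} ^ i).matrix (Fin n) := by
  rw [Ideal.mem_matrix] at hX ⊢
  intro a b
  have := hX a b
  rw [Ideal.span_singleton_pow, Ideal.mem_span_singleton] at this ⊢
  obtain ⟨c, hc⟩ := this
  exact ⟨τ c, by rw [Matrix.map_apply, hc, map_mul, map_pow, hτ]⟩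

theorem pow_fixed {π : R} {τ : R ≃+* R} (hτ : τ π = π) (d : ℕ) : (τ ^ d : R ≃+* R) π = π := by
  induction d with
  | zero => rfl
  | succ d ih => rw [pow_succ', RingAut.mul_apply, ih, hτ]

theorem map_pow_fixed {B : Matrix (Fin n) (Fin n) R} {τ : R ≃+* R} (hB : B.map τ = B) (d : ℕ) :
    B.map (τ ^ d : R ≃+* R) = B := by
  ext i j
  exact pow_fixed (congrFun (congrFun hB i) j) d

variable [IsLocalRing R] {π : R} {r : ℕ} {τ : R ≃+* R}
variable {T : MaximalTorus n R} {g : GL (Fin n) R} {χ : Module.Basis (Fin n) ℤ (Fin n → ℤ)}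
variable {w : Equiv.Perm (Fin n)} {F : Monoid.End (GL (Fin n) R)}
variable {E : Type*} [Field E]

/-- Products of matrices of level r - 1 vanish because 2(r - 1) ≥ r, so the norm becomes an additive
trace. -/
theorem IsTruncated.frobNorm_val (h : IsTruncated π r τ) (hr : 1 < r)
    (hF : ∀ x, (F x).val = x.val.map τ) {t : GL (Fin n) R} {Y : Matrix (Fin n) (Fin n) R}
    (hY : Y ∈ (Ideal.span {π} ^ (r - 1)).matrix (Fin n)) (ht : t.val = 1 + Y) (a : ℕ) :
    (frobNorm F a t).val = 1 + ∑ d ∈ Finset.range a, Y.map (τ ^ d : R ≃+* R) := by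
  have hYd : ∀ d, Y.map (τ ^ d : R ≃+* R) ∈ (Ideal.span {π} ^ (r - 1)).matrix (Fin n) :=
    fun d => map_mem_matrix (pow_fixed h.fixed d) hY
  induction a with
  | zero => simp [frobNorm]
  | succ a ih =>
    have h1 : ((F ^ a) t).val = 1 + Y.map (τ ^ a : R ≃+* R) := by
      rw [pow_val_eq_map hF, ht]
      exact (map_add (τ ^ a : R ≃+* R).toRingHom.mapMatrix 1 Y).trans (by rw [map_one]; rfl)
    have h2 : (∑ d ∈ Finset.range a, Y.map (τ ^ d : R ≃+* R)) * Y.map (τ ^ a : R ≃+* R) = 0 :=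
      h.mul_eq_zero (by omega) (Ideal.sum_mem _ fun d _ => hYd d) (hYd a)
    rw [frobNorm_succ, Units.val_mul, ih, h1, Finset.sum_range_succ, add_mul, one_mul, mul_add,
      mul_one, h2]
    abel

/-- The element `b` of the Cartan subalgebra represents the character `θ` on `T^F ∩ G^l`. -/
def IsDual (θ : TorusIrr T F E) (Ψ : Multiplicative (fixedRing τ) →* Eˣ) (g : GL (Fin n) R)
    (π : R) (l : ℕ) (b : Fin n → R) : Prop :=
  ∀ X : Matrix (Fin n) (Fin n) R, X.map τ = X → X ∈ (Ideal.span {π} ^ l).matrix (Fin n) →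
    ∀ x : fixedSubgroup T.points F, x.val.val = 1 + cartanProj g X →
      ∀ a : fixedRing τ, (a : R) = trace (cartan g b * X) → θ x = Ψ (Multiplicative.ofAdd a)

omit [IsLocalRing R] in
theorem map_eq_self_of_fixed (hF : ∀ x, (F x).val = x.val.map τ) {x : GL (Fin n) R}
    (hx : F x = x) {Z : Matrix (Fin n) (Fin n) R} (hxZ : x.val = 1 + Z) : Z.map τ = Z := by
  have h1 : (x.val).map τ = x.val := by rw [← hF, hx]
  rw [hxZ] at h1
  have h2 : (1 + Z).map τ = 1 + Z.map τ :=
    (map_add (τ : R →+* R).mapMatrix 1 Z).trans (by rw [map_one]; rfl)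
  rw [h2] at h1
  exact add_left_cancel h1

omit [IsLocalRing R] in
theorem trace_map_ringEquiv (f : R ≃+* R) (X : Matrix (Fin n) (Fin n) R) :
    trace (X.map f) = f (trace X) := by
  rw [trace, trace, map_sum]
  rfl

/-- On the norm of 1 + s(E_i - E_j), θ is Ψ of a sum of Frobenius conjugates of (b i - b j)s. If b i
- b j ∈ (π) this vanishes, as s ∈ (π^(r-1)), contradicting regularity at χ i - χ j. -/
theorem IsTruncated.isUnit_sub_of_isRegularChar (h : IsTruncated π r τ) (hr : 1 < r)
    (hF : ∀ x, (F x).val = x.val.map τ) (hg : T.IsFrame g χ)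
    (hw : PermutesIdempotents g (τ : R →+* R) w) {θ : TorusIrr T F E}
    {Ψ : Multiplicative (fixedRing τ) →* Eˣ} {l : ℕ} (hl : l ≤ r - 1) {b : Fin n → R}
    (hb : (cartan g b).map τ = cartan g b) (hθ : IsDual θ Ψ g π l b)
    (hreg : IsRegularChar (Ideal.span {π}) r θ) {i j : Fin n} (hij : i ≠ j) :
    IsUnit (b i - b j) := by
  by_contra hu
  obtain ⟨a, -, -, hα⟩ := hreg
  obtain ⟨t, ht, -, hfix, hne⟩ := hα (χ i - χ j) (hg.isRoot_iff.2 ⟨i, j, hij, rfl⟩)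
  have hsq : ∀ s ∈ Ideal.span {π} ^ (r - 1), s * s = 0 := by
    intro s hs
    have := Ideal.mul_mem_mul hs hs
    rwa [← pow_add, h.ideal_pow_eq_bot (by omega), Ideal.mem_bot] at this
  obtain ⟨s, hs, hts⟩ := (hg.mem_topCorootImage hsq hij).1 ht
  set y : Fin n → R := s • (Pi.single i 1 - Pi.single j 1) with hy
  have hYmem : cartan g y ∈ (Ideal.span {π} ^ (r - 1)).matrix (Fin n) := by
    rw [cartan_mem]
    exact fun k => Ideal.mul_mem_right _ _ hs
  have hN := h.frobNorm_val hr hF hYmem hts a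
  set Z := ∑ d ∈ Finset.range a, (cartan g y).map (τ ^ d : R ≃+* R) with hZ
  have hZfix : Z.map τ = Z := map_eq_self_of_fixed hF hfix.2 hN
  have hZmem : Z ∈ (Ideal.span {π} ^ (r - 1)).matrix (Fin n) :=
    Ideal.sum_mem _ fun d _ => map_mem_matrix (pow_fixed h.fixed d) hYmem
  have hZproj : cartanProj g Z = Z := by
    have : ∃ z, Z = cartan g z := by
      refine ⟨∑ d ∈ Finset.range a, fun k => (τ ^ d : R ≃+* R) (y ((w ^ d).symm k)), ?_⟩
      rw [map_sum]
      exact Finset.sum_congr rfl fun d _ => (hw.pow d).map_cartan y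
    obtain ⟨z, hz⟩ := this
    rw [hz, cartanProj_cartan]
  have htr : trace (cartan g b * Z) = 0 := by
    rw [hZ, Finset.mul_sum, trace_sum]
    refine Finset.sum_eq_zero fun d _ => ?_
    have h1 : cartan g b * (cartan g y).map (τ ^ d : R ≃+* R) =
        (cartan g b * cartan g y).map (τ ^ d : R ≃+* R) := by
      have := map_mul (τ ^ d : R ≃+* R).toRingHom.mapMatrix (cartan g b) (cartan g y)
      refine Eq.trans ?_ this.symm
      congr 1
      exact (map_pow_fixed hb d).symm
    have h2 : trace (cartan g b * cartan g y) = (b i - b j) * s := by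
      rw [trace_cartan_mul, frameConj_cartan, hy]
      simp only [diagonal_apply_eq, Pi.smul_apply, Pi.sub_apply, Pi.single_apply, smul_eq_mul]
      simp only [mul_sub, mul_ite, mul_one, mul_zero, Finset.sum_sub_distrib,
        Finset.sum_ite_eq', Finset.mem_univ, if_true]
      ring
    have h3 : (b i - b j) * s = 0 := by
      have h4 : b i - b j ∈ Ideal.span {π} := by
        rw [← h.maximal]
        exact hu
      have := Ideal.mul_mem_mul h4 hs
      rwa [← pow_succ', h.ideal_pow_eq_bot (by omega), Ideal.mem_bot] at this
    rw [h1, trace_map_ringEquiv, h2, h3, map_zero]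
  apply hne
  rw [hθ Z hZfix (Ideal.matrix_pow_mono hl hZmem) ⟨frobNorm F a t, hfix⟩ (by rw [hZproj, hN]) 0
    (by rw [htr]; rfl)]
  exact map_one Ψ

omit [IsLocalRing R] in
/-- If conjugation by `w` changes `B = g diag(b) g⁻¹` only modulo an ideal and the differences of
the `b i` are units, then `w` is diagonal modulo the ideal. -/
theorem frameConj_apply_mem_of_commutes {b : Fin n → R} {x : GL (Fin n) R} {J : Ideal R}
    (hC : x⁻¹.val * cartan g b * x.val - cartan g b ∈ J.matrix (Fin n)) {i j : Fin n}
    (hu : IsUnit (b i - b j)) : frameConj g x.val i j ∈ J := by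
  have h1 := (J.matrix (Fin n)).mul_mem_left x.val hC
  have h2 : x.val * (x⁻¹.val * cartan g b * x.val - cartan g b) =
      cartan g b * x.val - x.val * cartan g b := by
    rw [mul_sub, mul_assoc, ← mul_assoc x.val, frame_mul_inv, one_mul]
  rw [h2, ← frameConj_mem g, frameConj_sub, frameConj_mul, frameConj_mul, frameConj_cartan,
    Ideal.mem_matrix] at h1
  have h3 := h1 i j
  rw [Matrix.sub_apply, diagonal_mul, mul_diagonal, mul_comm _ (b j), ← sub_mul] at h3
  exact (Ideal.unit_mul_mem_iff_mem J hu).1 h3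

/-- Invariance of θ under x makes x⁻¹Bx - B orthogonal to all fixed matrices of level l, hence zero
modulo π^(r-l). Unit differences of the b i then make x diagonal modulo π, and such an element of
the normaliser lies in T. -/
theorem IsTruncated.inGeneralPosition (h : IsTruncated π r τ)
    (hF : ∀ x, (F x).val = x.val.map τ) (hg : T.IsFrame g χ)
    (hw : PermutesIdempotents g (τ : R →+* R) w) {θ : TorusIrr T F E}
    {Ψ : Multiplicative (fixedRing τ) →* Eˣ} (hΨ : IsGenerating Ψ) {l : ℕ} (hl : r ≤ l + l)
    (hl' : l < r) {b : Fin n → R}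
    (hb : (cartan g b).map τ = cartan g b) (hθ : IsDual θ Ψ g π l b)
    (hu : ∀ i j, i ≠ j → IsUnit (b i - b j)) : InGeneralPosition θ := by
  intro x hx hxF hfix
  have hx' := (Subgroup.normalizer (T.points : Set (GL (Fin n) R))).inv_mem hx
  obtain ⟨b', hb'⟩ := hg.conj_cartan h.unit hx' b
  rw [inv_inv] at hb'
  obtain ⟨t₀, ht₀⟩ := hg.mem_points'.1 hxF
  have hFx : F x = x * (x⁻¹ * F x) := by group
  have hFx' : (F x).val = x.val * cartan g t₀ := by
    rw [hFx, Units.val_mul, ht₀]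
  -- Here x itself need not be F-fixed; but F x = x t₀ with t₀ ∈ T, and t₀ commutes with the Cartan
  -- subalgebra.
  have hb'fix : (cartan g b').map τ = cartan g b' := by
    have h1 : cartan g b * x.val = x.val * cartan g b' := by
      rw [← hb', mul_assoc, ← mul_assoc x.val, frame_mul_inv, one_mul]
    have h2 : cartan g b * (F x).val = (F x).val * (cartan g b').map τ := by
      have := congrArg (τ : R →+* R).mapMatrix h1
      rw [map_mul, map_mul] at this
      have h3 : (τ : R →+* R).mapMatrix (cartan g b) = cartan g b := hb
      have h4 : (τ : R →+* R).mapMatrix x.val = (F x).val := (hF x).symm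
      rw [h3, h4] at this
      exact this
    have h3 : cartan g b * (F x).val = (F x).val * cartan g b' := by
      rw [hFx', ← mul_assoc, h1, mul_assoc, mul_assoc, cartan_comm]
    exact (F x).isUnit.mul_left_cancel (h2.symm.trans h3)
  refine hg.mem_points_of_mem_normalizer h.unit hx fun i j hij => ?_
  have hC : x⁻¹.val * cartan g b * x.val - cartan g b ∈ (Ideal.span {π} ^ (r - l)).matrix (Fin n) := by
    rw [hb']
    refine h.mem_matrix_of_trace hΨ hl'.le ?_ ?_
    · have := map_sub (τ : R →+* R).mapMatrix (cartan g b') (cartan g b)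
      refine Eq.trans this ?_
      exact congrArg₂ _ hb'fix hb
    · intro X hX hXl a ha
      have hPfix : (cartanProj g X).map τ = cartanProj g X := by
        have := hw.map_cartanProj X
        rw [show X.map (τ : R →+* R) = X from hX] at this
        exact this
      have hPl := cartanProj_mem g hXl
      have hPsq := h.mul_eq_zero hl hPl hPl
      let t := oneAddSqZero _ hPsq
      have htT : t ∈ T.points := by
        rw [hg.mem_points']
        exact ⟨1 + fun i => frameConj g X i i, by rw [map_add, map_one]; rfl⟩
      have htF : F t = t := by
        apply Units.ext
        rw [hF]
        change (τ : R →+* R).mapMatrix (1 + cartanProj g X) = 1 + cartanProj g X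
        rw [map_add, map_one]
        exact congrArg _ hPfix
      have hconjT : x * t * x⁻¹ ∈ T.points := (Subgroup.mem_normalizer_iff.1 hx t).1 htT
      have hcomm : (x⁻¹ * F x) * t = t * (x⁻¹ * F x) := by
        obtain ⟨s, hs⟩ := hg.mem_points'.1 htT
        apply Units.ext
        rw [Units.val_mul (x⁻¹ * F x) t, Units.val_mul t (x⁻¹ * F x), ht₀, hs, cartan_comm]
      -- Conjugation by x preserves T^F for the same reason: x⁻¹ F x lies in the commutative group
      -- T.
      have hconjF : F (x * t * x⁻¹) = x * t * x⁻¹ := by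
        rw [map_mul, map_mul, map_inv, htF]
        calc F x * t * (F x)⁻¹ = x * ((x⁻¹ * F x) * t) * (F x)⁻¹ := by group
          _ = x * t * x⁻¹ := by rw [hcomm]; group
      have hθt := hfix t ⟨htT, htF⟩ ⟨hconjT, hconjF⟩
      obtain ⟨p', hp'⟩ := hg.conj_cartan h.unit hx fun i => frameConj g X i i
      have hval : (x * t * x⁻¹).val = 1 + cartan g p' := by
        rw [Units.val_mul, Units.val_mul, ← hp']
        change x.val * (1 + cartanProj g X) * x⁻¹.val = _
        rw [mul_add, mul_one, add_mul, frame_mul_inv]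
        rfl
      have hp'fix := map_eq_self_of_fixed hF hconjF hval
      have hp'l : cartan g p' ∈ (Ideal.span {π} ^ l).matrix (Fin n) := by
        rw [← hp']
        exact Ideal.mul_mem_matrix_right (Ideal.mul_mem_left _ _ hPl) _
      let a₁ : fixedRing τ := ⟨trace (cartan g b * cartan g p'), trace_mul_fixed hb hp'fix⟩
      let a₂ : fixedRing τ := ⟨trace (cartan g b * X), trace_mul_fixed hb hX⟩
      rw [hθ _ hp'fix hp'l ⟨x * t * x⁻¹, ⟨hconjT, hconjF⟩⟩
          (by rw [cartanProj_cartan]; exact hval) a₁ rfl,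
        hθ X hX hXl ⟨t, ⟨htT, htF⟩⟩ rfl a₂ rfl] at hθt
      have haa : a = a₁ - a₂ := by
        apply Subtype.ext
        change (a : R) = trace (cartan g b * cartan g p') - trace (cartan g b * X)
        rw [ha, sub_mul, trace_sub, ← trace_cartan_mul_cartanProj g b', ← hb', ← hp']
        congr 1
        rw [mul_assoc, mul_assoc, trace_mul_comm]
        simp only [mul_assoc]
        rfl
      rw [haa, ofAdd_sub, map_div, hθt, div_self']
  rw [h.maximal, ← pow_one (Ideal.span {π})]
  refine Ideal.pow_le_pow_right (by omega : 1 ≤ r - l) ?_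
  exact frameConj_apply_mem_of_commutes hC (hu i j hij)

end Regular

/-! ### The stabiliser condition -/

section Stabiliser

variable {R : Type*} [CommRing R] {n : ℕ}

/-- A diagonal entry of XY differs from the product of diagonal entries by products of off-diagonal
ones, which lie in J² = 0. This makes the projection multiplicative on TG^l. -/
theorem cartanProj_mul_of_offDiag {g : GL (Fin n) R} {J : Ideal R} (hJ : J * J = ⊥)
    {X Y : Matrix (Fin n) (Fin n) R} (hX : ∀ i j, i ≠ j → frameConj g X i j ∈ J)
    (hY : ∀ i j, i ≠ j → frameConj g Y i j ∈ J) :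
    cartanProj g (X * Y) = cartanProj g X * cartanProj g Y := by
  rw [cartanProj, cartanProj, cartanProj, ← map_mul]
  congr 1
  ext i
  rw [frameConj_mul, Matrix.mul_apply, Finset.sum_eq_single i]
  · rfl
  · intro k _ hk
    have := Ideal.mul_mem_mul (hX i k hk.symm) (hY k i hk)
    rwa [hJ, Ideal.mem_bot] at this
  · simp

theorem isUnit_diag_of_offDiag [IsLocalRing R] {N : Matrix (Fin n) (Fin n) R} (hN : IsUnit N)
    (hd : ∀ i j, i ≠ j → N i j ∈ IsLocalRing.maximalIdeal R) (i : Fin n) : IsUnit (N i i) := by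
  by_contra h0
  have hrow : ∀ j, N i j ∈ IsLocalRing.maximalIdeal R := by
    intro j
    rcases eq_or_ne i j with rfl | hij
    · exact h0
    · exact hd i j hij
  obtain ⟨N', hN'⟩ := hN.exists_right_inv
  have := congrFun (congrFun hN' i) i
  rw [Matrix.mul_apply, one_apply_eq] at this
  have h1 : (1 : R) ∈ IsLocalRing.maximalIdeal R := by
    rw [← this]
    exact Ideal.sum_mem _ fun k _ => Ideal.mul_mem_right _ _ (hrow k)
  exact (Ideal.ne_top_iff_one _).1 Ideal.IsPrime.ne_top' h1

instance congruenceSubgroup_normal (I : Ideal R) (i : ℕ) : (congruenceSubgroup n I i).Normal :=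
  MonoidHom.normal_ker _

theorem conj_oneAdd {x c : GL (Fin n) R} {X : Matrix (Fin n) (Fin n) R} (hx : x.val = 1 + X) :
    (c * x * c⁻¹).val = 1 + c.val * X * c⁻¹.val := by
  rw [Units.val_mul, Units.val_mul, hx, mul_add, mul_one, add_mul, frame_mul_inv]

theorem conj_map_eq {τ : R ≃+* R} {F : Monoid.End (GL (Fin n) R)}
    (hF : ∀ x, (F x).val = x.val.map τ) {c : GL (Fin n) R} (hc : F c = c)
    {X : Matrix (Fin n) (Fin n) R} (hX : X.map τ = X) :
    (c.val * X * c⁻¹.val).map τ = c.val * X * c⁻¹.val := by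
  have h1 : (τ : R →+* R).mapMatrix c.val = c.val := by
    have := hF c
    rw [hc] at this
    exact this.symm
  have h2 : (τ : R →+* R).mapMatrix c⁻¹.val = c⁻¹.val := by
    have := hF c⁻¹
    rw [map_inv, hc] at this
    exact this.symm
  have h3 : (τ : R →+* R).mapMatrix X = X := hX
  have h4 := map_mul (τ : R →+* R).mapMatrix (c.val * X) c⁻¹.val
  have h5 := map_mul (τ : R →+* R).mapMatrix c.val X
  rw [h1, h3] at h5
  rw [h5, h2] at h4
  exact h4

variable [IsLocalRing R] {π : R} {r : ℕ} {τ : R ≃+* R}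
variable {T : MaximalTorus n R} {g : GL (Fin n) R} {χ : Module.Basis (Fin n) ℤ (Fin n → ℤ)}
variable {w : Equiv.Perm (Fin n)} {F : Monoid.End (GL (Fin n) R)}
variable {E : Type*} [Field E]

/-- For the converse, the diagonal part of x in the frame is invertible, since its off-diagonal
entries lie in the maximal ideal; dividing by it leaves an element of G^i. -/
theorem MaximalTorus.IsFrame.mem_sup_congruence (hg : T.IsFrame g χ) {I : Ideal R}
    (hI : I ≤ IsLocalRing.maximalIdeal R) {i : ℕ} (hi : 0 < i) {x : GL (Fin n) R} :
    x ∈ T.points ⊔ congruenceSubgroup n I i ↔ ∀ a b, a ≠ b → frameConj g x.val a b ∈ I ^ i := by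
  constructor
  · intro hx a b hab
    obtain ⟨t, ht, k, hk, rfl⟩ := Subgroup.mem_sup_of_normal_right.1 hx
    obtain ⟨s, hs⟩ := hg.mem_points'.1 ht
    have hk' := (frameConj_mem g).2 (mem_congruenceSubgroup.1 hk)
    rw [Ideal.mem_matrix] at hk'
    have h1 : t.val * k.val = cartan g s + cartan g s * (k.val - 1) := by
      rw [hs, mul_sub, mul_one]
      abel
    rw [Units.val_mul, h1, frameConj_add, frameConj_mul, frameConj_cartan, Matrix.add_apply,
      diagonal_mul, diagonal_apply_ne _ hab, zero_add]
    exact Ideal.mul_mem_left _ _ (hk' a b)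
  · intro hx
    set N := frameConj g x.val with hN
    have hNu : IsUnit N := (g⁻¹.isUnit.mul x.isUnit).mul g.isUnit
    have hdiag := isUnit_diag_of_offDiag hNu fun a b hab =>
      hI (Ideal.pow_le_self hi.ne' (hx a b hab))
    let t : GL (Fin n) R := ⟨cartan g fun i => N i i, cartan g fun i => ((hdiag i).unit⁻¹ : Rˣ),
      by rw [← map_mul, ← map_one (cartan g)]; congr 1; ext i; simp,
      by rw [← map_mul, ← map_one (cartan g)]; congr 1; ext i; simp⟩
    have ht : t ∈ T.points := hg.mem_points'.2 ⟨_, rfl⟩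
    refine Subgroup.mem_sup_of_normal_right.2 ⟨t, ht, t⁻¹ * x, ?_, by group⟩
    rw [mem_congruenceSubgroup]
    have h1 : (t⁻¹ * x).val - 1 = t⁻¹.val * (x.val - t.val) := by
      rw [mul_sub, frame_inv_mul, Units.val_mul]
    rw [h1]
    refine Ideal.mul_mem_left _ _ ((frameConj_mem g).1 ?_)
    rw [frameConj_sub, show frameConj g t.val = diagonal _ from frameConj_cartan g _,
      Ideal.mem_matrix]
    intro a b
    rw [Matrix.sub_apply, diagonal_apply]
    split_ifs with hab
    · subst hab
      rw [sub_self]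
      exact Ideal.zero_mem _
    · rw [sub_zero]
      exact hx a b hab

theorem IsTruncated.ideal_mul_self (h : IsTruncated π r τ) {l : ℕ} (hl : r ≤ l + l) :
    Ideal.span {π} ^ l * Ideal.span {π} ^ l = ⊥ := by
  rw [← pow_add, h.ideal_pow_eq_bot hl]

/-- The projection `(TG^l)^F → T^F`. -/
def IsTruncated.projHom (h : IsTruncated π r τ) (hF : ∀ x, (F x).val = x.val.map τ)
    (hg : T.IsFrame g χ) (hw : PermutesIdempotents g (τ : R →+* R) w) {l : ℕ} (hl0 : 0 < l)
    (hl : r ≤ l + l) :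
    fixedSubgroup (T.points ⊔ congruenceSubgroup n (Ideal.span {π}) l) F →*
      fixedSubgroup T.points F :=
  have hmul : ∀ x y : GL (Fin n) R, x ∈ T.points ⊔ congruenceSubgroup n (Ideal.span {π}) l →
      y ∈ T.points ⊔ congruenceSubgroup n (Ideal.span {π}) l →
      cartanProj g (x * y).val = cartanProj g x.val * cartanProj g y.val := fun x y hx hy =>
    cartanProj_mul_of_offDiag (h.ideal_mul_self hl)
      ((hg.mem_sup_congruence h.maximal.ge hl0).1 hx)
      ((hg.mem_sup_congruence h.maximal.ge hl0).1 hy)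
  { toFun := fun x => ⟨⟨cartanProj g x.val.val, cartanProj g x.val⁻¹.val,
        by rw [← hmul _ _ x.2.1 (inv_mem x.2.1), mul_inv_cancel, Units.val_one, cartanProj_one],
        by rw [← hmul _ _ (inv_mem x.2.1) x.2.1, inv_mul_cancel, Units.val_one, cartanProj_one]⟩, by
      refine ⟨hg.mem_points'.2 ⟨_, rfl⟩, Units.ext ?_⟩
      rw [hF]
      have h1 := hw.map_cartanProj x.val.val
      have h2 : x.val.val.map (τ : R →+* R) = x.val.val := by
        have := hF x.val
        rw [x.2.2] at this
        exact this.symm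
      rw [h2] at h1
      exact h1⟩
    map_one' := by
      apply Subtype.ext
      apply Units.ext
      exact cartanProj_one g
    map_mul' := fun x y => by
      apply Subtype.ext
      apply Units.ext
      exact hmul _ _ x.2.1 y.2.1 }

/-- Generators have the form 1 + X with X in a root space, which projects to 0; multiplicativity of
the projection on G^l does the rest. -/
theorem IsTruncated.cartanProj_of_mem_rootCongruence (h : IsTruncated π r τ)
    (hg : T.IsFrame g χ) {l : ℕ} (hl0 : 0 < l)
    (hl : r ≤ l + l) {x : GL (Fin n) R} (hx : x ∈ rootCongruenceSubgroup (Ideal.span {π}) T l) :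
    cartanProj g x.val = 1 := by
  have hmul : ∀ x y : GL (Fin n) R, x ∈ congruenceSubgroup n (Ideal.span {π}) l →
      y ∈ congruenceSubgroup n (Ideal.span {π}) l →
      cartanProj g (x * y).val = cartanProj g x.val * cartanProj g y.val := fun x y hx hy =>
    cartanProj_mul_of_offDiag (h.ideal_mul_self hl)
      ((hg.mem_sup_congruence h.maximal.ge hl0).1 (Subgroup.mem_sup_right hx))
      ((hg.mem_sup_congruence h.maximal.ge hl0).1 (Subgroup.mem_sup_right hy))
  suffices h' : x ∈ congruenceSubgroup n (Ideal.span {π}) l ∧ cartanProj g x.val = 1 from h'.2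
  induction hx using Subgroup.closure_induction with
  | mem x hx =>
    obtain ⟨hxl, α, hα, hX⟩ := hx
    refine ⟨hxl, ?_⟩
    rw [show x.val = 1 + (x.val - 1) by abel, cartanProj_add, cartanProj_one,
      hg.cartanProj_weightSpace hα.1 hX, add_zero]
  | one => exact ⟨one_mem _, cartanProj_one g⟩
  | mul x y _ _ hx hy =>
    exact ⟨mul_mem hx.1 hy.1, by rw [hmul x y hx.1 hy.1, hx.2, hy.2, one_mul]⟩
  | inv x _ hx =>
    refine ⟨inv_mem hx.1, ?_⟩
    have := hmul x x⁻¹ hx.1 (inv_mem hx.1)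
    rw [mul_inv_cancel, Units.val_one, cartanProj_one, hx.2, one_mul] at this
    exact this.symm

/-- The inflation is θ composed with `projHom`. A stabilising c satisfies c⁻¹Bc ≡ B modulo π^(r-l),
so its off-diagonal entries have level l'. Conversely G^(l') acts trivially on matrices of level l,
and conjugation by T does not change diagonal entries in the frame. -/
theorem IsTruncated.stabiliserCondition (h : IsTruncated π r τ) (hr : 1 < r)
    (hF : ∀ x, (F x).val = x.val.map τ) (hg : T.IsFrame g χ)
    (hw : PermutesIdempotents g (τ : R →+* R) w) {θ : TorusIrr T F E}
    {Ψ : Multiplicative (fixedRing τ) →* Eˣ} (hΨ : IsGenerating Ψ) {b : Fin n → R}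
    (hb : (cartan g b).map τ = cartan g b) (hθ : IsDual θ Ψ g π ((r + 1) / 2) b)
    (hu : ∀ i j, i ≠ j → IsUnit (b i - b j)) : StabiliserCondition (Ideal.span {π}) r θ := by
  have hl0 : 0 < (r + 1) / 2 := by omega
  have hl : r ≤ (r + 1) / 2 + (r + 1) / 2 := by omega
  unfold StabiliserCondition
  set l := (r + 1) / 2 with hl_def
  let ρ := h.projHom hF hg hw hl0 hl
  have hρ : ∀ x, (ρ x).val.val = cartanProj g x.val.val := fun x => rfl
  have hρ' : ∀ x, ∀ X, x.val.val = 1 + X → (ρ x).val.val = 1 + cartanProj g X := by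
    intro x X hx
    rw [hρ, hx, cartanProj_add, cartanProj_one]
  refine ⟨θ.comp ρ, ⟨?_, ?_⟩, ?_⟩
  · intro x hx
    rw [MonoidHom.comp_apply]
    congr 1
    apply Subtype.ext
    apply Units.ext
    rw [hρ]
    obtain ⟨t, ht⟩ := hg.mem_points'.1 hx.1
    rw [ht, cartanProj_cartan]
  · intro x hx
    rw [MonoidHom.comp_apply]
    have : ρ x = 1 := by
      apply Subtype.ext
      apply Units.ext
      rw [hρ]
      exact h.cartanProj_of_mem_rootCongruence hg hl0 hl hx
    rw [this, map_one]
  · ext c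
    constructor
    · rintro ⟨hc, hstab⟩
      refine ⟨(hg.mem_sup_congruence h.maximal.ge (by omega)).2 fun i j hij => ?_, hc⟩
      refine frameConj_apply_mem_of_commutes ?_ (hu i j hij)
      have hc' : F c⁻¹ = c⁻¹ := by rw [map_inv, hc]
      have hconj : (c⁻¹.val * cartan g b * c.val).map τ = c⁻¹.val * cartan g b * c.val := by
        have := conj_map_eq hF hc' hb
        rwa [inv_inv] at this
      -- The level l' arises here as the annihilator exponent r - l.
      rw [show r / 2 = r - l by omega]
      refine h.mem_matrix_of_trace hΨ (by omega) ?_ ?_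
      · have := map_sub (τ : R →+* R).mapMatrix (c⁻¹.val * cartan g b * c.val) (cartan g b)
        exact this.trans (congrArg₂ _ hconj hb)
      · intro X hX hXl a ha
        have hsq := h.mul_eq_zero hl hXl hXl
        let x := oneAddSqZero X hsq
        have hxl : x ∈ congruenceSubgroup n (Ideal.span {π}) l := by
          rw [mem_congruenceSubgroup, show x.val - 1 = X from add_sub_cancel_left _ _]
          exact hXl
        have hxF : F x = x := by
          apply Units.ext
          rw [hF]
          change (τ : R →+* R).mapMatrix (1 + X) = 1 + X
          rw [map_add, map_one]
          exact congrArg _ hX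
        have hY := conj_map_eq hF hc hX
        have hYl : c.val * X * c⁻¹.val ∈ (Ideal.span {π} ^ l).matrix (Fin n) :=
          Ideal.mul_mem_matrix_right (Ideal.mul_mem_left _ _ hXl) _
        have hst := hstab ⟨x, hxl, hxF⟩
        let a₁ : fixedRing τ := ⟨trace (cartan g b * (c.val * X * c⁻¹.val)), trace_mul_fixed hb hY⟩
        let a₂ : fixedRing τ := ⟨trace (cartan g b * X), trace_mul_fixed hb hX⟩
        have e1 := hθ _ hY hYl (ρ ⟨c * x * c⁻¹, ⟨Subgroup.mem_sup_right
          ((congruenceSubgroup_normal _ _).conj_mem x hxl c), by rw [map_mul, map_mul, hc, hc', hxF]⟩⟩)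
          (hρ' _ _ (conj_oneAdd rfl)) a₁ rfl
        have e2 := hθ _ hX hXl (ρ ⟨x, ⟨Subgroup.mem_sup_right hxl, hxF⟩⟩) (hρ' _ _ rfl) a₂ rfl
        have hst' : Ψ (Multiplicative.ofAdd a₁) = Ψ (Multiplicative.ofAdd a₂) := by
          rw [← e1, ← e2]
          exact hst
        have haa : a = a₁ - a₂ := by
          apply Subtype.ext
          change (a : R) = trace (cartan g b * (c.val * X * c⁻¹.val)) - trace (cartan g b * X)
          rw [ha, sub_mul, trace_sub]
          congr 1
          rw [mul_assoc, mul_assoc, trace_mul_comm]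
          simp only [mul_assoc]
        rw [haa, ofAdd_sub, map_div, hst', div_self']
    · rintro ⟨hc, hcF⟩
      refine ⟨hcF, ?_⟩
      rintro ⟨x, hxl, hxF⟩
      obtain ⟨t, ht, k, hk, rfl⟩ := Subgroup.mem_sup_of_normal_right.1 hc
      change θ (ρ _) = θ (ρ _)
      congr 1
      apply Subtype.ext
      apply Units.ext
      have hX := mem_congruenceSubgroup.1 hxl
      set X := x.val - 1 with hXdef
      have hx : x.val = 1 + X := by rw [hXdef]; abel
      rw [hρ' _ _ (conj_oneAdd hx), hρ' _ X hx]
      congr 1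
      -- As l + l' = r, multiplication by k ∈ G^(l') fixes X; only the torus part t of c remains.
      have h1 : k.val * X = X := by
        have := h.mul_eq_zero (i := r / 2) (j := l) (by omega) (mem_congruenceSubgroup.1 hk) hX
        rwa [sub_mul, one_mul, sub_eq_zero] at this
      have h2 : X * k⁻¹.val = X := by
        have := h.mul_eq_zero (i := l) (j := r / 2) (by omega) hX
          (mem_congruenceSubgroup.1 (inv_mem hk))
        rwa [mul_sub, mul_one, sub_eq_zero] at this
      have h3 : (t * k).val * X * (t * k)⁻¹.val = t.val * X * t⁻¹.val := by
        rw [_root_.mul_inv_rev, Units.val_mul, Units.val_mul]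
        calc t.val * k.val * X * (k⁻¹.val * t⁻¹.val)
            = t.val * ((k.val * X) * k⁻¹.val) * t⁻¹.val := by simp only [mul_assoc]
          _ = _ := by rw [h1, h2]
      rw [h3]
      obtain ⟨s, hs⟩ := hg.mem_points'.1 ht
      obtain ⟨s', hs'⟩ := hg.mem_points'.1 (inv_mem ht)
      rw [hs, hs']
      have hss : ∀ i, s i * s' i = 1 := by
        have h4 : t.val * t⁻¹.val = 1 := frame_mul_inv t
        rw [hs, hs', ← map_mul, ← map_one (cartan g)] at h4
        exact fun i => congrFun (cartan_injective g h4) i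
      rw [cartanProj, cartanProj]
      congr 1
      ext i
      rw [frameConj_mul, frameConj_mul, frameConj_cartan, frameConj_cartan, mul_diagonal,
        diagonal_mul, mul_right_comm, hss, one_mul]

/-- Regular characters are strongly generic. -/
theorem IsTruncated.isStronglyGenericChar [IsAlgClosed E] [CharZero E] (h : IsTruncated π r τ)
    (hr : 1 < r) (hF : ∀ x, (F x).val = x.val.map τ) (hg : T.IsFrame g χ)
    (hw : PermutesIdempotents g (τ : R →+* R) w) {θ : TorusIrr T F E}
    (hreg : IsRegularChar (Ideal.span {π}) r θ) : IsStronglyGenericChar (Ideal.span {π}) r θ := by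
  obtain ⟨Ψ, hΨ⟩ := h.exists_isGenerating (E := E) (by omega)
  obtain ⟨b, hb, hθ⟩ := h.exists_dual hF hΨ hg hw (l := (r + 1) / 2) (by omega) θ
  have hu : ∀ i j, i ≠ j → IsUnit (b i - b j) := fun i j hij =>
    h.isUnit_sub_of_isRegularChar hr hF hg hw (by omega) hb hθ hreg hij
  exact ⟨⟨hreg, h.inGeneralPosition hF hg hw hΨ (by omega) (by omega) hb hθ hu⟩,
    h.stabiliserCondition hr hF hg hw hΨ hb hθ hu⟩

end Stabiliser

/-! ### Counting regular characters -/

/-- These characters form the kernel of restriction to H, which has as many elements as the quotient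
by H. -/
theorem card_characters_trivial_on {G : Type*} [CommGroup G] [Finite G] {E : Type*} [Field E]
    [IsAlgClosed E] [CharZero E] (H : Subgroup G) :
    Nat.card {θ : G →* Eˣ // ∀ h ∈ H, θ h = 1} * Nat.card H = Nat.card (G →* Eˣ) := by
  rw [CommGroup.card_monoidHom_of_hasEnoughRootsOfUnity,
    H.card_eq_card_quotient_mul_card_subgroup, ← CommGroup.card_domRestrictHom_ker E H]
  congr 1
  refine Nat.card_congr (Equiv.subtypeEquivRight fun θ => ?_)
  rw [MonoidHom.mem_ker, MonoidHom.domRestrictHom_apply, MonoidHom.domRestrict_eq_one_iff]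

/-- Expanding from the other end serves to prove that the norm of an F^a-fixed element is F-fixed.
-/
theorem frobNorm_succ' {G : Type*} [Group G] (F : Monoid.End G) (a : ℕ) (t : G) :
    frobNorm F (a + 1) t = t * F (frobNorm F a t) := by
  induction a with
  | zero => simp [frobNorm]
  | succ a ih =>
    rw [frobNorm_succ F (a + 1) t, frobNorm_succ F a t, map_mul, ← mul_assoc, ← ih,
      frobNorm_succ F a t, pow_succ']
    rfl

section Counting

variable {R : Type*} [CommRing R] {n : ℕ}
variable [IsLocalRing R] {π : R} {r : ℕ} {τ : R ≃+* R}
variable {T : MaximalTorus n R} {g : GL (Fin n) R} {χ : Module.Basis (Fin n) ℤ (Fin n → ℤ)}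
variable {w : Equiv.Perm (Fin n)} {F : Monoid.End (GL (Fin n) R)}
variable {E : Type*} [Field E]

theorem IsTruncated.finite_fixedSubgroup (h : IsTruncated π r τ)
    (hF : ∀ x, (F x).val = x.val.map τ) (H : Subgroup (GL (Fin n) R)) :
    Finite (fixedSubgroup H F) := by
  have := h.finite
  have hfix : ∀ (x : fixedSubgroup H F) i j, τ (x.val.val i j) = x.val.val i j := by
    intro x i j
    have := hF x.val
    rw [x.2.2] at this
    exact (congrFun (congrFun this i) j).symm
  refine Finite.of_injective
    (fun x : fixedSubgroup H F => (Matrix.of fun i j => ⟨x.val.val i j, hfix x i j⟩ :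
      Matrix (Fin n) (Fin n) (fixedRing τ))) ?_
  intro x y hxy
  apply Subtype.ext
  apply Units.ext
  ext i j
  exact congrArg Subtype.val (congrFun (congrFun hxy i) j)

open Polynomial in
/-- The additive polynomial `∑ ε_d X^{Q^d}` with `ε_0 = 1` has at most `Q^{a-1}` roots. -/
theorem ncard_additive_roots_le {k : Type*} [Field k] {Q : ℕ} (hQ : 2 ≤ Q) {a : ℕ} (ha : 0 < a)
    (ε : ℕ → k) (hε : ε 0 = 1) :
    {y : k | ∑ d ∈ Finset.range a, ε d * y ^ Q ^ d = 0}.Finite ∧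
      {y : k | ∑ d ∈ Finset.range a, ε d * y ^ Q ^ d = 0}.ncard ≤ Q ^ (a - 1) := by
  classical
  let P : k[X] := ∑ d ∈ Finset.range a, C (ε d) * X ^ Q ^ d
  have hP : P ≠ 0 := by
    intro h0
    have h1 := congrArg (fun p => p.coeff 1) h0
    simp only [P, finsetSum_coeff, coeff_C_mul, coeff_X_pow, coeff_zero] at h1
    -- Only d = 0 contributes to the coefficient of X, since Q^d ≠ 1 for d > 0; so that coefficient
    -- is ε 0 = 1.
    rw [Finset.sum_eq_single 0] at h1
    · simp [hε] at h1
    · intro d _ hd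
      have : 1 ≠ Q ^ d := (Nat.one_lt_pow hd (by omega)).ne
      simp [this]
    · simp [ha.ne']
  have hdeg : P.natDegree ≤ Q ^ (a - 1) := by
    refine natDegree_sum_le_of_forall_le _ _ fun d hd => ?_
    refine (natDegree_C_mul_X_pow_le _ _).trans ?_
    exact Nat.pow_le_pow_right (by omega) (by have := Finset.mem_range.1 hd; omega)
  have hset : {y : k | ∑ d ∈ Finset.range a, ε d * y ^ Q ^ d = 0} = (P.roots.toFinset : Set k) := by
    ext y
    simp [P, hP, IsRoot.def, eval_finsetSum]
  rw [hset]
  refine ⟨Finset.finite_toSet _, ?_⟩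
  rw [Set.ncard_coe_finset]
  exact (Multiset.toFinset_card_le _).trans ((card_roots' P).trans hdeg)

/-- The annihilator of π^(r-1) is (π), so multiplication by π^(r-1) embeds the residue field as the
top layer of R. -/
theorem IsTruncated.exists_top_equiv (h : IsTruncated π r τ) (hr : 0 < r) :
    ∃ c : IsLocalRing.ResidueField R → R, Function.Injective c ∧
      ∀ x, c (IsLocalRing.residue R x) = π ^ (r - 1) * x := by
  have key : ∀ x, π ^ (r - 1) * x = 0 ↔ IsLocalRing.residue R x = 0 := by
    intro x
    rw [IsLocalRing.residue_eq_zero_iff, h.maximal]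
    constructor
    · intro hx
      have := h.annihilator (r - 1) (by omega) x hx
      rwa [show r - (r - 1) = 1 by omega, pow_one] at this
    · intro hx
      obtain ⟨y, rfl⟩ := Ideal.mem_span_singleton.1 hx
      rw [← mul_assoc, ← pow_succ, Nat.sub_add_cancel hr, h.pow_eq_zero, zero_mul]
  have key' : ∀ x y, π ^ (r - 1) * x = π ^ (r - 1) * y ↔
      IsLocalRing.residue R x = IsLocalRing.residue R y := by
    intro x y
    rw [← sub_eq_zero, ← mul_sub, key, map_sub, sub_eq_zero]
  refine ⟨fun y => π ^ (r - 1) * Function.surjInv IsLocalRing.residue_surjective y, ?_, ?_⟩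
  · intro y z hyz
    rwa [key', Function.surjInv_eq IsLocalRing.residue_surjective,
      Function.surjInv_eq IsLocalRing.residue_surjective] at hyz
  · intro x
    rw [key', Function.surjInv_eq IsLocalRing.residue_surjective]

theorem residue_pow_apply {Q : ℕ}
    (hQ : ∀ x, IsLocalRing.residue R (τ x) = IsLocalRing.residue R x ^ Q) (d : ℕ) (x : R) :
    IsLocalRing.residue R ((τ ^ d : R ≃+* R) x) = IsLocalRing.residue R x ^ Q ^ d := by
  induction d with
  | zero => simp
  | succ d ih => rw [pow_succ', RingAut.mul_apply, hQ, ih, ← pow_mul, pow_succ]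

/-- The subgroup of norms of elements of `(𝒯^α)^{F^a}`, `α = χ i - χ j`, contains `≥ Q` elements. -/
theorem IsTruncated.exists_norm_subgroup (h : IsTruncated π r τ) (hr : 1 < r)
    (hF : ∀ x, (F x).val = x.val.map τ) (hg : T.IsFrame g χ)
    (hw : PermutesIdempotents g (τ : R →+* R) w) {a : ℕ} (ha : 0 < a) (hwa : w ^ a = 1)
    {Q : ℕ} (hQ2 : 2 ≤ Q)
    (hQ : ∀ x, IsLocalRing.residue R (τ x) = IsLocalRing.residue R x ^ Q)
    (hcard : {y : IsLocalRing.ResidueField R | y ^ Q ^ a = y}.ncard = Q ^ a)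
    {i j : Fin n} (hij : i ≠ j) :
    ∃ H : Subgroup (fixedSubgroup T.points F), Q ≤ Nat.card H ∧
      ∀ x ∈ H, ∃ t ∈ topCorootImage (Ideal.span {π}) r T (χ i - χ j), (F ^ a) t = t ∧
        frobNorm F a t = x := by
  let e : Fin n → R := Pi.single i 1 - Pi.single j 1
  have hsq : ∀ s ∈ Ideal.span {π} ^ (r - 1), s * s = 0 := by
    intro s hs
    have := Ideal.mul_mem_mul hs hs
    rwa [← pow_add, h.ideal_pow_eq_bot (by omega), Ideal.mem_bot] at this
  let S : AddSubgroup R :=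
    { carrier := {s | s ∈ Ideal.span {π} ^ (r - 1) ∧ (τ ^ a : R ≃+* R) s = s}
      add_mem' := fun hs ht => ⟨add_mem hs.1 ht.1, by rw [map_add, hs.2, ht.2]⟩
      zero_mem' := ⟨zero_mem _, map_zero _⟩
      neg_mem' := fun hs => ⟨neg_mem hs.1, by rw [map_neg, hs.2]⟩ }
  have hYmem : ∀ s : S, cartan g ((s : R) • e) ∈ (Ideal.span {π} ^ (r - 1)).matrix (Fin n) := by
    intro s
    rw [cartan_mem]
    exact fun k => Ideal.mul_mem_right _ _ s.2.1
  have hYsq : ∀ s s' : S, cartan g ((s : R) • e) * cartan g ((s' : R) • e) = 0 := fun s s' =>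
    h.mul_eq_zero (by omega) (hYmem s) (hYmem s')
  have hYa : ∀ s : S, (cartan g ((s : R) • e)).map (τ ^ a : R ≃+* R) = cartan g ((s : R) • e) := by
    intro s
    have := (hw.pow a).map_cartan ((s : R) • e)
    rw [hwa] at this
    refine this.trans ?_
    congr 1
    ext k
    change (τ ^ a : R ≃+* R) ((s : R) * e k) = (s : R) * e k
    rw [map_mul, s.2.2]
    congr 1
    simp only [e, Pi.sub_apply, Pi.single_apply, map_sub]
    split_ifs <;> simp
  let t : S → GL (Fin n) R := fun s => oneAddSqZero _ (hYsq s s)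
  have ht : ∀ s, (t s).val = 1 + cartan g ((s : R) • e) := fun s => rfl
  have htF : ∀ s, (F ^ a) (t s) = t s := by
    intro s
    apply Units.ext
    rw [pow_val_eq_map hF, ht]
    refine (map_add (τ ^ a : R ≃+* R).toRingHom.mapMatrix 1 _).trans ?_
    rw [map_one]
    exact congrArg _ (hYa s)
  have hval : ∀ s, (frobNorm F a (t s)).val =
      1 + ∑ d ∈ Finset.range a, (cartan g ((s : R) • e)).map (τ ^ d : R ≃+* R) := fun s =>
    h.frobNorm_val hr hF (hYmem s) (ht s) a
  let z : S → Fin n → R := fun s => ∑ d ∈ Finset.range a,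
    fun k => (τ ^ d : R ≃+* R) (((s : R) • e) ((w ^ d).symm k))
  have hz : ∀ s, (frobNorm F a (t s)).val = 1 + cartan g (z s) := by
    intro s
    rw [hval, map_sum]
    congr 1
    exact Finset.sum_congr rfl fun d _ => (hw.pow d).map_cartan _
  have hzmem : ∀ s, cartan g (z s) ∈ (Ideal.span {π} ^ (r - 1)).matrix (Fin n) := by
    intro s
    rw [← add_right_injective 1 |>.eq_iff.1 ((hval s).symm.trans (hz s))]
    exact Ideal.sum_mem _ fun d _ => map_mem_matrix (pow_fixed h.fixed d) (hYmem s)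
  have hzadd : ∀ s s' : S, z (s + s') = z s + z s' := by
    intro s s'
    simp only [z, ← Finset.sum_add_distrib]
    refine Finset.sum_congr rfl fun d _ => ?_
    ext k
    simp [add_mul]
  -- The two expansions of the norm N of length a + 1 give t · F(N) = N · F^a(t) = N · t, and N
  -- commutes with t.
  have hNF : ∀ s, F (frobNorm F a (t s)) = frobNorm F a (t s) := by
    intro s
    have h1 := frobNorm_succ' F a (t s)
    have h2 := frobNorm_succ F a (t s)
    rw [htF, h1] at h2
    have h3 : frobNorm F a (t s) * t s = t s * frobNorm F a (t s) := by
      apply Units.ext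
      rw [Units.val_mul, Units.val_mul, hz, ht, ← map_one (cartan g), ← map_add, ← map_add,
        cartan_comm]
    rw [h3] at h2
    exact mul_left_cancel h2
  let ν : Multiplicative S →* fixedSubgroup T.points F :=
    { toFun := fun s => ⟨frobNorm F a (t (Multiplicative.toAdd s)),
        hg.mem_points'.2 ⟨1 + z (Multiplicative.toAdd s), by rw [hz, map_add, map_one]⟩, hNF _⟩
      map_one' := by
        apply Subtype.ext
        apply Units.ext
        have : z 0 = 0 := by
          have := hzadd 0 0
          rwa [add_zero, left_eq_add] at this
        change (frobNorm F a (t 0)).val = 1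
        rw [hz, this, map_zero, add_zero]
      map_mul' := fun s s' => by
        apply Subtype.ext
        apply Units.ext
        change (frobNorm F a (t (Multiplicative.toAdd s + Multiplicative.toAdd s'))).val =
          (frobNorm F a (t (Multiplicative.toAdd s))).val *
            (frobNorm F a (t (Multiplicative.toAdd s'))).val
        rw [hz, hz, hz, hzadd, map_add, add_mul, one_mul, mul_add, mul_one,
          h.mul_eq_zero (by omega) (hzmem _) (hzmem _)]
        abel }
  refine ⟨ν.range, ?_, ?_⟩
  · obtain ⟨c, hc, hcx⟩ := h.exists_top_equiv (by omega)
    -- Under the embedding of the residue field, the τ^a-fixed elements of (π^(r-1)) are the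
    -- solutions of y^(Q^a) = y.
    have hSc : (S : Set R) = c '' {y : IsLocalRing.ResidueField R | y ^ Q ^ a = y} := by
      ext s
      constructor
      · rintro ⟨hs, hsa⟩
        rw [Ideal.span_singleton_pow, Ideal.mem_span_singleton] at hs
        obtain ⟨x, rfl⟩ := hs
        refine ⟨IsLocalRing.residue R x, ?_, hcx x⟩
        rw [map_mul, map_pow, pow_fixed h.fixed, ← hcx, ← hcx, hc.eq_iff,
          residue_pow_apply hQ] at hsa
        exact hsa
      · rintro ⟨y, hy, rfl⟩
        obtain ⟨x, rfl⟩ := IsLocalRing.residue_surjective y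
        rw [hcx]
        refine ⟨Ideal.mul_mem_right _ _ (Ideal.pow_mem_pow (Ideal.mem_span_singleton_self π) _), ?_⟩
        rw [map_mul, map_pow, pow_fixed h.fixed, ← hcx, ← hcx, hc.eq_iff,
          residue_pow_apply hQ]
        exact hy
    have hcardS : Nat.card (Multiplicative S) = Q ^ a := by
      rw [← hcard, ← Set.ncard_image_of_injective _ hc, ← hSc]
      rfl
    have : Finite (Multiplicative S) :=
      Nat.finite_of_card_ne_zero (by rw [hcardS]; positivity)
    -- The i-th coordinate of the d-th conjugate of E_i - E_j; it is 1 for d = 0 because i ≠ j.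
    let ε : ℕ → R := fun d => (τ ^ d : R ≃+* R) (e ((w ^ d).symm i))
    have hε0 : IsLocalRing.residue R (ε 0) = 1 := by
      simp only [ε, pow_zero]
      change IsLocalRing.residue R (e i) = 1
      simp [e, hij]
    obtain ⟨hfin, hker⟩ := ncard_additive_roots_le hQ2 ha
      (fun d => IsLocalRing.residue R (ε d)) hε0
    have hkerle : Nat.card ν.ker ≤ Q ^ (a - 1) := by
      refine le_trans ?_ hker
      rw [← Set.ncard_image_of_injective _ hc]
      have hmap : ∀ s : ν.ker, ((Multiplicative.toAdd s.1 : S) : R) ∈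
          c '' {y | ∑ d ∈ Finset.range a, IsLocalRing.residue R (ε d) * y ^ Q ^ d = 0} := by
        rintro ⟨s, hs⟩
        have hs0 : z (Multiplicative.toAdd s) = 0 := by
          have h1 : ((ν s).val).val = 1 := by rw [MonoidHom.mem_ker.1 hs]; rfl
          have h2 : 1 + cartan g (z (Multiplicative.toAdd s)) = 1 := (hz _).symm.trans h1
          rw [add_eq_left, ← map_zero (cartan g)] at h2
          exact cartan_injective g h2
        obtain ⟨x, hx⟩ : ∃ x, ((Multiplicative.toAdd s : S) : R) = π ^ (r - 1) * x := by
          have := (Multiplicative.toAdd s).2.1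
          rw [Ideal.span_singleton_pow, Ideal.mem_span_singleton] at this
          exact this
        refine ⟨IsLocalRing.residue R x, ?_, by rw [hcx, hx]⟩
        -- A kernel element has zero norm in every coordinate; the i-th one alone already gives the
        -- polynomial relation ∑ ε_d y^(Q^d) = 0.
        have h3 := congrFun hs0 i
        simp only [z, Finset.sum_apply, Pi.smul_apply, smul_eq_mul, hx, map_mul, map_pow,
          pow_fixed h.fixed, Pi.zero_apply, mul_assoc, ← Finset.mul_sum] at h3
        have hc0 : c 0 = 0 := by rw [← map_zero (IsLocalRing.residue R), hcx, mul_zero]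
        rw [← hcx, ← hc0, hc.eq_iff, map_sum] at h3
        rw [Set.mem_ofPred_eq, ← h3]
        refine Finset.sum_congr rfl fun d _ => ?_
        rw [map_mul, residue_pow_apply hQ d x, mul_comm]
      rw [← Nat.card_coe_set_eq]
      have hfin' := (hfin.image c).to_subtype
      refine Nat.card_le_card_of_injective (fun s : ν.ker => ⟨_, hmap s⟩) ?_
      intro s s' hss
      have hss' : ((Multiplicative.toAdd s.1 : S) : R) = (Multiplicative.toAdd s'.1 : S) :=
        Subtype.mk.inj hss
      exact Subtype.ext (Multiplicative.toAdd.injective (Subtype.ext hss'))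
    have hprod : Nat.card ν.range * Nat.card ν.ker = Q ^ a := by
      rw [← hcardS, mul_comm, ← Subgroup.index_ker, Subgroup.card_mul_index]
    have hQa : Q ^ a = Q * Q ^ (a - 1) := by rw [← pow_succ', Nat.sub_add_cancel ha]
    have h0 : 0 < Q ^ (a - 1) := by positivity
    refine Nat.le_of_mul_le_mul_right ?_ h0
    rw [← hQa, ← hprod]
    exact Nat.mul_le_mul_left _ hkerle
  · rintro x ⟨s, rfl⟩
    exact ⟨t (Multiplicative.toAdd s),
      (hg.mem_topCorootImage hsq hij).2 ⟨_, (Multiplicative.toAdd s).2.1, rfl⟩, htF _, rfl⟩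

end Counting

/-! ### Non-regular characters are rare -/

section Counting

variable {R : Type*} [CommRing R] {n : ℕ}
variable [IsLocalRing R] {π : R} {r : ℕ} {τ : R ≃+* R}
variable {T : MaximalTorus n R} {g : GL (Fin n) R} {χ : Module.Basis (Fin n) ℤ (Fin n → ℤ)}
variable {w : Equiv.Perm (Fin n)} {F : Monoid.End (GL (Fin n) R)}
variable {E : Type*} [Field E]

/-- As w^a = 1, F^a acts on 1 + s(E_i - E_j) only through s; it is onto because τ^a is bijective and
fixes π. -/
theorem IsTruncated.image_topCorootImage (h : IsTruncated π r τ) (hr : 1 < r)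
    (hF : ∀ x, (F x).val = x.val.map τ) (hg : T.IsFrame g χ)
    (hw : PermutesIdempotents g (τ : R →+* R) w) {a : ℕ} (hwa : w ^ a = 1)
    {i j : Fin n} (hij : i ≠ j) :
    (F ^ a) '' topCorootImage (Ideal.span {π}) r T (χ i - χ j) =
      topCorootImage (Ideal.span {π}) r T (χ i - χ j) := by
  have hsq : ∀ s ∈ Ideal.span {π} ^ (r - 1), s * s = 0 := by
    intro s hs
    have := Ideal.mul_mem_mul hs hs
    rwa [← pow_add, h.ideal_pow_eq_bot (by omega), Ideal.mem_bot] at this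
  have hval : ∀ x : GL (Fin n) R, ∀ s : R,
      x.val = 1 + cartan g (s • (Pi.single i 1 - Pi.single j 1)) → ((F ^ a) x).val =
        1 + cartan g ((τ ^ a : R ≃+* R) s • (Pi.single i 1 - Pi.single j 1)) := by
    intro x s hx
    rw [pow_val_eq_map hF, hx]
    refine (map_add (τ ^ a : R ≃+* R).toRingHom.mapMatrix 1 _).trans ?_
    rw [map_one]
    refine congrArg _ (((hw.pow a).map_cartan _).trans ?_)
    rw [hwa]
    congr 1
    ext k
    change (τ ^ a : R ≃+* R) (s * (Pi.single i 1 - Pi.single j 1 : Fin n → R) k) = _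
    rw [map_mul, Pi.smul_apply, smul_eq_mul]
    congr 1
    simp only [Pi.sub_apply, Pi.single_apply, map_sub]
    split_ifs <;> simp
  ext x
  constructor
  · rintro ⟨y, hy, rfl⟩
    obtain ⟨s, hs, hys⟩ := (hg.mem_topCorootImage hsq hij).1 hy
    refine (hg.mem_topCorootImage hsq hij).2 ⟨_, ?_, hval y s hys⟩
    rw [Ideal.span_singleton_pow, Ideal.mem_span_singleton] at hs ⊢
    obtain ⟨c, rfl⟩ := hs
    exact ⟨(τ ^ a : R ≃+* R) c, by rw [map_mul, map_pow, pow_fixed h.fixed]⟩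
  · intro hx
    obtain ⟨s, hs, hxs⟩ := (hg.mem_topCorootImage hsq hij).1 hx
    rw [Ideal.span_singleton_pow, Ideal.mem_span_singleton] at hs
    obtain ⟨c, rfl⟩ := hs
    let s' := π ^ (r - 1) * (τ ^ a : R ≃+* R).symm c
    have hs' : s' ∈ Ideal.span {π} ^ (r - 1) :=
      Ideal.mul_mem_right _ _ (Ideal.pow_mem_pow (Ideal.mem_span_singleton_self π) _)
    have hτs : (τ ^ a : R ≃+* R) s' = π ^ (r - 1) * c := by
      rw [map_mul, map_pow, pow_fixed h.fixed, RingEquiv.apply_symm_apply]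
    have hY : cartan g (s' • (Pi.single i 1 - Pi.single j 1)) *
        cartan g (s' • (Pi.single i 1 - Pi.single j 1)) = 0 := by
      rw [← map_mul, smul_mul_smul_comm, hsq s' hs', zero_smul, map_zero]
    refine ⟨oneAddSqZero _ hY, (hg.mem_topCorootImage hsq hij).2 ⟨s', hs', rfl⟩, ?_⟩
    apply Units.ext
    rw [hval _ s' rfl, hτs, hxs]

/-- A union bound: a non-regular character is trivial on the norm subgroup of some root, and each
subgroup accounts for at most a fraction 1/Q of the characters. -/
theorem IsTruncated.card_not_isRegularChar_le [IsAlgClosed E] [CharZero E]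
    (h : IsTruncated π r τ) (hr : 1 < r)
    (hF : ∀ x, (F x).val = x.val.map τ) (hg : T.IsFrame g χ)
    (hw : PermutesIdempotents g (τ : R →+* R) w) {a : ℕ} (ha : 0 < a) (hwa : w ^ a = 1)
    {Q : ℕ} (hQ2 : 2 ≤ Q)
    (hQ : ∀ x, IsLocalRing.residue R (τ x) = IsLocalRing.residue R x ^ Q)
    (hcard : {y : IsLocalRing.ResidueField R | y ^ Q ^ a = y}.ncard = Q ^ a) :
    Finite (TorusIrr T F E) ∧
    Q * Nat.card {θ : TorusIrr T F E // ¬ IsRegularChar (Ideal.span {π}) r θ} ≤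
      n ^ 2 * Nat.card (TorusIrr T F E) := by
  have hfinG := h.finite_fixedSubgroup hF T.points
  let _ : CommGroup (fixedSubgroup T.points F) :=
    { (inferInstance : Group (fixedSubgroup T.points F)) with
      mul_comm := fun x y => by
        obtain ⟨s, hs⟩ := hg.mem_points'.1 x.2.1
        obtain ⟨t, ht⟩ := hg.mem_points'.1 y.2.1
        apply Subtype.ext
        apply Units.ext
        change x.val.val * y.val.val = y.val.val * x.val.val
        rw [hs, ht, cartan_comm] }
  have hcardIrr : Nat.card (TorusIrr T F E) = Nat.card (fixedSubgroup T.points F) :=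
    CommGroup.card_monoidHom_of_hasEnoughRootsOfUnity (fixedSubgroup T.points F) E
  have hfin : Finite (TorusIrr T F E) :=
    Nat.finite_of_card_ne_zero (by rw [hcardIrr]; exact Nat.card_pos.ne')
  refine ⟨hfin, ?_⟩
  choose H hHQ hH using fun p : {p : Fin n × Fin n // p.1 ≠ p.2} =>
    h.exists_norm_subgroup hr hF hg hw ha hwa hQ2 hQ hcard p.2
  have hsub : {θ : TorusIrr T F E | ¬ IsRegularChar (Ideal.span {π}) r θ} ⊆
      ⋃ p, {θ : TorusIrr T F E | ∀ x ∈ H p, θ x = 1} := by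
    intro θ hθ
    by_contra hcon
    simp only [Set.mem_iUnion, Set.mem_ofPred_eq, not_exists, not_forall] at hcon
    apply hθ
    refine ⟨a, ha, ?_, ?_⟩
    · intro α hα
      obtain ⟨i, j, hij, rfl⟩ := hg.isRoot_iff.1 hα
      exact h.image_topCorootImage hr hF hg hw hwa hij
    · intro α hα
      obtain ⟨i, j, hij, rfl⟩ := hg.isRoot_iff.1 hα
      obtain ⟨x, hx, hne⟩ := hcon ⟨(i, j), hij⟩
      obtain ⟨t, ht, htF, hN⟩ := hH ⟨(i, j), hij⟩ x hx
      refine ⟨t, ht, htF, hN ▸ x.2, ?_⟩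
      convert hne
  have hcount : ∀ p, Q * {θ : TorusIrr T F E | ∀ x ∈ H p, θ x = 1}.ncard ≤
      Nat.card (TorusIrr T F E) := by
    intro p
    have := card_characters_trivial_on (E := E) (H p)
    rw [← this, mul_comm]
    exact Nat.mul_le_mul_left _ (hHQ p)
  calc Q * Nat.card {θ : TorusIrr T F E // ¬ IsRegularChar (Ideal.span {π}) r θ}
      ≤ Q * ∑ p, {θ : TorusIrr T F E | ∀ x ∈ H p, θ x = 1}.ncard := by
        refine Nat.mul_le_mul_left _ ?_
        refine (Set.ncard_le_ncard hsub (Set.toFinite _)).trans ?_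
        exact Set.ncard_iUnion_le_of_fintype _
    _ ≤ ∑ _p : {p : Fin n × Fin n // p.1 ≠ p.2}, Nat.card (TorusIrr T F E) := by
        rw [Finset.mul_sum]
        exact Finset.sum_le_sum fun p _ => hcount p
    _ ≤ n ^ 2 * Nat.card (TorusIrr T F E) := by
        rw [Finset.sum_const, smul_eq_mul]
        refine Nat.mul_le_mul_right _ ?_
        rw [Finset.card_univ]
        refine (Fintype.card_subtype_le _).trans ?_
        simp [sq]

end Counting

/-! ### Frobenius powers -/

/-- `R` is a truncated valuation ring whose residue field contains `Q ^ a` solutions of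
`y ^ (Q ^ a) = y` for `Q` the powers of `q`, and `σ` induces `x ↦ x ^ q` on the residue field. -/
structure IsFrobeniusTruncated {R : Type*} [CommRing R] [IsLocalRing R] (π : R) (r q : ℕ)
    (σ : R ≃+* R) : Prop where
  truncated : ∀ m, 0 < m → IsTruncated π r (σ ^ m)
  two_le : 2 ≤ q
  residue : ∀ x, IsLocalRing.residue R (σ x) = IsLocalRing.residue R x ^ q
  card : ∀ a, 0 < a → {y : IsLocalRing.ResidueField R | y ^ q ^ a = y}.ncard = q ^ a

theorem tendsto_ratio_of_complement_le {A B : ℕ → ℕ} {q C : ℕ} (hq : 2 ≤ q)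
    (hB : ∀ m, 0 < m → 0 < B m) (hAB : ∀ m, 0 < m → ∃ N, A m + N = B m ∧ q ^ m * N ≤ C * B m) :
    Filter.Tendsto (fun m => (A m : ℝ) / (B m : ℝ)) Filter.atTop (nhds 1) := by
  have hlim : Filter.Tendsto (fun m : ℕ => 1 - (C : ℝ) * ((q : ℝ)⁻¹) ^ m) Filter.atTop
      (nhds 1) := by
    have h1 : Filter.Tendsto (fun m : ℕ => ((q : ℝ)⁻¹) ^ m) Filter.atTop (nhds 0) := by
      apply tendsto_pow_atTop_nhds_zero_of_lt_one (by positivity)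
      have : (2 : ℝ) ≤ q := by exact_mod_cast hq
      exact inv_lt_one_of_one_lt₀ (by linarith)
    simpa using (h1.const_mul (C : ℝ)).const_sub 1
  refine tendsto_of_tendsto_of_tendsto_of_le_of_le' hlim tendsto_const_nhds ?_ ?_
  · filter_upwards [Filter.eventually_gt_atTop 0] with m hm
    obtain ⟨N, hN, hle⟩ := hAB m hm
    have hBm : (0 : ℝ) < B m := by exact_mod_cast hB m hm
    have hqm : (0 : ℝ) < (q : ℝ) ^ m := by positivity
    have hN' : (A m : ℝ) + N = B m := by exact_mod_cast hN
    have hle' : (q : ℝ) ^ m * N ≤ C * B m := by exact_mod_cast hle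
    rw [le_div_iff₀ hBm, sub_mul, one_mul, inv_pow]
    have : (N : ℝ) ≤ C * ((q : ℝ) ^ m)⁻¹ * B m := by
      rw [mul_right_comm, ← div_eq_mul_inv, le_div_iff₀ hqm]
      linarith
    linarith
  · filter_upwards [Filter.eventually_gt_atTop 0] with m hm
    obtain ⟨N, hN, -⟩ := hAB m hm
    have hBm : (0 : ℝ) < B m := by exact_mod_cast hB m hm
    rw [div_le_one hBm]
    exact_mod_cast Nat.le.intro hN

theorem IsFrobeniusTruncated.main {R : Type*} [CommRing R] [IsLocalRing R] {π : R} {r q : ℕ}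
    {σ : R ≃+* R} (h : IsFrobeniusTruncated π r q σ) (hr : 1 < r) {n : ℕ} {T : MaximalTorus n R}
    {F : Monoid.End (GL (Fin n) R)} (hF : F = GeneralLinearGroup.map (σ : R →+* R))
    (hT : T.IsStable F) (E : Type*) [Field E] [IsAlgClosed E] [CharZero E] :
    (∀ θ : TorusIrr T F E,
      (IsRegularChar (Ideal.span {π}) r θ ↔ IsGenericChar (Ideal.span {π}) r θ) ∧
      (IsGenericChar (Ideal.span {π}) r θ ↔ IsStronglyGenericChar (Ideal.span {π}) r θ)) ∧
    Filter.Tendsto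
      (fun m : ℕ => (Nat.card {θ : TorusIrr T (F ^ m) E //
            IsStronglyGenericChar (Ideal.span {π}) r θ} : ℝ) /
          (Nat.card (TorusIrr T (F ^ m) E) : ℝ))
      Filter.atTop (nhds 1) := by
  subst hF
  have hFval : ∀ x, ((GeneralLinearGroup.map (σ : R →+* R) : Monoid.End (GL (Fin n) R)) x).val =
      x.val.map σ := fun x => rfl
  obtain ⟨g, χ, hg⟩ := T.exists_frame
  obtain ⟨w, hw⟩ := exists_permutesIdempotents (h.truncated 1 one_pos).unit hg σ hT
  set F : Monoid.End (GL (Fin n) R) := GeneralLinearGroup.map (σ : R →+* R)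
  have hstrong : ∀ m, 0 < m → ∀ θ : TorusIrr T (F ^ m) E,
      IsRegularChar (Ideal.span {π}) r θ → IsStronglyGenericChar (Ideal.span {π}) r θ :=
    fun m hm θ hθ => (h.truncated m hm).isStronglyGenericChar hr (pow_val_eq_map hFval m) hg
      (hw.pow m) hθ
  constructor
  · intro θ
    have h1 : IsTruncated π r σ := by
      have := h.truncated 1 one_pos
      rwa [pow_one] at this
    have h2 : IsRegularChar (Ideal.span {π}) r θ → IsStronglyGenericChar (Ideal.span {π}) r θ :=
      fun hθ => h1.isStronglyGenericChar hr hFval hg hw hθ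
    exact ⟨⟨fun hθ => (h2 hθ).1, fun hθ => hθ.1⟩, ⟨fun hθ => h2 hθ.1, fun hθ => hθ.1⟩⟩
  · have hcard : ∀ m, 0 < m → Finite (TorusIrr T (F ^ m) E) ∧ q ^ m *
        Nat.card {θ : TorusIrr T (F ^ m) E // ¬ IsRegularChar (Ideal.span {π}) r θ} ≤
          n ^ 2 * Nat.card (TorusIrr T (F ^ m) E) := by
      intro m hm
      -- The exponent a is the order of w^m, so that (F^m)^a preserves every 𝒯^α.
      have ha : 0 < orderOf (w ^ m) := orderOf_pos _
      refine (h.truncated m hm).card_not_isRegularChar_le hr (pow_val_eq_map hFval m) hg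
        (hw.pow m) ha (pow_orderOf_eq_one _) ?_ (residue_pow_apply h.residue m) ?_
      · exact h.two_le.trans (Nat.le_self_pow hm.ne' q)
      · rw [← pow_mul]
        exact h.card _ (Nat.mul_pos hm ha)
    refine tendsto_ratio_of_complement_le (C := n ^ 2) h.two_le ?_ ?_
    · intro m hm
      have := (hcard m hm).1
      exact Nat.card_pos
    · intro m hm
      refine ⟨_, ?_, (hcard m hm).2⟩
      have := (hcard m hm).1
      have hiff : ∀ θ : TorusIrr T (F ^ m) E, IsStronglyGenericChar (Ideal.span {π}) r θ ↔
          IsRegularChar (Ideal.span {π}) r θ := fun θ => ⟨fun hθ => hθ.1.1, hstrong m hm θ⟩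
      rw [Nat.card_congr (Equiv.subtypeEquivRight hiff), ← Nat.card_sum]
      classical
      exact Nat.card_congr (Equiv.sumCompl _)

/-! ### Finite algebras over a complete local ring -/

section CompleteLocal

open IsLocalRing

/-- For finite M the completion is a quotient of Â ⊗ M, and every element of Â comes from A. -/
theorem isPrecomplete_of_finite {A : Type*} [CommRing A] (I : Ideal A) [IsAdicComplete I A]
    (M : Type*) [AddCommGroup M] [Module A M] [Module.Finite A M] : IsPrecomplete I M := by
  rw [← AdicCompletion.of_surjective_iff]
  intro x
  obtain ⟨t, rfl⟩ := AdicCompletion.ofTensorProduct_surjective_of_finite I M x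
  induction t with
  | zero => exact ⟨0, by simp⟩
  | add x y hx hy =>
    obtain ⟨a, ha⟩ := hx
    obtain ⟨b, hb⟩ := hy
    exact ⟨a + b, by rw [map_add, map_add, ha, hb]⟩
  | tmul s m =>
    obtain ⟨a, rfl⟩ := AdicCompletion.of_surjective I A s
    refine ⟨a • m, ?_⟩
    rw [AdicCompletion.ofTensorProduct_tmul, map_smul]
    rfl

theorem henselianRing_of_finite (A B : Type*) [CommRing A] [IsLocalRing A] [IsNoetherianRing A]
    [IsAdicComplete (maximalIdeal A) A] [CommRing B] [Algebra A B] [Module.Finite A B] :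
    HenselianRing B ((maximalIdeal A).map (algebraMap A B)) := by
  have h1 : IsPrecomplete ((maximalIdeal A).map (algebraMap A B)) B :=
    IsPrecomplete.map_algebraMap_iff.2 (isPrecomplete_of_finite _ B)
  have h2 : IsHausdorff ((maximalIdeal A).map (algebraMap A B)) B :=
    IsHausdorff.map_algebraMap_iff.2 inferInstance
  have : IsAdicComplete ((maximalIdeal A).map (algebraMap A B)) B := { }
  exact IsAdicComplete.henselianRing _ _

variable {A B : Type*} [CommRing A] [IsLocalRing A] [Finite (ResidueField A)]
  [CommRing B] [Algebra A B]

theorem card_residueField_mem_map :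
    ((Nat.card (ResidueField A) : ℕ) : B) ∈ (maximalIdeal A).map (algebraMap A B) := by
  have h : ((Nat.card (ResidueField A) : ℕ) : A) ∈ maximalIdeal A := by
    rw [← residue_eq_zero_iff, map_natCast]
    have := Fintype.ofFinite (ResidueField A)
    rw [Nat.card_eq_fintype_card, FiniteField.cast_card_eq_zero]
  simpa using Ideal.mem_map_of_mem (algebraMap A B) h

/-- Unless B modulo the extended ideal is zero, it has residue characteristic p, and q is a power of
p. -/
theorem add_pow_card_sub_mem (a b : B) (m : ℕ) :
    (a + b) ^ Nat.card (ResidueField A) ^ m - (a ^ Nat.card (ResidueField A) ^ m +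
      b ^ Nat.card (ResidueField A) ^ m) ∈ (maximalIdeal A).map (algebraMap A B) := by
  have := Fintype.ofFinite (ResidueField A)
  obtain ⟨p, hp⟩ := CharP.exists (ResidueField A)
  obtain ⟨n, hpp, hc⟩ := FiniteField.card (ResidueField A) p
  rw [← Nat.card_eq_fintype_card] at hc
  by_cases ht : (maximalIdeal A).map (algebraMap A B) = ⊤
  · rw [ht]; trivial
  have : Nontrivial (B ⧸ (maximalIdeal A).map (algebraMap A B)) :=
    Ideal.Quotient.nontrivial_iff.2 ht
  have := Fact.mk hpp
  let g : ResidueField A →+* B ⧸ (maximalIdeal A).map (algebraMap A B) :=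
    Ideal.quotientMap _ (algebraMap A B) Ideal.le_comap_map
  have : CharP (B ⧸ (maximalIdeal A).map (algebraMap A B)) p :=
    charP_of_injective_ringHom g.injective p
  rw [← Ideal.Quotient.eq_zero_iff_mem]
  simp only [map_sub, map_add, map_pow, hc, ← pow_mul]
  rw [add_pow_char_pow, sub_self]

/-- Unramifiedness makes the quotient reduced, and it is finite; so x ↦ x^q is injective on it,
hence a permutation of finite order f. -/
theorem exists_pow_card_sub_mem [Algebra.FormallyUnramified A B] [Module.Finite A B] :
    ∃ f : ℕ, 0 < f ∧ ∀ x : B, x ^ Nat.card (ResidueField A) ^ f - x ∈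
      (maximalIdeal A).map (algebraMap A B) := by
  set J := (maximalIdeal A).map (algebraMap A B) with hJ
  set q := Nat.card (ResidueField A) with hq
  have hrad : J.IsRadical := Algebra.FormallyUnramified.isRadical_map_isMaximal (A := A) B _
  have hfin : Finite (B ⧸ J) := by
    have : Finite (A ⧸ maximalIdeal A) := ‹Finite (ResidueField A)›
    have : Module.Finite (A ⧸ maximalIdeal A) (B ⧸ J) := Module.Finite.of_restrictScalars_finite A _ _
    exact Module.finite_of_finite (A ⧸ maximalIdeal A)
  have : IsReduced (B ⧸ J) := Ideal.isRadical_iff_quotient_reduced _ |>.1 hrad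
  have hq0 : q ≠ 0 := Nat.card_pos.ne'
  have hinj : Function.Injective (fun x : B ⧸ J => x ^ q) := by
    intro x y hxy
    obtain ⟨x, rfl⟩ := Ideal.Quotient.mk_surjective x
    obtain ⟨y, rfl⟩ := Ideal.Quotient.mk_surjective y
    simp only [← map_pow] at hxy
    rw [Ideal.Quotient.eq] at hxy ⊢
    refine hrad ⟨q, ?_⟩
    have h := add_pow_card_sub_mem (A := A) (x - y) y 1
    rw [sub_add_cancel, pow_one, ← hq, ← hJ] at h
    have : (x - y) ^ q = (x ^ q - y ^ q) - (x ^ q - ((x - y) ^ q + y ^ q)) := by ring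
    rw [this]
    exact J.sub_mem hxy h
  have hbij := Finite.injective_iff_bijective.1 hinj
  let e : Equiv.Perm (B ⧸ J) := Equiv.ofBijective _ hbij
  obtain ⟨f, hf, he⟩ := isOfFinOrder_iff_pow_eq_one.1 (isOfFinOrder_of_finite e)
  refine ⟨f, hf, fun x => ?_⟩
  have key : ∀ k : ℕ, ∀ y : B ⧸ J, (e ^ k) y = y ^ q ^ k := by
    intro k
    induction k with
    | zero => simp
    | succ k ih => intro y; rw [pow_succ', Equiv.Perm.mul_apply, ih, pow_succ, pow_mul]; rfl
  have h := key f (Ideal.Quotient.mk J x)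
  rw [he] at h
  rw [← Ideal.Quotient.eq, map_pow, ← h]
  rfl

/-- Hensel's lemma for X^(q^f) - X, whose derivative is -1 modulo the extended ideal. -/
theorem exists_pow_card_eq [IsNoetherianRing A] [IsAdicComplete (maximalIdeal A) A]
    [Module.Finite A B] {f : ℕ} (hf : 0 < f)
    (hB : ∀ x : B, x ^ Nat.card (ResidueField A) ^ f - x ∈
      (maximalIdeal A).map (algebraMap A B)) (b : B) :
    ∃ z : B, z ^ Nat.card (ResidueField A) ^ f = z ∧
      z - b ∈ (maximalIdeal A).map (algebraMap A B) := by
  nontriviality B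
  set J := (maximalIdeal A).map (algebraMap A B) with hJ
  set q := Nat.card (ResidueField A) with hq
  have hH : HenselianRing B J := henselianRing_of_finite A B
  have hq1 : 1 < q ^ f := Nat.one_lt_pow hf.ne' Finite.one_lt_card
  obtain ⟨z, hz, hzb⟩ := hH.is_henselian (Polynomial.X ^ q ^ f - Polynomial.X)
    (Polynomial.monic_X_pow_sub (by
      rw [Polynomial.degree_X]; exact_mod_cast hq1)) b (by simpa using hB b) (by
      have h0 : Ideal.Quotient.mk J ((q : ℕ) : B) = 0 :=
        Ideal.Quotient.eq_zero_iff_mem.2 card_residueField_mem_map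
      rw [map_natCast] at h0
      simp [Polynomial.derivative_X_pow, h0, hf.ne'])
  refine ⟨z, ?_, hzb⟩
  simpa [Polynomial.IsRoot, sub_eq_zero] using hz

/-- Nakayama: the Teichmüller elements represent all residue classes. -/
theorem span_pow_card_eq_top [IsNoetherianRing A] [IsAdicComplete (maximalIdeal A) A]
    [Module.Finite A B] {f : ℕ} (hf : 0 < f)
    (hB : ∀ x : B, x ^ Nat.card (ResidueField A) ^ f - x ∈
      (maximalIdeal A).map (algebraMap A B)) :
    Submodule.span A {z : B | z ^ Nat.card (ResidueField A) ^ f = z} = ⊤ := by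
  rw [eq_top_iff]
  refine Submodule.le_of_le_smul_of_le_jacobson_bot (I := maximalIdeal A) Module.Finite.fg_top
    (IsLocalRing.maximalIdeal_le_jacobson _) fun b _ => ?_
  obtain ⟨z, hz, hzb⟩ := exists_pow_card_eq hf hB b
  rw [← sub_sub_cancel z b]
  refine Submodule.sub_mem_sup (Submodule.subset_span hz) ?_
  rw [Ideal.smul_top_eq_map]
  exact hzb

end CompleteLocal

/-- Unramifiedness passes to the fraction field L over K, so L/K is separable, and integral closures
in finite separable extensions are finite. -/
theorem finite_integralClosure_of_formallyUnramified (A K L : Type*) [CommRing A] [IsDomain A]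
    [IsDiscreteValuationRing A] [Field K] [Algebra A K] [IsFractionRing A K] [Field L]
    [Algebra K L] [Algebra A L] [IsScalarTower A K L] [FiniteDimensional K L]
    [Algebra.FormallyUnramified A (integralClosure A L)] :
    Module.Finite A (integralClosure A L) := by
  have : IsFractionRing (integralClosure A L) L :=
    integralClosure.isFractionRing_of_finite_extension K L
  have h1 : Algebra.FormallyUnramified (integralClosure A L) L :=
    .of_isLocalization (nonZeroDivisors (integralClosure A L))
  have h2 : Algebra.FormallyUnramified A L := .comp A (integralClosure A L) L
  have h3 : Algebra.FormallyUnramified K L := .of_restrictScalars A K L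
  have h4 : Algebra.IsSeparable K L := Algebra.FormallyUnramified.isSeparable K L
  exact IsIntegralClosure.finite A K L (integralClosure A L)

/-! ### Unramified extensions generated by a lift of an irreducible residual polynomial -/

section Monogenic

open IsLocalRing

variable {A W : Type*} [CommRing A] [IsLocalRing A] [CommRing W] [Algebra A W] {θ : W}
  {h : Polynomial A}

theorem map_maximalIdeal_ne_top [Algebra.IsIntegral A W] [FaithfulSMul A W] :
    (maximalIdeal A).map (algebraMap A W) ≠ ⊤ := by
  have hk : RingHom.ker (algebraMap A W) ≤ maximalIdeal A := by
    rw [(RingHom.injective_iff_ker_eq_bot _).1 (FaithfulSMul.algebraMap_injective A W)]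
    exact bot_le
  obtain ⟨Q, hQ, hQm⟩ := Ideal.exists_ideal_over_maximal_of_isIntegral (maximalIdeal A) hk
  exact ne_top_of_le_ne_top hQ.ne_top (Ideal.map_le_iff_le_comap.2 hQm.ge)

theorem exists_equiv_adjoinRoot [Algebra.IsIntegral A W] [FaithfulSMul A W]
    (hθ : Algebra.adjoin A {θ} = ⊤) (hh : Polynomial.aeval θ h = 0)
    (hirr : Irreducible (h.map (residue A))) :
    Nonempty (AdjoinRoot (h.map (residue A)) ≃+* W ⧸ (maximalIdeal A).map (algebraMap A W)) := by
  set J := (maximalIdeal A).map (algebraMap A W) with hJ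
  have := Fact.mk hirr
  have : Nontrivial (W ⧸ J) := Ideal.Quotient.nontrivial_iff.2 map_maximalIdeal_ne_top
  let g : ResidueField A →+* W ⧸ J := Ideal.quotientMap J (algebraMap A W) Ideal.le_comap_map
  have hg : g.comp (residue A) = (Ideal.Quotient.mk J).comp (algebraMap A W) := by
    ext; rfl
  let ψ : AdjoinRoot (h.map (residue A)) →+* W ⧸ J :=
    AdjoinRoot.lift g (Ideal.Quotient.mk J θ) (by
      rw [Polynomial.eval₂_map, hg, ← Polynomial.hom_eval₂, ← Polynomial.aeval_def, hh, map_zero])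
  refine ⟨RingEquiv.ofBijective ψ ⟨ψ.injective, fun y => ?_⟩⟩
  obtain ⟨w, rfl⟩ := Ideal.Quotient.mk_surjective y
  have hw : w ∈ Algebra.adjoin A {θ} := hθ ▸ Algebra.mem_top
  change _ ∈ ψ.range
  induction hw using Algebra.adjoin_induction with
  | mem x hx =>
    rw [Set.mem_singleton_iff.1 hx]
    exact ⟨AdjoinRoot.root _, AdjoinRoot.lift_root _⟩
  | algebraMap a =>
    exact ⟨AdjoinRoot.of _ (residue A a), (AdjoinRoot.lift_of _).trans (RingHom.congr_fun hg a)⟩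
  | add x y _ _ hx hy => rw [map_add]; exact add_mem hx hy
  | mul x y _ _ hx hy => rw [map_mul]; exact mul_mem hx hy

theorem isMaximal_map_maximalIdeal [Algebra.IsIntegral A W] [FaithfulSMul A W]
    (hθ : Algebra.adjoin A {θ} = ⊤) (hh : Polynomial.aeval θ h = 0)
    (hirr : Irreducible (h.map (residue A))) :
    ((maximalIdeal A).map (algebraMap A W)).IsMaximal := by
  obtain ⟨e⟩ := exists_equiv_adjoinRoot hθ hh hirr
  have := Fact.mk hirr
  exact Ideal.Quotient.maximal_of_isField _ (e.symm.toMulEquiv.isField (Field.toIsField _))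

/-- By integrality every maximal ideal of W lies over that of A, hence contains the extended ideal
and equals it. -/
theorem isUnit_of_notMem_map_maximalIdeal [Algebra.IsIntegral A W]
    (hJ : ((maximalIdeal A).map (algebraMap A W)).IsMaximal) {w : W}
    (hw : w ∉ (maximalIdeal A).map (algebraMap A W)) : IsUnit w := by
  by_contra hu
  obtain ⟨M, hM, hwM⟩ := exists_max_ideal_of_mem_nonunits hu
  have h1 : M.comap (algebraMap A W) = maximalIdeal A :=
    eq_maximalIdeal (Ideal.isMaximal_comap_of_isIntegral_of_isMaximal M)
  exact hw (hJ.eq_of_le hM.ne_top (Ideal.map_le_iff_le_comap.2 h1.ge) ▸ hwM)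

/-- Evaluate a Bézout relation between the residual polynomial and its derivative at the class of θ.
-/
theorem isUnit_aeval_derivative [Algebra.IsIntegral A W]
    (hJ : ((maximalIdeal A).map (algebraMap A W)).IsMaximal) (hh : Polynomial.aeval θ h = 0)
    (hsep : (h.map (residue A)).Separable) :
    IsUnit (Polynomial.aeval θ (Polynomial.derivative h)) := by
  refine isUnit_of_notMem_map_maximalIdeal hJ fun hmem => hJ.ne_top ?_
  set J := (maximalIdeal A).map (algebraMap A W) with hJ'
  obtain ⟨a, b, hab⟩ := hsep
  let g : ResidueField A →+* W ⧸ J := Ideal.quotientMap J (algebraMap A W) Ideal.le_comap_map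
  have hg : g.comp (residue A) = (Ideal.Quotient.mk J).comp (algebraMap A W) := by
    ext; rfl
  have key : ∀ P : Polynomial A, (P.map (residue A)).eval₂ g (Ideal.Quotient.mk J θ) =
      Ideal.Quotient.mk J (Polynomial.aeval θ P) := fun P => by
    rw [Polynomial.eval₂_map, hg, ← Polynomial.hom_eval₂, ← Polynomial.aeval_def]
  have h1 := congrArg (Polynomial.eval₂ g (Ideal.Quotient.mk J θ)) hab
  rw [Polynomial.eval₂_add, Polynomial.eval₂_mul, Polynomial.eval₂_mul, Polynomial.derivative_map,
    key, key, hh, Ideal.Quotient.eq_zero_iff_mem.2 hmem, map_zero, mul_zero, mul_zero, add_zero,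
    Polynomial.eval₂_one] at h1
  rw [Ideal.eq_top_iff_one, ← Ideal.Quotient.eq_zero_iff_mem, map_one, ← h1]

end Monogenic

/-- Two maps agreeing modulo a square-zero ideal differ at θ by some ε with h'(f₂ θ) ε = 0, by
Taylor expansion; the derivative is a unit, so ε = 0. -/
theorem formallyUnramified_of_adjoin_eq_top {A W : Type*} [CommRing A] [CommRing W]
    [Algebra A W] {θ : W} {h : Polynomial A}
    (hθ : Algebra.adjoin A {θ} = ⊤) (hh : Polynomial.aeval θ h = 0)
    (hu : IsUnit (Polynomial.aeval θ (Polynomial.derivative h))) :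
    Algebra.FormallyUnramified A W := by
  rw [Algebra.FormallyUnramified.iff_comp_injective]
  intro B _ _ I hI f₁ f₂ e
  refine AlgHom.ext_of_adjoin_eq_top hθ fun x hx => ?_
  rw [Set.mem_singleton_iff.1 hx]
  have h1 : f₁ θ - f₂ θ ∈ I := by
    simpa [Ideal.Quotient.mk_eq_mk_iff_sub_mem] using AlgHom.congr_fun e θ
  have h2 := Polynomial.eval_add_of_sq_eq_zero (h.map (algebraMap A B)) (f₂ θ)
    (f₁ θ - f₂ θ) (show (f₁ θ - f₂ θ) ^ 2 ∈ (⊥ : Ideal B) from hI ▸ Ideal.pow_mem_pow h1 2)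
  simp only [add_sub_cancel, Polynomial.eval_map_algebraMap, Polynomial.aeval_algHom_apply, hh,
    map_zero, Polynomial.derivative_map, zero_add] at h2
  rwa [eq_comm, (hu.map f₂).mul_right_eq_zero, sub_eq_zero] at h2

theorem FiniteField.exists_monic_irreducible (k : Type*) [Field k] [Finite k] {f : ℕ}
    (hf : 0 < f) : ∃ g : Polynomial k, g.Monic ∧ Irreducible g ∧ g.natDegree = f := by
  obtain ⟨p, hp⟩ := CharP.exists k
  have := Fact.mk (CharP.char_is_prime k p)
  have := NeZero.mk hf.ne'
  obtain ⟨α, hα⟩ := Field.exists_primitive_element k (FiniteField.Extension k p f)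
  have hi : IsIntegral k α := Algebra.IsIntegral.isIntegral α
  refine ⟨minpoly k α, minpoly.monic hi, minpoly.irreducible hi, ?_⟩
  rw [← IntermediateField.adjoin.finrank hi, hα, IntermediateField.finrank_top',
    FiniteField.finrank_extension]

/-! ### Monogenic unramified extensions inside an algebraic closure -/

section Residual

open IsLocalRing

variable {A W : Type*} [CommRing A] [IsLocalRing A] [CommRing W] [Algebra A W]
  [Algebra.IsIntegral A W] [FaithfulSMul A W] {θ : W} {h : Polynomial A}

theorem card_quotient_map_maximalIdeal (hθ : Algebra.adjoin A {θ} = ⊤)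
    (hh : Polynomial.aeval θ h = 0) (hirr : Irreducible (h.map (residue A))) :
    Nat.card (W ⧸ (maximalIdeal A).map (algebraMap A W)) =
      Nat.card (ResidueField A) ^ (h.map (residue A)).natDegree := by
  obtain ⟨e⟩ := exists_equiv_adjoinRoot hθ hh hirr
  have := Fact.mk hirr
  have := (AdjoinRoot.powerBasis hirr.ne_zero).finite
  rw [← Nat.card_congr e.toEquiv,
    Module.natCard_eq_pow_finrank (K := ResidueField A),
    PowerBasis.finrank (AdjoinRoot.powerBasis hirr.ne_zero), AdjoinRoot.powerBasis_dim]

theorem pow_card_sub_mem_map_maximalIdeal [Finite (ResidueField A)] (hθ : Algebra.adjoin A {θ} = ⊤)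
    (hh : Polynomial.aeval θ h = 0) (hirr : Irreducible (h.map (residue A))) (w : W) :
    w ^ Nat.card (ResidueField A) ^ (h.map (residue A)).natDegree - w ∈
      (maximalIdeal A).map (algebraMap A W) := by
  have hmax := isMaximal_map_maximalIdeal hθ hh hirr
  have hc := card_quotient_map_maximalIdeal hθ hh hirr
  let _ := Ideal.Quotient.field ((maximalIdeal A).map (algebraMap A W))
  have : Finite (W ⧸ (maximalIdeal A).map (algebraMap A W)) :=
    Nat.finite_of_card_ne_zero (hc ▸ pow_ne_zero _ Nat.card_pos.ne')
  have := Fintype.ofFinite (W ⧸ (maximalIdeal A).map (algebraMap A W))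
  rw [← Ideal.Quotient.eq, map_pow, ← hc, Nat.card_eq_fintype_card, FiniteField.pow_card]

end Residual

section Ambient

open IsLocalRing

variable {A Ω : Type*} [CommRing A] [Field Ω] [Algebra A Ω] [FaithfulSMul A Ω]

theorem Subalgebra.faithfulSMul_of_faithfulSMul (W : Subalgebra A Ω) : FaithfulSMul A W :=
  (faithfulSMul_iff_algebraMap_injective A W).2 fun _ _ h =>
    FaithfulSMul.algebraMap_injective A Ω (congrArg Subtype.val h)

/-- A non-unit with integral inverse would make the maximal ideal extend to the unit ideal of the
integral closure, against lying over. -/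
theorem isUnit_of_isIntegral_of_mul_eq_one [IsLocalRing A] {a : A} {y : Ω}
    (hy : IsIntegral A y) (h : algebraMap A Ω a * y = 1) : IsUnit a := by
  by_contra ha
  have := (integralClosure A Ω).faithfulSMul_of_faithfulSMul
  refine map_maximalIdeal_ne_top (A := A) (W := integralClosure A Ω) ?_
  rw [Ideal.eq_top_iff_one]
  have : algebraMap A (integralClosure A Ω) a * ⟨y, hy⟩ = 1 := Subtype.ext h
  rw [← this]
  exact Ideal.mul_mem_right _ _ (Ideal.mem_map_of_mem _ ha)

/-- If πy ∈ πW, cancel π. Otherwise πy is a unit of W, so π has an inverse integral over A, which is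
impossible. Thus one factor π of a denominator can be removed. -/
theorem Subalgebra.mem_of_algebraMap_mul_mem [IsLocalRing A] (W : Subalgebra A Ω)
    [Algebra.IsIntegral A W]
    (hJ : ((maximalIdeal A).map (algebraMap A W)).IsMaximal) {π : A}
    (hπ : maximalIdeal A = Ideal.span {π}) (hπ0 : π ≠ 0) {y : Ω} (hy : IsIntegral A y)
    (hyW : algebraMap A Ω π * y ∈ W) : y ∈ W := by
  have hπΩ : algebraMap A Ω π ≠ 0 := by simpa using hπ0
  by_cases hw : (⟨_, hyW⟩ : W) ∈ (maximalIdeal A).map (algebraMap A W)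
  · rw [hπ, Ideal.map_span, Set.image_singleton, Ideal.mem_span_singleton'] at hw
    obtain ⟨v, hv⟩ := hw
    have h1 : (v : Ω) * algebraMap A Ω π = algebraMap A Ω π * y := congrArg Subtype.val hv
    rw [mul_comm] at h1
    rw [← mul_left_cancel₀ hπΩ h1]
    exact v.2
  · obtain ⟨v, hv⟩ := (isUnit_of_notMem_map_maximalIdeal hJ hw).exists_right_inv
    have h1 : algebraMap A Ω π * y * (v : Ω) = 1 := congrArg Subtype.val hv
    have hvi : IsIntegral A (v : Ω) := (Algebra.IsIntegral.isIntegral v).map W.val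
    have hu := isUnit_of_isIntegral_of_mul_eq_one (hy.mul hvi) (by rw [← mul_assoc, h1])
    have hm : π ∈ maximalIdeal A := hπ ▸ Ideal.mem_span_singleton_self π
    exact absurd hu hm

/-- Some non-zero multiple ax lies in A[θ]; up to a unit a is a power of π, and the powers are
stripped one at a time. -/
theorem mem_adjoin_of_isIntegral [IsDomain A] [IsDiscreteValuationRing A] (K : Type*) [Field K]
    [Algebra A K] [IsFractionRing A K] [Algebra K Ω] [IsScalarTower A K Ω] {θ : Ω}
    (hθ : IsIntegral A θ)
    (hJ : ((maximalIdeal A).map (algebraMap A (Algebra.adjoin A {θ}))).IsMaximal) {x : Ω}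
    (hx : x ∈ IntermediateField.adjoin K {θ}) (hxi : IsIntegral A x) :
    x ∈ Algebra.adjoin A {θ} := by
  obtain ⟨π, hπ⟩ := IsDiscreteValuationRing.exists_irreducible A
  have : Algebra.IsIntegral A (Algebra.adjoin A {θ}) :=
    Algebra.IsIntegral.adjoin fun y hy => by rwa [Set.mem_singleton_iff.1 hy]
  have key : ∃ a : A, a ≠ 0 ∧ algebraMap A Ω a * x ∈ Algebra.adjoin A {θ} := by
    rw [← IntermediateField.mem_toSubalgebra,
      IntermediateField.adjoin_simple_toSubalgebra_of_isAlgebraic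
        (hθ.tower_top (A := K)).isAlgebraic] at hx
    clear hxi
    induction hx using Algebra.adjoin_induction with
    | mem x hx => exact ⟨1, one_ne_zero, by simpa using Algebra.subset_adjoin hx⟩
    | algebraMap k =>
      obtain ⟨a, b, hb, rfl⟩ := IsFractionRing.div_surjective (A := A) k
      have hb0 := nonZeroDivisors.ne_zero hb
      refine ⟨b, hb0, ?_⟩
      have hb1 : algebraMap A Ω b ≠ 0 := by simpa using hb0
      rw [map_div₀, ← IsScalarTower.algebraMap_apply, ← IsScalarTower.algebraMap_apply,
        mul_div_cancel₀ _ hb1]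
      exact Subalgebra.algebraMap_mem _ a
    | add x y _ _ hx hy =>
      obtain ⟨a, ha, hax⟩ := hx
      obtain ⟨b, hb, hby⟩ := hy
      refine ⟨a * b, mul_ne_zero ha hb, ?_⟩
      rw [map_mul, mul_add]
      refine add_mem ?_ ?_
      · rw [mul_comm (algebraMap A Ω a), mul_assoc]
        exact mul_mem (Subalgebra.algebraMap_mem _ b) hax
      · rw [mul_assoc]
        exact mul_mem (Subalgebra.algebraMap_mem _ a) hby
    | mul x y _ _ hx hy =>
      obtain ⟨a, ha, hax⟩ := hx
      obtain ⟨b, hb, hby⟩ := hy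
      refine ⟨a * b, mul_ne_zero ha hb, ?_⟩
      rw [map_mul, mul_mul_mul_comm]
      exact mul_mem hax hby
  obtain ⟨a, ha, hax⟩ := key
  obtain ⟨n, u, rfl⟩ := IsDiscreteValuationRing.eq_unit_mul_pow_irreducible ha hπ
  have hn : algebraMap A Ω π ^ n * x ∈ Algebra.adjoin A {θ} := by
    have := mul_mem (Subalgebra.algebraMap_mem (Algebra.adjoin A {θ}) (↑u⁻¹ : A)) hax
    rwa [← mul_assoc, ← map_mul, ← mul_assoc, Units.inv_mul, one_mul, map_pow] at this
  clear hax ha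
  induction n with
  | zero => simpa using hn
  | succ n ih =>
    refine ih (Subalgebra.mem_of_algebraMap_mul_mem _ hJ hπ.maximalIdeal_eq hπ.ne_zero
      ((isIntegral_algebraMap.pow n).mul hxi) ?_)
    rwa [← mul_assoc, ← pow_succ']

theorem formallyUnramified_integralClosure_adjoin [IsDomain A] [IsDiscreteValuationRing A]
    (K : Type*) [Field K] [Algebra A K] [IsFractionRing A K] [Algebra K Ω] [IsScalarTower A K Ω]
    {θ : Ω} (hθ : IsIntegral A θ)
    (hJ : ((maximalIdeal A).map (algebraMap A (Algebra.adjoin A {θ}))).IsMaximal)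
    [Algebra.FormallyUnramified A (Algebra.adjoin A {θ})] :
    Algebra.FormallyUnramified A (integralClosure A (IntermediateField.adjoin K {θ})) := by
  let g : integralClosure A (IntermediateField.adjoin K {θ}) →ₐ[A] Ω :=
    ((IntermediateField.adjoin K {θ}).val.restrictScalars A).comp (Subalgebra.val _)
  have hg : Function.Injective g := fun x y h => Subtype.ext (Subtype.ext h)
  have hr : Algebra.adjoin A {θ} = g.range := by
    refine le_antisymm ?_ ?_
    · rw [Algebra.adjoin_le_iff, Set.singleton_subset_iff]
      exact ⟨⟨⟨θ, IntermediateField.mem_adjoin_simple_self K θ⟩,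
        (isIntegral_algHom_iff ((IntermediateField.adjoin K {θ}).val.restrictScalars A)
          Subtype.val_injective).1 hθ⟩, rfl⟩
    · rintro _ ⟨x, rfl⟩
      exact mem_adjoin_of_isIntegral K hθ hJ x.1.2 ((show IsIntegral A x.1 from x.2).map
        ((IntermediateField.adjoin K {θ}).val.restrictScalars A))
  exact Algebra.FormallyUnramified.of_equiv
    ((Subalgebra.equivOfEq _ _ hr).trans (AlgEquiv.ofInjective g hg).symm)

end Ambient

/-- The polynomial X^Q - X has at most Q roots, so Q distinct ones are all of them. -/
theorem range_eq_of_pow_eq {ι Ω : Type*} [Field Ω] {Q : ℕ} (hQ : 1 < Q) (s : ι → Ω)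
    (hinj : Function.Injective s) (hs : ∀ i, s i ^ Q = s i) (hc : Nat.card ι = Q) :
    Set.range s = {z | z ^ Q = z} := by
  classical
  have hP : (Polynomial.X ^ Q - Polynomial.X : Polynomial Ω) ≠ 0 :=
    FiniteField.X_pow_card_sub_X_ne_zero Ω hQ
  have hroot : {z : Ω | z ^ Q = z} =
      ((Polynomial.X ^ Q - Polynomial.X : Polynomial Ω).roots.toFinset : Set Ω) := by
    ext x
    simp [hP, sub_eq_zero]
  have : Finite ι := Nat.finite_of_card_ne_zero (by omega)
  rw [hroot]
  refine Set.eq_of_subset_of_ncard_le ?_ ?_ (Finset.finite_toSet _)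
  · rw [← hroot]
    rintro _ ⟨i, rfl⟩
    exact hs i
  · rw [Set.ncard_coe_finset, Set.ncard_range_of_injective hinj, hc]
    refine (Multiset.toFinset_card_le _).trans ((Polynomial.card_roots' _).trans ?_)
    rw [FiniteField.X_pow_card_sub_X_natDegree_eq Ω hQ]

open IsLocalRing in
-- Lifting each of the q^f residue classes of W to a Teichmüller element yields q^f distinct roots
-- of X^(q^f) - X in W, hence all its roots in Ω.
theorem mem_of_pow_card_eq {A Ω : Type*} [CommRing A] [Field Ω] [Algebra A Ω] [IsLocalRing A]
    [IsNoetherianRing A] [Finite (ResidueField A)]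
    [IsAdicComplete (maximalIdeal A) A] (W : Subalgebra A Ω) [Module.Finite A W] {f : ℕ}
    (hf : 0 < f) (hW : ∀ x : W, x ^ Nat.card (ResidueField A) ^ f - x ∈
      (maximalIdeal A).map (algebraMap A W))
    (hc : Nat.card (W ⧸ (maximalIdeal A).map (algebraMap A W)) = Nat.card (ResidueField A) ^ f)
    {z : Ω} (hz : z ^ Nat.card (ResidueField A) ^ f = z) : z ∈ W := by
  set q := Nat.card (ResidueField A) with hq
  set J := (maximalIdeal A).map (algebraMap A W) with hJ
  have hq1 : 1 < q ^ f := Nat.one_lt_pow hf.ne' Finite.one_lt_card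
  choose s hs hsJ using fun y : W ⧸ J => exists_pow_card_eq hf hW y.out
  have hinj : Function.Injective fun y => (s y : Ω) := by
    intro x y hxy
    have h1 : s x = s y := Subtype.ext hxy
    have h2 : ∀ x, Ideal.Quotient.mk J (s x) = x := fun x => by
      conv_rhs => rw [← Ideal.Quotient.mk_out x]
      exact Ideal.Quotient.eq.2 (hsJ x)
    rw [← h2 x, h1, h2]
  have h := range_eq_of_pow_eq hq1 (fun y => (s y : Ω)) hinj
    (fun y => congrArg Subtype.val (hs y)) hc
  obtain ⟨y, rfl⟩ := h.ge hz
  exact (s y).2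

/-! ### The maximal unramified extension -/

section MaxUnramified

open IsLocalRing

/-- `θ` generates an integral extension of `A` that is local with maximal ideal generated by that
of `A`, formally unramified, and has residue field of degree `f`. -/
structure IsResidualGenerator (A : Type*) {Ω : Type*} [CommRing A] [IsLocalRing A] [Field Ω]
    [Algebra A Ω] (f : ℕ) (θ : Ω) : Prop where
  isIntegral : IsIntegral A θ
  isMaximal : ((maximalIdeal A).map (algebraMap A (Algebra.adjoin A {θ}))).IsMaximal
  formallyUnramified : Algebra.FormallyUnramified A (Algebra.adjoin A {θ})
  card : Nat.card (Algebra.adjoin A {θ} ⧸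
    (maximalIdeal A).map (algebraMap A (Algebra.adjoin A {θ}))) = Nat.card (ResidueField A) ^ f
  pow_sub_mem : ∀ w : Algebra.adjoin A {θ}, w ^ Nat.card (ResidueField A) ^ f - w ∈
    (maximalIdeal A).map (algebraMap A (Algebra.adjoin A {θ}))

theorem isIntegral_adjoin_singleton {A Ω : Type*} [CommRing A] [CommRing Ω] [Algebra A Ω] {θ : Ω}
    (hθ : IsIntegral A θ) : Algebra.IsIntegral A (Algebra.adjoin A {θ}) :=
  Algebra.IsIntegral.adjoin fun y hy => by rwa [Set.mem_singleton_iff.1 hy]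

/-- Take a root of a monic lift of an irreducible polynomial of degree f over the residue field,
separable because finite fields are perfect. -/
theorem exists_isResidualGenerator (A Ω : Type*) [CommRing A] [IsLocalRing A]
    [Finite (ResidueField A)] [Field Ω] [IsAlgClosed Ω] [Algebra A Ω] [FaithfulSMul A Ω]
    {f : ℕ} (hf : 0 < f) : ∃ θ : Ω, IsResidualGenerator A f θ := by
  obtain ⟨g, hgm, hgi, hgd⟩ := FiniteField.exists_monic_irreducible (ResidueField A) hf
  obtain ⟨h, hhg, hhd, hhm⟩ := Polynomial.lifts_and_natDegree_eq_and_monic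
    ((Polynomial.mem_lifts _).2 (Polynomial.map_surjective _ residue_surjective g)) hgm
  obtain ⟨θ, hθ⟩ := IsAlgClosed.exists_aeval_eq_zero_of_injective Ω
    (FaithfulSMul.algebraMap_injective A Ω) h (by
      rw [Polynomial.degree_eq_natDegree hhm.ne_zero, hhd, hgd]; exact_mod_cast hf.ne')
  have hi : IsIntegral A θ := ⟨h, hhm, hθ⟩
  have := isIntegral_adjoin_singleton hi
  have := (Algebra.adjoin A {θ}).faithfulSMul_of_faithfulSMul
  let θ' : Algebra.adjoin A {θ} := ⟨θ, Algebra.self_mem_adjoin_singleton A θ⟩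
  have hθ' : Polynomial.aeval θ' h = 0 := by
    apply Subtype.ext
    rw [← Subalgebra.coe_val, ← Polynomial.aeval_algHom_apply]
    exact hθ
  have htop : Algebra.adjoin A {θ'} = ⊤ := by
    rw [← Algebra.adjoin_adjoin_coe_preimage (R := A) (s := {θ})]
    congr 1
    ext x
    simp [θ', Subtype.ext_iff]
  rw [← hhg] at hgi hgd
  have hmax := isMaximal_map_maximalIdeal htop hθ' hgi
  refine ⟨θ, hi, hmax, ?_, ?_, ?_⟩
  · exact formallyUnramified_of_adjoin_eq_top htop hθ'
      (isUnit_aeval_derivative hmax hθ' (PerfectField.separable_of_irreducible hgi))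
  · rw [card_quotient_map_maximalIdeal htop hθ' hgi, hgd]
  · intro w
    have := pow_card_sub_mem_map_maximalIdeal htop hθ' hgi w
    rwa [hgd] at this

/-- The solutions of `z ^ q ^ f = z`, where `q` is the cardinality of the residue field. -/
def teichmullerSet (A Ω : Type*) [CommRing A] [IsLocalRing A] [Field Ω] (f : ℕ) : Set Ω :=
  {z | z ^ Nat.card (ResidueField A) ^ f = z}

theorem teichmullerSet_subset_mul (A Ω : Type*) [CommRing A] [IsLocalRing A] [Field Ω]
    (f k : ℕ) : teichmullerSet A Ω f ⊆ teichmullerSet A Ω (f * k) := by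
  intro z (hz : _ = _)
  change _ = _
  induction k with
  | zero => simp
  | succ k ih => rw [mul_add, mul_one, pow_add, pow_mul, ih, hz]

instance faithfulSMul_algebraicClosure_fractionRing (O : Type*) [CommRing O] [IsDomain O] :
    FaithfulSMul O (AlgebraicClosure (FractionRing O)) := by
  rw [faithfulSMul_iff_algebraMap_injective,
    IsScalarTower.algebraMap_eq O (FractionRing O) (AlgebraicClosure (FractionRing O)),
    RingHom.coe_comp]
  exact (algebraMap (FractionRing O) (AlgebraicClosure (FractionRing O))).injective.comp
    (IsFractionRing.injective O (FractionRing O))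

instance faithfulSMul_unramifiedIntegers (O : Type*) [CommRing O] [IsDomain O] :
    FaithfulSMul O (UnramifiedIntegers O) := by
  refine (faithfulSMul_iff_algebraMap_injective _ _).2 fun a b hab => ?_
  have h := congrArg (fun x : UnramifiedIntegers O =>
    ((x : maxUnramifiedExt O) : AlgebraicClosure (FractionRing O))) hab
  exact FaithfulSMul.algebraMap_injective O (AlgebraicClosure (FractionRing O)) h

variable {O : Type*} [CommRing O] [IsDomain O] [IsDiscreteValuationRing O]

theorem IsResidualGenerator.adjoin_le {f : ℕ} {θ : AlgebraicClosure (FractionRing O)}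
    (h : IsResidualGenerator O f θ) :
    IntermediateField.adjoin (FractionRing O) {θ} ≤ maxUnramifiedExt O := by
  have := h.formallyUnramified
  exact le_sSup ⟨IntermediateField.adjoin.finiteDimensional (h.isIntegral.tower_top),
    formallyUnramified_integralClosure_adjoin _ h.isIntegral h.isMaximal⟩

/-- The inclusion of `O[θ]` into the ring of integers of the maximal unramified extension. -/
def IsResidualGenerator.inclusion {f : ℕ} {θ : AlgebraicClosure (FractionRing O)}
    (h : IsResidualGenerator O f θ) : Algebra.adjoin O {θ} →ₐ[O] UnramifiedIntegers O where
  toFun w := ⟨⟨w, h.adjoin_le ((Algebra.adjoin_le (S := (IntermediateField.adjoin (FractionRing O)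
      {θ}).toSubalgebra.restrictScalars O) (Set.singleton_subset_iff.2
        (IntermediateField.mem_adjoin_simple_self _ θ)) : _ ≤ _) w.2)⟩,
    (isIntegral_algHom_iff ((maxUnramifiedExt O).val.restrictScalars O)
      Subtype.val_injective).1 (by
        have := isIntegral_adjoin_singleton h.isIntegral
        exact (Algebra.IsIntegral.isIntegral (R := O) w).map (Subalgebra.val _))⟩
  map_one' := rfl
  map_mul' _ _ := rfl
  map_zero' := rfl
  map_add' _ _ := rfl
  commutes' _ := rfl

theorem unramifiedIdeal_ne_top : unramifiedIdeal O ≠ ⊤ := by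
  exact map_maximalIdeal_ne_top

/-- The residue field of 𝒪[θ] has q^f elements, all satisfying the equation, and embeds into k
through g. -/
theorem ncard_pow_card_eq [Finite (ResidueField O)] {k : Type*} [Field k] (g : UnramifiedIntegers O →+* k)
    (hg : ∀ a ∈ maximalIdeal O, g (algebraMap O _ a) = 0) {f : ℕ} (hf : 0 < f) :
    {y : k | y ^ Nat.card (ResidueField O) ^ f = y}.ncard = Nat.card (ResidueField O) ^ f := by
  obtain ⟨θ, hθ⟩ := exists_isResidualGenerator O (AlgebraicClosure (FractionRing O)) hf
  set J := (maximalIdeal O).map (algebraMap O (Algebra.adjoin O {θ})) with hJ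
  have := hθ.isMaximal
  let _ := Ideal.Quotient.field J
  let s : Algebra.adjoin O {θ} ⧸ J →+* k :=
    Ideal.Quotient.lift J (g.comp hθ.inclusion) (by
      change J ≤ RingHom.ker _
      refine Ideal.map_le_iff_le_comap.2 fun a ha => ?_
      rw [Ideal.mem_comap, RingHom.mem_ker, RingHom.comp_apply, ← hg a ha]
      exact congrArg g (hθ.inclusion.commutes a))
  rw [← range_eq_of_pow_eq (Nat.one_lt_pow hf.ne' Finite.one_lt_card) s s.injective ?_ hθ.card,
    Set.ncard_range_of_injective s.injective, hθ.card]
  intro y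
  obtain ⟨w, rfl⟩ := Ideal.Quotient.mk_surjective y
  rw [← map_pow, ← map_pow, Ideal.Quotient.eq.2 (hθ.pow_sub_mem w)]

variable [IsAdicComplete (maximalIdeal O) O] [Finite (ResidueField O)]

theorem IsResidualGenerator.teichmullerSet_subset {Ω : Type*} [Field Ω] [Algebra O Ω] {f : ℕ}
    (hf : 0 < f) {θ : Ω} (h : IsResidualGenerator O f θ) :
    teichmullerSet O Ω f ⊆ Algebra.adjoin O {θ} := by
  intro z hz
  have : Module.Finite O (Algebra.adjoin O {θ}) :=
    Module.Finite.iff_fg.2 h.isIntegral.fg_adjoin_singleton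
  exact mem_of_pow_card_eq _ hf h.pow_sub_mem h.card hz

/-- The integral closure in L is spanned over 𝒪 by Teichmüller elements, and L is its fraction
field. -/
theorem exists_le_adjoin_teichmullerSet
    (L : IntermediateField (FractionRing O) (AlgebraicClosure (FractionRing O)))
    [FiniteDimensional (FractionRing O) L] [Algebra.FormallyUnramified O (integralClosure O L)] :
    ∃ f, 0 < f ∧ L ≤ IntermediateField.adjoin (FractionRing O)
      (teichmullerSet O (AlgebraicClosure (FractionRing O)) f) := by
  have := finite_integralClosure_of_formallyUnramified O (FractionRing O) L
  obtain ⟨f, hf, hB⟩ := exists_pow_card_sub_mem (A := O) (B := integralClosure O L)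
  have hs := span_pow_card_eq_top hf hB
  refine ⟨f, hf, fun x hx => ?_⟩
  have key : ∀ b : integralClosure O L, ((b : L) : AlgebraicClosure (FractionRing O)) ∈
      IntermediateField.adjoin (FractionRing O)
        (teichmullerSet O (AlgebraicClosure (FractionRing O)) f) := by
    intro b
    have hb : b ∈ Submodule.span O
      {z : integralClosure O L | z ^ Nat.card (ResidueField O) ^ f = z} := hs ▸ trivial
    induction hb using Submodule.span_induction with
    | mem z hz =>
      refine IntermediateField.subset_adjoin _ _ ?_
      exact congrArg (fun b : integralClosure O L =>
        ((b : L) : AlgebraicClosure (FractionRing O))) hz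
    | zero => exact zero_mem _
    | add x y _ _ hx hy => exact add_mem hx hy
    | smul a x _ hx =>
      have : (((a • x : integralClosure O L) : L) : AlgebraicClosure (FractionRing O)) =
        algebraMap (FractionRing O) _ (algebraMap O (FractionRing O) a) * ((x : L) : _) := by
        rw [← IsScalarTower.algebraMap_apply, ← Algebra.smul_def]
        rfl
      rw [this]
      exact mul_mem (IntermediateField.algebraMap_mem _ _) hx
  have : IsFractionRing (integralClosure O L) L :=
    integralClosure.isFractionRing_of_finite_extension (FractionRing O) L
  obtain ⟨a, b, -, hab⟩ := IsFractionRing.div_surjective (A := integralClosure O L) (⟨x, hx⟩ : L)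
  have : x = ((a : L) : AlgebraicClosure (FractionRing O)) / ((b : L) : _) :=
    (congrArg Subtype.val hab).symm
  rw [this]
  exact div_mem (key a) (key b)

theorem exists_mem_adjoin_teichmullerSet {x : AlgebraicClosure (FractionRing O)}
    (hx : x ∈ maxUnramifiedExt O) : ∃ f, 0 < f ∧ x ∈ IntermediateField.adjoin (FractionRing O)
      (teichmullerSet O (AlgebraicClosure (FractionRing O)) f) := by
  -- The shift by one keeps the residue degree positive; the family is directed under divisibility
  -- of degrees.
  let N : ℕ → IntermediateField (FractionRing O) (AlgebraicClosure (FractionRing O)) := fun f =>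
    IntermediateField.adjoin _ (teichmullerSet O (AlgebraicClosure (FractionRing O)) (f + 1))
  have hN : Directed (· ≤ ·) N := by
    intro f g
    refine ⟨(f + 1) * (g + 1) - 1, IntermediateField.adjoin.mono _ _ _ ?_,
      IntermediateField.adjoin.mono _ _ _ ?_⟩
    · rw [Nat.sub_add_cancel (Nat.mul_pos f.succ_pos g.succ_pos)]
      exact teichmullerSet_subset_mul _ _ _ _
    · rw [Nat.sub_add_cancel (Nat.mul_pos f.succ_pos g.succ_pos), mul_comm]
      exact teichmullerSet_subset_mul _ _ _ _
  have hle : maxUnramifiedExt O ≤ ⨆ f, N f := by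
    refine sSup_le fun L ⟨h1, h2⟩ => ?_
    obtain ⟨f, hf, hL⟩ := exists_le_adjoin_teichmullerSet L
    refine hL.trans (le_trans (le_of_eq ?_) (le_iSup N (f - 1)))
    simp only [N]
    rw [Nat.sub_add_cancel hf]
  have h := hle hx
  rw [← SetLike.mem_coe, IntermediateField.coe_iSup_of_directed hN, Set.mem_iUnion] at h
  obtain ⟨f, hf⟩ := h
  exact ⟨f + 1, f.succ_pos, hf⟩

/-- The Teichmüller elements of degree f all lie in 𝒪[θ], so x lies in K(θ); being integral, it lies
in 𝒪[θ]. -/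
theorem exists_mem_adjoin_residualGenerator (x : UnramifiedIntegers O) :
    ∃ f θ, 0 < f ∧ IsResidualGenerator O f θ ∧
      ((x : maxUnramifiedExt O) : AlgebraicClosure (FractionRing O)) ∈ Algebra.adjoin O {θ} := by
  obtain ⟨f, hf, hx⟩ := exists_mem_adjoin_teichmullerSet x.1.2
  obtain ⟨θ, hθ⟩ := exists_isResidualGenerator O (AlgebraicClosure (FractionRing O)) hf
  refine ⟨f, θ, hf, hθ, mem_adjoin_of_isIntegral (FractionRing O) hθ.isIntegral hθ.isMaximal ?_ ?_⟩
  · refine (IntermediateField.adjoin_le_iff.2 fun z hz => ?_ :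
      IntermediateField.adjoin (FractionRing O) (teichmullerSet O _ f) ≤ _) hx
    have h1 := hθ.teichmullerSet_subset hf hz
    refine (Algebra.adjoin_le (S := (IntermediateField.adjoin (FractionRing O)
      {θ}).toSubalgebra.restrictScalars O) ?_ : _ ≤ _) h1
    rw [Set.singleton_subset_iff]
    exact IntermediateField.mem_adjoin_simple_self _ θ
  · exact (show IsIntegral O x.1 from x.2).map ((maxUnramifiedExt O).val.restrictScalars O)

/-- The dichotomy holds in 𝒪[θ], whose only maximal ideal is generated by that of 𝒪, and it
transfers along the inclusion. -/
theorem isUnit_or_mem_unramifiedIdeal (x : UnramifiedIntegers O) :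
    IsUnit x ∨ x ∈ unramifiedIdeal O := by
  obtain ⟨f, θ, hf, hθ, hx⟩ := exists_mem_adjoin_residualGenerator x
  have hxe : x = hθ.inclusion ⟨_, hx⟩ := rfl
  have := isIntegral_adjoin_singleton hθ.isIntegral
  by_cases hm : (⟨_, hx⟩ : Algebra.adjoin O {θ}) ∈
    (maximalIdeal O).map (algebraMap O (Algebra.adjoin O {θ}))
  · right
    have h1 := Ideal.mem_map_of_mem (hθ.inclusion : _ →+* UnramifiedIntegers O) hm
    rw [Ideal.map_map, AlgHom.comp_algebraMap] at h1
    exact h1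
  · left
    rw [hxe]
    exact (isUnit_of_notMem_map_maximalIdeal hθ.isMaximal hm).map _

instance isLocalRing_unramifiedIntegers : IsLocalRing (UnramifiedIntegers O) :=
  IsLocalRing.of_nonunits_add fun a b ha hb => by
    have h1 := (isUnit_or_mem_unramifiedIdeal a).resolve_left ha
    have h2 := (isUnit_or_mem_unramifiedIdeal b).resolve_left hb
    exact fun hu => unramifiedIdeal_ne_top
      (Ideal.eq_top_of_isUnit_mem _ ((unramifiedIdeal O).add_mem h1 h2) hu)

end MaxUnramified

/-! ### Truncations of a ring with Frobenius -/

section Truncation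

open IsLocalRing

/-- In a^Q - b^Q = (∑ a^j b^(Q-1-j))(a - b) the sum is congruent to Q a^(Q-1), hence to 0, modulo π.
-/
theorem pow_sub_pow_mem_span_pow {R : Type*} [CommRing R] {π : R} {Q : ℕ}
    (hQ : (Q : R) ∈ Ideal.span {π}) {i : ℕ} (hi : 0 < i) {a b : R}
    (hab : a - b ∈ Ideal.span {π} ^ i) : a ^ Q - b ^ Q ∈ Ideal.span {π} ^ (i + 1) := by
  rw [← (Commute.all a b).geom_sum₂_mul, pow_succ' _ i]
  refine Ideal.mul_mem_mul ?_ hab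
  have h1 : Ideal.Quotient.mk (Ideal.span {π}) a = Ideal.Quotient.mk (Ideal.span {π}) b :=
    Ideal.Quotient.eq.2 (Ideal.pow_le_self hi.ne' hab)
  rw [← Ideal.Quotient.eq_zero_iff_mem, map_sum]
  simp only [map_mul, map_pow, h1]
  rw [Finset.sum_congr rfl fun j hj => by
    rw [← pow_add, Nat.add_sub_cancel' (Nat.le_sub_one_of_lt (Finset.mem_range.1 hj))],
    Finset.sum_const, Finset.card_range, nsmul_eq_mul,
    ← map_natCast (Ideal.Quotient.mk (Ideal.span {π})), Ideal.Quotient.eq_zero_iff_mem.2 hQ,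
    zero_mul]

theorem pow_pow_sub_pow_pow_mem_span_pow {R : Type*} [CommRing R] {π : R} {Q : ℕ}
    (hQ : (Q : R) ∈ Ideal.span {π}) {a b : R} (hab : a - b ∈ Ideal.span {π}) (N : ℕ) :
    a ^ Q ^ N - b ^ Q ^ N ∈ Ideal.span {π} ^ (N + 1) := by
  induction N with
  | zero => simpa using hab
  | succ N ih =>
    rw [pow_succ Q, pow_mul, pow_mul]
    exact pow_sub_pow_mem_span_pow hQ N.succ_pos ih

variable {R : Type*} [CommRing R] [IsLocalRing R] {π : R} {r : ℕ}
  (hmax : maximalIdeal R = Ideal.span {π}) (hpow : π ^ r = 0)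
  (hann : ∀ j ≤ r, ∀ x, π ^ j * x = 0 → x ∈ Ideal.span {π} ^ (r - j))
  {τ : R ≃+* R} (hfix : τ π = π) {Q : ℕ} (hQ : ∀ x, residue R (τ x) = residue R x ^ Q)

include hmax hann hfix hQ in
theorem residue_pow_eq_of_fixed {k : ℕ} (hk : k < r) {u : R} (hu : τ (π ^ k * u) = π ^ k * u) :
    residue R u ^ Q = residue R u ∧ τ u - u ∈ Ideal.span {π} := by
  have h1 : π ^ k * (τ u - u) = 0 := by
    rw [mul_sub, sub_eq_zero, ← hu, map_mul, map_pow, hfix]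
  have h2 : τ u - u ∈ Ideal.span {π} := Ideal.pow_le_self (Nat.sub_pos_of_lt hk).ne'
    (hann k hk.le _ h1)
  refine ⟨?_, h2⟩
  rw [← hQ, ← sub_eq_zero, ← map_sub, residue_eq_zero_iff, hmax]
  exact h2

include hmax hpow hann hfix hQ in
theorem finite_fixed_of_residue (hfin : {y : ResidueField R | y ^ Q = y}.Finite) :
    Finite ((τ : R →+* R).eqLocus (RingHom.id R)) := by
  have key : ∀ k ≤ r, {x : R | τ x = x ∧ x ∈ Ideal.span {π} ^ (r - k)}.Finite := by
    intro k
    induction k with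
    | zero =>
      intro _
      refine (Set.finite_singleton (0 : R)).subset fun x hx => ?_
      have h := hx.2
      rwa [Nat.sub_zero, Ideal.span_singleton_pow, hpow, Ideal.mem_span_singleton,
        zero_dvd_iff] at h
    | succ k ih =>
      intro hk
      have ih := ih (by omega)
      have hu : ∀ x : R, ∃ u, x ∈ Ideal.span {π} ^ (r - (k + 1)) → x = π ^ (r - (k + 1)) * u := by
        intro x
        by_cases hx : x ∈ Ideal.span {π} ^ (r - (k + 1))
        · rw [Ideal.span_singleton_pow, Ideal.mem_span_singleton] at hx
          obtain ⟨u, hu⟩ := hx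
          exact ⟨u, fun _ => hu⟩
        · exact ⟨0, fun h => absurd h hx⟩
      choose u hu using hu
      -- The residue of the leading coefficient is a solution of y^Q = y, and fixed elements with
      -- the same residue differ by a fixed element one layer deeper.
      refine Set.Finite.of_finite_fibers (fun x => residue R (u x)) (hfin.subset ?_) ?_
      · rintro _ ⟨x, ⟨hx1, hx2⟩, rfl⟩
        refine (residue_pow_eq_of_fixed hmax hann hfix hQ (k := r - (k + 1)) (by omega) ?_).1
        rw [← hu x hx2, hx1]
      · rintro _ ⟨x, ⟨hx1, hx2⟩, rfl⟩
        refine (ih.image (x + ·)).subset ?_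
        rintro y ⟨⟨hy1, hy2⟩, hy3⟩
        refine ⟨y - x, ⟨by rw [map_sub, hx1, hy1], ?_⟩, by simp⟩
        have h3 : u y - u x ∈ Ideal.span {π} := by
          rw [← hmax, ← residue_eq_zero_iff, map_sub, sub_eq_zero]
          exact hy3
        rw [hu x hx2, hu y hy2, ← mul_sub, show r - k = r - (k + 1) + 1 by omega, pow_succ]
        exact Ideal.mul_mem_mul (Ideal.pow_mem_pow (Ideal.mem_span_singleton_self π) _) h3
  refine Set.Finite.to_subtype ((key r le_rfl).subset fun x hx => ⟨hx, ?_⟩)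
  simp

include hmax hpow hann hfix hQ in
-- Write x = π^k u with u a unit. Although u need not be fixed, u^(Q^r) is fixed and has the same
-- residue, and π^(r-1) sees only residues; so π^(r-1-k) u^(-Q^r) works.
theorem exists_fixed_mul_eq_pow (hQπ : (Q : R) ∈ Ideal.span {π}) {x : R} (hx : τ x = x)
    (hx0 : x ≠ 0) : ∃ y, τ y = y ∧ x * y = π ^ (r - 1) := by
  classical
  have hex : ∃ k, x ∉ Ideal.span {π} ^ k := ⟨r, by
    rwa [Ideal.span_singleton_pow, hpow, Ideal.mem_span_singleton, zero_dvd_iff]⟩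
  obtain ⟨k, hk⟩ : ∃ k, Nat.find hex = k + 1 := by
    refine Nat.exists_eq_succ_of_ne_zero fun h => ?_
    have := Nat.find_spec hex
    rw [h] at this
    simp at this
  have hk1 : x ∈ Ideal.span {π} ^ k := not_not.1 (Nat.find_min hex (by omega))
  have hk2 : x ∉ Ideal.span {π} ^ (k + 1) := hk ▸ Nat.find_spec hex
  have hkr : k < r := by
    by_contra h
    have h1 := Ideal.pow_le_pow_right (I := Ideal.span {π}) (not_lt.1 h) hk1
    rw [Ideal.span_singleton_pow, hpow, Ideal.mem_span_singleton, zero_dvd_iff] at h1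
    exact hx0 h1
  rw [Ideal.span_singleton_pow, Ideal.mem_span_singleton] at hk1
  obtain ⟨u, rfl⟩ := hk1
  obtain ⟨h1, h2⟩ := residue_pow_eq_of_fixed hmax hann hfix hQ hkr hx
  have hunit : IsUnit u := by
    by_contra hu
    refine hk2 ?_
    rw [pow_succ]
    refine Ideal.mul_mem_mul (Ideal.pow_mem_pow (Ideal.mem_span_singleton_self π) _) ?_
    rw [← hmax]
    exact hu
  -- Each Q-th power improves the congruence τ u ≡ u by one power of π; r of them make it an
  -- equality.
  have hτ : τ (u ^ Q ^ r) = u ^ Q ^ r := by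
    have h3 := Ideal.pow_le_pow_right r.le_succ (pow_pow_sub_pow_pow_mem_span_pow hQπ h2 r)
    rw [Ideal.span_singleton_pow, hpow, Ideal.mem_span_singleton, zero_dvd_iff, sub_eq_zero] at h3
    rw [map_pow, h3]
  obtain ⟨a, ha⟩ := hunit.pow (Q ^ r)
  have hres : residue R u = residue R (a : R) := by
    rw [ha, map_pow]
    have : ∀ N : ℕ, residue R u ^ Q ^ N = residue R u := by
      intro N
      induction N with
      | zero => simp
      | succ N ih => rw [pow_succ, pow_mul, ih, h1]
    rw [this]
  have hdiff : u - a ∈ Ideal.span {π} := by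
    rw [← hmax, ← residue_eq_zero_iff, map_sub, hres, sub_self]
  have hzero : π ^ (r - 1) * (u - a) = 0 := by
    obtain ⟨c, hc⟩ := Ideal.mem_span_singleton.1 hdiff
    rw [hc, ← mul_assoc, ← pow_succ, Nat.sub_add_cancel (by omega), hpow, zero_mul]
  refine ⟨π ^ (r - 1 - k) * (↑a⁻¹ : R), ?_, ?_⟩
  · rw [map_mul, map_pow, hfix]
    congr 1
    have h4 : Units.map (τ : R →* R) a = a := Units.ext (by simpa [ha] using hτ)
    have h5 := congrArg (fun b : Rˣ => (↑b⁻¹ : R)) h4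
    simpa [← map_inv] using h5
  · have : π ^ k * u * (π ^ (r - 1 - k) * (↑a⁻¹ : R)) =
        π ^ (k + (r - 1 - k)) * ((u - a) + a) * (↑a⁻¹ : R) := by
      rw [pow_add]; ring
    rw [this, Nat.add_sub_cancel' (by omega), mul_add, hzero, zero_add, mul_assoc, Units.mul_inv,
      mul_one]

theorem isFrobeniusTruncated_of_card {σ : R ≃+* R} (hmax : maximalIdeal R = Ideal.span {π})
    (hpow : π ^ r = 0)
    (hann : ∀ j ≤ r, ∀ x, π ^ j * x = 0 → x ∈ Ideal.span {π} ^ (r - j)) (hfix : σ π = π)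
    {q : ℕ} (hq : 2 ≤ q) (hqπ : (q : R) ∈ Ideal.span {π})
    (hres : ∀ x, residue R (σ x) = residue R x ^ q)
    (hcard : ∀ a, 0 < a → {y : ResidueField R | y ^ q ^ a = y}.ncard = q ^ a) :
    IsFrobeniusTruncated π r q σ := by
  refine ⟨fun m hm => ?_, hq, hres, hcard⟩
  have hfixm := pow_fixed hfix m
  have hresm := residue_pow_apply hres m
  refine ⟨hmax, hpow, hann, hfixm, ?_, ?_, ?_⟩
  · refine finite_fixed_of_residue hmax hpow hann hfixm hresm (Set.finite_of_ncard_ne_zero ?_)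
    rw [hcard m hm]
    positivity
  · intro x hx hx0
    refine exists_fixed_mul_eq_pow hmax hpow hann hfixm hresm ?_ hx hx0
    rw [Nat.cast_pow]
    exact Ideal.pow_mem_of_mem _ hqπ m hm
  -- The residue field may be an extension of 𝔽_2, so the element other than 0 and 1 is found among
  -- the q² ≥ 4 solutions of y^(q²) = y.
  · have hlt : ({0, 1} : Set (ResidueField R)).ncard <
        {y : ResidueField R | y ^ q ^ 2 = y}.ncard := by
      rw [hcard 2 two_pos, Set.ncard_pair zero_ne_one]
      nlinarith
    obtain ⟨y, -, hy⟩ := Set.exists_mem_notMem_of_ncard_lt_ncard hlt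
    obtain ⟨u, rfl⟩ := residue_surjective y
    simp only [Set.mem_insert_iff, Set.mem_singleton_iff, not_or] at hy
    refine ⟨u, (residue_ne_zero_iff_isUnit u).1 hy.1, (residue_ne_zero_iff_isUnit _).1 ?_⟩
    rw [map_sub, map_one]
    exact sub_ne_zero.2 hy.2

end Truncation

/-! ### The rings `𝒪^ur_r` -/

section Level

open IsLocalRing

variable {O : Type*} [CommRing O] [IsDomain O] [IsDiscreteValuationRing O]

theorem unramifiedIdeal_eq_span {π : O} (hπ : maximalIdeal O = Ideal.span {π}) :
    unramifiedIdeal O = Ideal.span {algebraMap O (UnramifiedIntegers O) π} := by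
  rw [unramifiedIdeal, hπ, Ideal.map_span, Set.image_singleton]

theorem levelIdeal_eq_span {π : O} (hπ : maximalIdeal O = Ideal.span {π}) (r : ℕ) :
    levelIdeal O r = Ideal.span {algebraMap O (UnramifiedLevel O r) π} := by
  refine (congrArg (Ideal.map (Ideal.Quotient.mk (unramifiedIdeal O ^ r)))
    (unramifiedIdeal_eq_span hπ)).trans ?_
  rw [Ideal.map_span, Set.image_singleton]
  rfl

theorem algebraMap_level_pow_eq_zero {π : O} (hπ : maximalIdeal O = Ideal.span {π}) (r : ℕ) :
    algebraMap O (UnramifiedLevel O r) π ^ r = 0 := by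
  change Ideal.Quotient.mk (unramifiedIdeal O ^ r) (algebraMap O _ π) ^ r = 0
  rw [← map_pow, Ideal.Quotient.eq_zero_iff_mem]
  exact Ideal.pow_mem_pow (Ideal.mem_map_of_mem _ (hπ ▸ Ideal.mem_span_singleton_self π)) r

/-- Lift to the domain 𝒪^ur and cancel π^j from a divisibility by π^r. -/
theorem mem_span_pow_of_pow_mul_eq_zero {π : O} (hπ : maximalIdeal O = Ideal.span {π})
    (hπ0 : π ≠ 0) {r j : ℕ} (hj : j ≤ r) {x : UnramifiedLevel O r}
    (hx : algebraMap O (UnramifiedLevel O r) π ^ j * x = 0) :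
    x ∈ Ideal.span {algebraMap O (UnramifiedLevel O r) π} ^ (r - j) := by
  obtain ⟨s, rfl⟩ := Ideal.Quotient.mk_surjective x
  change Ideal.Quotient.mk (unramifiedIdeal O ^ r) (algebraMap O _ π) ^ j * _ = 0 at hx
  rw [← map_pow, ← map_mul, Ideal.Quotient.eq_zero_iff_mem, unramifiedIdeal_eq_span hπ,
    Ideal.span_singleton_pow, Ideal.mem_span_singleton] at hx
  obtain ⟨c, hc⟩ := hx
  have hϖ : algebraMap O (UnramifiedIntegers O) π ^ j ≠ 0 :=
    pow_ne_zero _ (by simpa using hπ0)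
  rw [← Nat.add_sub_cancel' hj, pow_add, mul_assoc] at hc
  rw [mul_left_cancel₀ hϖ hc, map_mul, map_pow, Ideal.span_singleton_pow]
  exact Ideal.mul_mem_right _ _ (Ideal.mem_span_singleton_self _)

theorem under_unramifiedIdeal : (unramifiedIdeal O).under O = maximalIdeal O := by
  refine le_antisymm (le_maximalIdeal ?_) Ideal.le_comap_map
  exact Ideal.comap_ne_top _ unramifiedIdeal_ne_top

variable [IsAdicComplete (maximalIdeal O) O] [Finite (ResidueField O)]

theorem isLocalRing_unramifiedLevel {r : ℕ} (hr : r ≠ 0) : IsLocalRing (UnramifiedLevel O r) := by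
  have : Nontrivial (UnramifiedLevel O r) := Ideal.Quotient.nontrivial_iff.2
    (ne_top_of_le_ne_top unramifiedIdeal_ne_top (Ideal.pow_le_self hr))
  exact IsLocalRing.of_surjective' _ Ideal.Quotient.mk_surjective

theorem maximalIdeal_unramifiedLevel {r : ℕ} [IsLocalRing (UnramifiedLevel O r)] {π : O}
    (hπ : maximalIdeal O = Ideal.span {π}) :
    maximalIdeal (UnramifiedLevel O r) = Ideal.span {algebraMap O (UnramifiedLevel O r) π} := by
  refine le_antisymm (fun x hx => ?_) ?_
  · obtain ⟨s, rfl⟩ := Ideal.Quotient.mk_surjective x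
    rw [← levelIdeal_eq_span hπ]
    exact Ideal.mem_map_of_mem _ ((isUnit_or_mem_unramifiedIdeal s).resolve_left fun hu =>
      hx (hu.map _))
  · rw [Ideal.span_le, Set.singleton_subset_iff]
    refine Ideal.IsPrime.mem_of_pow_mem inferInstance r ?_
    rw [algebraMap_level_pow_eq_zero hπ]
    exact zero_mem _

theorem isFrobeniusTruncated_levelAut
    {φ : UnramifiedIntegers O ≃ₐ[O] UnramifiedIntegers O} (hφ : IsFrobenius φ) {r : ℕ}
    [IsLocalRing (UnramifiedLevel O r)] {π : O} (hπ : maximalIdeal O = Ideal.span {π})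
    (hπ0 : π ≠ 0) :
    IsFrobeniusTruncated (algebraMap O (UnramifiedLevel O r) π) r (Nat.card (ResidueField O))
      (levelAut φ r) := by
  have hmax := maximalIdeal_unramifiedLevel (r := r) hπ
  refine isFrobeniusTruncated_of_card hmax (algebraMap_level_pow_eq_zero hπ r)
    (fun j hj x hx => mem_span_pow_of_pow_mul_eq_zero hπ hπ0 hj hx) ?_ Finite.one_lt_card ?_ ?_ ?_
  · change Ideal.Quotient.mk _ (φ (algebraMap O _ π)) = _
    rw [φ.commutes]
    rfl
  · rw [← levelIdeal_eq_span hπ, ← map_natCast (Ideal.Quotient.mk (unramifiedIdeal O ^ r))]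
    exact Ideal.mem_map_of_mem _ card_residueField_mem_map
  · intro x
    obtain ⟨s, rfl⟩ := Ideal.Quotient.mk_surjective x
    have h := hφ s
    rw [under_unramifiedIdeal] at h
    rw [← map_pow]
    refine Ideal.Quotient.eq.2 ?_
    rw [hmax, ← levelIdeal_eq_span hπ]
    exact Ideal.mem_map_of_mem (Ideal.Quotient.mk (unramifiedIdeal O ^ r)) h
  · intro a ha
    refine ncard_pow_card_eq ((residue (UnramifiedLevel O r)).comp (Ideal.Quotient.mk _))
      (fun x hx => ?_) ha
    rw [RingHom.comp_apply, residue_eq_zero_iff, hmax, ← levelIdeal_eq_span hπ]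
    exact Ideal.mem_map_of_mem _ (Ideal.mem_map_of_mem _ hx)

end Level

end

/-! ### The main theorem -/

theorem mainTheorem7 {O : Type*} [CommRing O] [IsDomain O] [IsDiscreteValuationRing O]
    [IsAdicComplete (IsLocalRing.maximalIdeal O) O] [Finite (IsLocalRing.ResidueField O)]
    (φ : UnramifiedIntegers O ≃ₐ[O] UnramifiedIntegers O) (hφ : IsFrobenius φ)
    (ℓ : ℕ) [Fact ℓ.Prime] (hℓ : (ℓ : IsLocalRing.ResidueField O) ≠ 0)
    (r : ℕ) (hr : 1 < r) (n : ℕ)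
    (T : MaximalTorus n (UnramifiedLevel O r)) (hT : T.IsStable (frobEnd φ r n)) :
    (∀ θ : TorusIrr T (frobEnd φ r n) (AlgebraicClosure ℚ_[ℓ]),
      (IsRegularChar (levelIdeal O r) r θ ↔ IsGenericChar (levelIdeal O r) r θ) ∧
      (IsGenericChar (levelIdeal O r) r θ ↔ IsStronglyGenericChar (levelIdeal O r) r θ)) ∧
    Filter.Tendsto
      (fun m : ℕ =>
        (Nat.card {θ : TorusIrr T (frobEnd φ r n ^ m) (AlgebraicClosure ℚ_[ℓ]) //
            IsStronglyGenericChar (levelIdeal O r) r θ} : ℝ) /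
          (Nat.card (TorusIrr T (frobEnd φ r n ^ m) (AlgebraicClosure ℚ_[ℓ])) : ℝ))
      Filter.atTop (nhds 1) := by
  obtain ⟨π, hπ⟩ := IsDiscreteValuationRing.exists_irreducible O
  have := isLocalRing_unramifiedLevel (O := O) (Nat.ne_of_gt (zero_lt_one.trans hr))
  rw [levelIdeal_eq_span hπ.maximalIdeal_eq]
  have : CharZero (AlgebraicClosure ℚ_[ℓ]) :=
    charZero_of_injective_algebraMap (algebraMap ℚ_[ℓ] (AlgebraicClosure ℚ_[ℓ])).injective
  exact (isFrobeniusTruncated_levelAut hφ hπ.maximalIdeal_eq hπ.ne_zero).main hr rfl hT _
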